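/- Let $\mathcal X$ be a nonempty measurable space, $\mathcal Y=[-1,1]$, $\mathcal Z=\mathcal X\times\mathcal Y$, and let $\mathcal F\subseteq\mathcal Y^{\mathcal X}$ be a nonempty pointwise measurable class: every $f\in\mathcal F$ is measurable and is the pointwise limit of a sequence from one fixed countable subclass $\mathcal F_0\subseteq\mathcal F$. Use the absolute loss $\ell((x,y),f)=|y-f(x)|$ and write $\ell(P,f)=\mathbb E_{z\sim P}\,\ell(z,f)$ for a distribution $P$ on $\mathcal Z$. A sequence of learning rules $\hat f_{0:n-1}$ consists of (jointly measurable) rules $\hat f_t$ that take $z_{1:t}\in\mathcal Z^t$ and internal randomness, and output a function in $\mathcal F$. Set $$V^{\mathrm{online}}_n(\mathcal F)=\inf_{\hat f_{0:n-1}}\ \sup_{z_{1:n}\in\mathcal Z^n}\ \mathbb E\Big[\tfrac1n\Big(\sum_{t=1}^n \ell(z_t,\hat f_{t-1})-\inf_{f\in\mathcal F}\sum_{t=1}^n\ell(z_t,f)\Big)\Big],$$ $$V^{\mathrm{preq}}_n(\mathcal F)=\inf_{\hat f_{0:n-1}}\ \sup_{\mathbb P}\ \mathbb E\Big[\tfrac1n\sum_{t=1}^n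 \ell(P_t,\hat f_{t-1})-\inf_{f\in\mathcal F}\tfrac1n\sum_{t=1}^n\ell(P_t,f)\Big],$$ where $\mathbb P$ ranges over all joint distributions of $Z_{1:n}$ on $\mathcal Z^n$ (for which regular conditional distributions exist), $P_t=\mathbb P(\cdot\mid Z_{1:t-1})$, and the expectations include the internal randomness of the rules. Then the following are equivalent: 1. $\mathcal F$ is prequentially learnable: $\limsup_{n\to\infty}V^{\mathrm{preq}}_n(\mathcal F)=0$. 2. $\mathcal F$ is online learnable: $\limsup_{n\to\infty}V^{\mathrm{online}}_n(\mathcal F)=0$. 3. The uniform martingale law of large numbers holds: $$\limsup_{n\to\infty}\ \sup_{\mathbb P,\mathcal A}\ \mathbb E\sup_{f\in\mathcal F}\Big|\tfrac1n\sum_{t=1}^n\big(f(X_t)-\mathbb E[f(X_t)\mid\mathcal A_{t-1}]\big)\Big|=0,$$ the supremum being over all probability spaces with a filtration $(\mathcal A_t)$ and an $\mathcal X$-valued process with $X_t$ $\mathcal A_t$-measurable, the conditional expectations being computed from regular conditional distributions of $X_t$ given $\mathcal A_{t-1}$ (whose existence is part of the setting; it is automatic if $\mathcal X$ is standard Borel).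 4. For every $\gamma>0$, $\mathrm{sfat}_\gamma(\mathcal F)<\infty$. Here $\mathrm{sfat}_\gamma(\mathcal F)$ is the supremum of the depths $n$ of the complete binary trees $\mathbf x=(\mathbf x_t:\{\pm1\}^{t-1}\to\mathcal X)_{t\le n}$ for which there is a real valued tree $\mathbf s$ such that for all $\epsilon\in\{\pm1\}^n$ there is $f\in\mathcal F$ with $\epsilon_t\big(f(\mathbf x_t(\epsilon_{1:t-1}))-\mathbf s_t(\epsilon_{1:t-1})\big)\ge\gamma$ for all $t\le n$. 5. The sequential Rademacher complexity vanishes: $$\limsup_{n\to\infty}\ \sup_{\mathbf x}\ \mathbb E_\epsilon\sup_{f\in\mathcal F}\tfrac1n\sum_{t=1}^n\epsilon_t f(\mathbf x_t(\epsilon_{1:t-1}))=0,$$ where $\epsilon_1,\dots,\epsilon_n$ are i.i.d. uniform signs and $\mathbf x$ ranges over $\mathcal X$-valued complete binary trees of depth $n$. -/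

import Mathlib

open MeasureTheory ProbabilityTheory Filter Topology

universe u v

noncomputable section

namespace PreqRegression

/-- The output space `[-1, 1]`. -/
abbrev Y : Type := Set.Icc (-1 : ℝ) 1

/-- The space of input-output pairs `z = (x, y)`. -/
abbrev Z (𝒳 : Type u) : Type u := 𝒳 × Y

/-- The part of a sequence of length `n` that precedes time `t`
(times are numbered `0, …, n - 1`). -/
def past {α : Type*} {n : ℕ} (t : Fin n) (z : Fin n → α) : Fin t → α :=
  fun i => z ⟨i, i.2.trans t.2⟩

/-- Signs `±1`, coded by Booleans. -/
def sgn (b : Bool) : ℝ := if b then 1 else -1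

/-- The absolute loss `|y - f x|`. -/
def absLoss {𝒳 : Type u} (f : 𝒳 → Y) (z : Z 𝒳) : ℝ := |(z.2 : ℝ) - (f z.1 : ℝ)|

/-- The expected absolute loss `ℓ(P, f)`. -/
def risk {𝒳 : Type u} [MeasurableSpace 𝒳] (P : Measure (Z 𝒳)) (f : 𝒳 → Y) : ℝ :=
  ∫ z, absLoss f z ∂P

/-! ### Trees, sequential fat-shattering dimension, sequential Rademacher complexity -/

/-- A complete binary tree of depth `n` with labels in `α`: the node at level `t` is determined
by the `t` signs that lead to it. -/
abbrev BinTree (α : Type*) (n : ℕ) : Type _ := (t : Fin n) → (Fin t → Bool) → α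

/-- The tree `x` is `γ`-shattered by `F`, for some real valued witness tree `s`. -/
def Shattered {𝒳 : Type u} (F : Set (𝒳 → Y)) (γ : ℝ) {n : ℕ} (x : BinTree 𝒳 n) : Prop :=
  ∃ s : BinTree ℝ n, ∀ ε : Fin n → Bool, ∃ f ∈ F, ∀ t : Fin n,
    γ ≤ sgn (ε t) * ((f (x t (past t ε)) : ℝ) - s t (past t ε))

/-- The sequential fat-shattering dimension of `F` at scale `γ`. -/
def sfat {𝒳 : Type u} (F : Set (𝒳 → Y)) (γ : ℝ) : ℕ∞ :=
  ⨆ n ∈ {n : ℕ | ∃ x : BinTree 𝒳 n, Shattered F γ x}, (n : ℕ∞)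

/-- The sequential Rademacher complexity of `F` on the tree `x`. -/
def seqRadOn {𝒳 : Type u} (F : Set (𝒳 → Y)) {n : ℕ} (x : BinTree 𝒳 n) : ℝ :=
  (1 / 2 ^ n : ℝ) * ∑ ε : Fin n → Bool,
    ⨆ f : F, (1 / n : ℝ) * ∑ t : Fin n, sgn (ε t) * ((f : 𝒳 → Y) (x t (past t ε)) : ℝ)

/-- The sequential Rademacher complexity of `F`. -/
def seqRad {𝒳 : Type u} (F : Set (𝒳 → Y)) (n : ℕ) : ℝ :=
  ⨆ x : BinTree 𝒳 n, seqRadOn F x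

/-! ### Learning rules and online learnability -/

/-- A sequence of `n` (randomized, proper, measurable) learning rules: the function used at time
`t` is a member of `F` that depends on the pairs seen before `t` and on an internal random seed,
which may live on any probability space. -/
structure LearningRule {𝒳 : Type u} [MeasurableSpace 𝒳] (F : Set (𝒳 → Y)) (n : ℕ) where
  Seed : Type
  [seedSpace : MeasurableSpace Seed]
  seedLaw : Measure Seed
  [seedProb : IsProbabilityMeasure seedLaw]
  rule : (t : Fin n) → (Fin t → Z 𝒳) → Seed → F
  measurable_rule : ∀ t : Fin n, Measurable
    fun p : (Fin t → Z 𝒳) × Seed × 𝒳 => (rule t p.1 p.2.1 : 𝒳 → Y) p.2.2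

attribute [instance] LearningRule.seedSpace LearningRule.seedProb

/-- The expected normalized regret of a sequence of learning rules on the sequence `z`. -/
def onlineRegret {𝒳 : Type u} [MeasurableSpace 𝒳] {F : Set (𝒳 → Y)} {n : ℕ}
    (R : LearningRule F n) (z : Fin n → Z 𝒳) : ℝ :=
  ∫ r, ((1 / n : ℝ) * ((∑ t : Fin n, absLoss (R.rule t (past t z) r) (z t))
    - ⨅ f : F, ∑ t : Fin n, absLoss (f : 𝒳 → Y) (z t))) ∂(R.seedLaw)

/-- The minimax value of the online game. -/
def onlineValue {𝒳 : Type u} [MeasurableSpace 𝒳] (F : Set (𝒳 → Y)) (n : ℕ) : ℝ :=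
  ⨅ R : LearningRule F n, ⨆ z : Fin n → Z 𝒳, onlineRegret R z

def OnlineLearnable {𝒳 : Type u} [MeasurableSpace 𝒳] (F : Set (𝒳 → Y)) : Prop :=
  limsup (onlineValue F) atTop = 0

/-! ### The uniform martingale law of large numbers -/

/-- A filtered probability space with a process `X 0, …, X (n - 1)` such that `X t` is measurable
with respect to `𝓐 (t + 1)`, and regular versions `cond t` of the conditional distributions of
`X t` given `𝓐 t`. (Regular versions exist always when `𝒳` is standard Borel. Conditional
expectations `E[f (X t) | 𝓐 t]` are computed from them, so that they are defined
for all `f` simultaneously.) -/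
structure FilteredProcess (𝒳 : Type u) [MeasurableSpace 𝒳] (n : ℕ) where
  Ω : Type v
  [space : MeasurableSpace Ω]
  μ : Measure Ω
  [prob : IsProbabilityMeasure μ]
  𝓐 : Filtration ℕ space
  X : Fin n → Ω → 𝒳
  adapted : ∀ t : Fin n, Measurable[𝓐 ((t : ℕ) + 1)] (X t)
  cond : Fin n → Ω → Measure 𝒳
  cond_prob : ∀ t ω, IsProbabilityMeasure (cond t ω)
  cond_measurable : ∀ t : Fin n, Measurable[𝓐 t] (cond t)
  cond_eq : ∀ (t : Fin n) (B : Set 𝒳), MeasurableSet B →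
    (fun ω => (cond t ω).real B) =ᵐ[μ] μ⟦X t ⁻¹' B | 𝓐 t⟧

attribute [instance] FilteredProcess.space FilteredProcess.prob

/-- `E sup_{f ∈ F} |(1/n) ∑ₜ (f(Xₜ) - E[f(Xₜ) | 𝓐ₜ₋₁])|`. -/
def martingaleDeviation {𝒳 : Type u} [MeasurableSpace 𝒳] (F : Set (𝒳 → Y)) {n : ℕ}
    (S : FilteredProcess.{u, v} 𝒳 n) : ℝ :=
  ∫ ω, ⨆ f : F, |(1 / n : ℝ) * ∑ t : Fin n,
    (((f : 𝒳 → Y) (S.X t ω) : ℝ) - ∫ x, ((f : 𝒳 → Y) x : ℝ) ∂(S.cond t ω))| ∂S.μ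

/-- The uniform martingale law of large numbers for `F`. -/
def UMLLN {𝒳 : Type u} [MeasurableSpace 𝒳] (F : Set (𝒳 → Y)) : Prop :=
  limsup (fun n : ℕ => ⨆ S : FilteredProcess.{u, v} 𝒳 n, martingaleDeviation F S) atTop = 0

/-! ### Prequential learnability -/

/-- A joint distribution `law` of `Z_0, …, Z_{n-1}` together with (a version of) the conditional
distributions `cond t` of `Z_t` given the past. (These exist always when `𝒳` is standard
Borel.) -/
structure JointLaw (𝒳 : Type u) [MeasurableSpace 𝒳] (n : ℕ) where
  law : Measure (Fin n → Z 𝒳)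
  [prob : IsProbabilityMeasure law]
  cond : (t : Fin n) → Kernel (Fin t → Z 𝒳) (Z 𝒳)
  [markov : ∀ t, IsMarkovKernel (cond t)]
  cond_eq : ∀ t : Fin n, (law.map (past t)) ⊗ₘ (cond t) = law.map (fun z => (past t z, z t))

attribute [instance] JointLaw.prob JointLaw.markov

/-- The expectation, over the process and the internal randomness of the rules, of
`(1/n) ∑ₜ ℓ(Pₜ, f̂ₜ₋₁) - inf_{f ∈ F} (1/n) ∑ₜ ℓ(Pₜ, f)`. -/
def preqRegret {𝒳 : Type u} [MeasurableSpace 𝒳] {F : Set (𝒳 → Y)} {n : ℕ}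
    (R : LearningRule F n) (P : JointLaw 𝒳 n) : ℝ :=
  ∫ p : (Fin n → Z 𝒳) × R.Seed,
    (((1 / n : ℝ) * ∑ t : Fin n, risk (P.cond t (past t p.1)) (R.rule t (past t p.1) p.2))
      - ⨅ f : F, (1 / n : ℝ) * ∑ t : Fin n, risk (P.cond t (past t p.1)) (f : 𝒳 → Y))
    ∂(P.law.prod R.seedLaw)

/-- The minimax value of the prequential game. -/
def preqValue {𝒳 : Type u} [MeasurableSpace 𝒳] (F : Set (𝒳 → Y)) (n : ℕ) : ℝ :=
  ⨅ R : LearningRule F n, ⨆ P : JointLaw 𝒳 n, preqRegret R P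

def PrequentiallyLearnable {𝒳 : Type u} [MeasurableSpace 𝒳] (F : Set (𝒳 → Y)) : Prop :=
  limsup (preqValue F) atTop = 0

/-! ### Measurability of the class -/

/-- `F` is a pointwise measurable class: its members are measurable, and each of them is the
pointwise limit of a sequence from one fixed countable subclass. This makes the suprema and infima
over `F` under the expectations measurable. -/
structure PointwiseMeasurable {𝒳 : Type u} [MeasurableSpace 𝒳] (F : Set (𝒳 → Y)) : Prop where
  measurable : ∀ f ∈ F, Measurable f
  separable : ∃ F₀ ⊆ F, F₀.Countable ∧ ∀ f ∈ F, ∃ g : ℕ → 𝒳 → Y,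
    (∀ k, g k ∈ F₀) ∧ ∀ x, Tendsto (fun k => g k x) atTop (𝓝 (f x))

end PreqRegression

end

noncomputable section

namespace PreqRegression

/-! ### The conditional sequential Rademacher functional -/

/-! The implications 1 → 2 → 5 → 4 and 3 → 5 are lower bounds. A deterministic sequence is a special
joint law. An adversary that labels the nodes of a tree with random signs makes every rule suffer
expected loss 1 per round, while the best function gains the Rademacher sum. A process that tosses a
fair coin between the current node and a fixed point does the same for the martingale law, up to a
vanishing term. A tree shattered at scale `γ` has complexity at least `γ`.

The substance is 4 → 1 and 4 → 3. Both rest on `condRad a k φ`, the unnormalized complexity of `k`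
further rounds started from the potential `φ`. By symmetrization (`integral_condRad_le`), a centred
random step followed by `k` rounds costs on average no more than `k + 1` rounds. Peeling off rounds
from the end bounds the expected uniform deviation of any process from its conditional means by
`condRad a n 0` (`integral_iSup_sum_le`).

Finite dimension makes `condRad a n 0` sublinear (`eventually_condRad_le`). Instead of covering
numbers, `expRad_le` follows an exponential moment: at each queried point the class is cut into
value cells of width `γ`. The cells that still shatter to the old depth lie close together and are
merged; every other cell has smaller dimension. This is the Sauer–Shelah recursion, with a Hoeffding
factor per round for the oscillation inside a piece.

For learning, `condRad` serves as a relaxation: the learner wants a mixed action whose expected loss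
plus the next potential is at most the current potential, whatever the outcome. Against a known
distribution, symmetrization provides one. Exchanging the quantifiers needs a minimax theorem for an
infinite game without compactness, and sublinearity itself supplies it (`exists_mix_le`): were the
exchange impossible, finite minimax theorems would produce an infinite threshold array of
distributions and mixed actions, and bisection in it forces linear growth (`add_mul_le_condRad`).
Finally, the regret in conditional risks is at most the regret in realized losses plus a martingale
deviation of the losses (`preqRegret_mixtureRule_le`).

Measurability is kept by countability: a sequence dense for pointwise limits replaces the class, a
sequence of outcomes with dense loss vectors replaces the adversary's moves, and a countable family
of laws replaces the mixed actions. -/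

/-- The conditional sequential Rademacher functional: with `k` rounds to go, the current potential
`φ` is modified by `± 2 a m`, where `m` is chosen by the adversary and the sign is random. -/
def condRad {I : Type*} (a : ℕ → I → ℝ) : ℕ → (I → ℝ) → ℝ
  | 0, φ => ⨆ i, φ i
  | k + 1, φ => ⨆ m, (condRad a k (φ + (2 : ℝ) • a m) + condRad a k (φ - (2 : ℝ) • a m)) / 2

section condRad

variable {I : Type*} {a : ℕ → I → ℝ}

theorem abs_add_two_smul_le {φ u : I → ℝ} {C : ℝ} (hφ : ∀ i, |φ i| ≤ C) (hu : ∀ i, |u i| ≤ 2)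
    (i : I) : |(φ + (2 : ℝ) • u) i| ≤ C + 4 := by
  have h1 := abs_le.1 (hφ i)
  have h2 := abs_le.1 (hu i)
  simp only [Pi.add_apply, Pi.smul_apply, smul_eq_mul]
  rw [abs_le]; constructor <;> linarith

theorem abs_sub_two_smul_le {φ u : I → ℝ} {C : ℝ} (hφ : ∀ i, |φ i| ≤ C) (hu : ∀ i, |u i| ≤ 2)
    (i : I) : |(φ - (2 : ℝ) • u) i| ≤ C + 4 := by
  have h1 := abs_le.1 (hφ i)
  have h2 := abs_le.1 (hu i)
  simp only [Pi.sub_apply, Pi.smul_apply, smul_eq_mul]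
  rw [abs_le]; constructor <;> linarith

theorem bddAbove_of_abs_le {ι : Sort*} {f : ι → ℝ} {C : ℝ} (h : ∀ i, |f i| ≤ C) :
    BddAbove (Set.range f) :=
  ⟨C, by rintro _ ⟨i, rfl⟩; exact (abs_le.1 (h i)).2⟩

theorem bddBelow_of_abs_le {ι : Sort*} {f : ι → ℝ} {C : ℝ} (h : ∀ i, |f i| ≤ C) :
    BddBelow (Set.range f) :=
  ⟨-C, by rintro _ ⟨i, rfl⟩; exact (abs_le.1 (h i)).1⟩

theorem abs_ciSup_le {ι : Sort*} [Nonempty ι] {f : ι → ℝ} {C : ℝ} (h : ∀ i, |f i| ≤ C) :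
    |⨆ i, f i| ≤ C := by
  obtain ⟨i⟩ := ‹Nonempty ι›
  have : Nonempty ι := ⟨i⟩
  rw [abs_le]
  exact ⟨(abs_le.1 (h i)).1.trans (le_ciSup (bddAbove_of_abs_le h) i),
    ciSup_le fun i => (abs_le.1 (h i)).2⟩

theorem abs_ciInf_le {ι : Sort*} [Nonempty ι] {f : ι → ℝ} {C : ℝ} (h : ∀ i, |f i| ≤ C) :
    |⨅ i, f i| ≤ C := by
  obtain ⟨i⟩ := ‹Nonempty ι›
  have : Nonempty ι := ⟨i⟩
  rw [abs_le]
  exact ⟨le_ciInf fun i => (abs_le.1 (h i)).1,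
    (ciInf_le (bddBelow_of_abs_le h) i).trans (abs_le.1 (h i)).2⟩

theorem condRad_neg (k : ℕ) (φ : I → ℝ) : condRad (fun m => -a m) k φ = condRad a k φ := by
  induction k generalizing φ with
  | zero => rfl
  | succ k ih => simp only [condRad, ih, smul_neg, sub_neg_eq_add, ← sub_eq_add_neg, add_comm]

/-- All suprema involved are countable; this is why moves are indexed by `ℕ` and the class by a
countable type. -/
theorem measurable_condRad [Countable I] {S : Type*} [MeasurableSpace S] (k : ℕ)
    {ψ : S → I → ℝ} (hψ : ∀ i, Measurable fun s => ψ s i) :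
    Measurable fun s => condRad a k (ψ s) := by
  induction k generalizing ψ with
  | zero => exact Measurable.iSup hψ
  | succ k ih =>
    refine Measurable.iSup fun m => ((ih fun i => ?_).add (ih fun i => ?_)).div_const 2
    · exact (hψ i).add_const _
    · exact (hψ i).sub_const _

variable [Nonempty I]

theorem abs_condRad_le (ha : ∀ m i, |a m i| ≤ 2) (k : ℕ) {φ : I → ℝ} {C : ℝ}
    (hφ : ∀ i, |φ i| ≤ C) : |condRad a k φ| ≤ C + 4 * k := by
  induction k generalizing φ C with
  | zero => simpa [condRad] using abs_ciSup_le hφ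
  | succ k ih =>
    refine abs_ciSup_le fun m => ?_
    have h1 := abs_le.1 (ih (abs_add_two_smul_le hφ (ha m)))
    have h2 := abs_le.1 (ih (abs_sub_two_smul_le hφ (ha m)))
    push_cast
    rw [abs_le]; constructor <;> linarith

theorem abs_half_condRad_le (ha : ∀ m i, |a m i| ≤ 2) (k : ℕ) {φ u : I → ℝ} {C : ℝ}
    (hφ : ∀ i, |φ i| ≤ C) (hu : ∀ i, |u i| ≤ 2) :
    |(condRad a k (φ + (2 : ℝ) • u) + condRad a k (φ - (2 : ℝ) • u)) / 2| ≤ C + 4 + 4 * k := by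
  have h1 := abs_le.1 (abs_condRad_le ha k (abs_add_two_smul_le hφ hu))
  have h2 := abs_le.1 (abs_condRad_le ha k (abs_sub_two_smul_le hφ hu))
  rw [abs_le]; constructor <;> linarith

theorem bddAbove_condRad (ha : ∀ m i, |a m i| ≤ 2) (k : ℕ) {φ : I → ℝ} {C : ℝ}
    (hφ : ∀ i, |φ i| ≤ C) : BddAbove (Set.range fun m =>
      (condRad a k (φ + (2 : ℝ) • a m) + condRad a k (φ - (2 : ℝ) • a m)) / 2) :=
  bddAbove_of_abs_le fun m => abs_half_condRad_le ha k hφ (ha m)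

theorem condRad_mono (ha : ∀ m i, |a m i| ≤ 2) (k : ℕ) {φ ψ : I → ℝ} {C : ℝ}
    (hψ : ∀ i, |ψ i| ≤ C) (h : φ ≤ ψ) : condRad a k φ ≤ condRad a k ψ := by
  induction k generalizing φ ψ C with
  | zero => exact ciSup_mono (bddAbove_of_abs_le hψ) h
  | succ k ih =>
    refine ciSup_mono (bddAbove_condRad ha k hψ) fun m => ?_
    have h1 := ih (abs_add_two_smul_le hψ (ha m)) (add_le_add_left h ((2 : ℝ) • a m))
    have h2 := ih (abs_sub_two_smul_le hψ (ha m)) (sub_le_sub_right h ((2 : ℝ) • a m))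
    linarith

theorem condRad_add_const (ha : ∀ m i, |a m i| ≤ 2) (k : ℕ) {φ : I → ℝ} {C : ℝ}
    (hφ : ∀ i, |φ i| ≤ C) (c : ℝ) :
    condRad a k (φ + fun _ => c) = condRad a k φ + c := by
  induction k generalizing φ C with
  | zero => exact (ciSup_add (bddAbove_of_abs_le hφ) c).symm
  | succ k ih =>
    simp only [condRad]
    rw [ciSup_add (bddAbove_condRad ha k hφ) c]
    congr 1; funext m
    rw [add_right_comm, ih (abs_add_two_smul_le hφ (ha m)), add_sub_right_comm,
      ih (abs_sub_two_smul_le hφ (ha m))]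
    ring

theorem integrable_condRad [Countable I] (ha : ∀ m i, |a m i| ≤ 2) {S : Type*} [MeasurableSpace S]
    (P : Measure S) [IsFiniteMeasure P] (k : ℕ) {ψ : S → I → ℝ}
    (hψ : ∀ i, Measurable fun s => ψ s i) {C : ℝ} (hC : ∀ s i, |ψ s i| ≤ C) :
    Integrable (fun s => condRad a k (ψ s)) P :=
  Integrable.of_bound (measurable_condRad k hψ).aestronglyMeasurable (C + 4 * k)
    (.of_forall fun s => abs_condRad_le ha k (hC s))

theorem abs_integral_le_of_abs_le {S : Type*} [MeasurableSpace S] (P : Measure S)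
    [IsProbabilityMeasure P] {f : S → ℝ} {C : ℝ} (h : ∀ s, |f s| ≤ C) : |∫ s, f s ∂P| ≤ C := by
  simpa using norm_integral_le_of_norm_le_const (μ := P) (f := f) (C := C) (.of_forall h)

/-- Jensen's inequality for `condRad`. -/
theorem condRad_integral_le [Countable I] (ha : ∀ m i, |a m i| ≤ 2) {S : Type*} [MeasurableSpace S]
    (P : Measure S) [IsProbabilityMeasure P] (k : ℕ) {ψ : S → I → ℝ}
    (hψ : ∀ i, Measurable fun s => ψ s i) {C : ℝ} (hC : ∀ s i, |ψ s i| ≤ C) :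
    condRad a k (fun i => ∫ s, ψ s i ∂P) ≤ ∫ s, condRad a k (ψ s) ∂P := by
  induction k generalizing ψ C with
  | zero =>
    refine ciSup_le fun i => integral_mono ?_ (integrable_condRad ha P 0 hψ hC) fun s =>
      le_ciSup (bddAbove_of_abs_le (hC s)) i
    exact .of_bound (hψ i).aestronglyMeasurable C (.of_forall fun s => hC s i)
  | succ k ih =>
    refine ciSup_le fun m => ?_
    have int : ∀ i, Integrable (fun s => ψ s i) P := fun i =>
      .of_bound (hψ i).aestronglyMeasurable C (.of_forall fun s => hC s i)
    have hp : ∀ i, Measurable fun s => (ψ s + (2 : ℝ) • a m) i := fun i => (hψ i).add_const _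
    have hm : ∀ i, Measurable fun s => (ψ s - (2 : ℝ) • a m) i := fun i => (hψ i).sub_const _
    have hp' : ∀ s i, |(ψ s + (2 : ℝ) • a m) i| ≤ C + 4 := fun s =>
      abs_add_two_smul_le (hC s) (ha m)
    have hm' : ∀ s i, |(ψ s - (2 : ℝ) • a m) i| ≤ C + 4 := fun s =>
      abs_sub_two_smul_le (hC s) (ha m)
    have h1 := ih hp hp'
    have h2 := ih hm hm'
    have e1 : (fun i => ∫ s, (ψ s + (2 : ℝ) • a m) i ∂P)
        = (fun i => ∫ s, ψ s i ∂P) + (2 : ℝ) • a m := by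
      funext i
      simp only [Pi.add_apply]
      rw [integral_add (int i) (integrable_const _)]; simp
    have e2 : (fun i => ∫ s, (ψ s - (2 : ℝ) • a m) i ∂P)
        = (fun i => ∫ s, ψ s i ∂P) - (2 : ℝ) • a m := by
      funext i
      simp only [Pi.sub_apply]
      rw [integral_sub (int i) (integrable_const _)]; simp
    rw [e1] at h1
    rw [e2] at h2
    have i1 := integrable_condRad ha P k hp hp'
    have i2 := integrable_condRad ha P k hm hm'
    calc _ ≤ ((∫ s, condRad a k (ψ s + (2 : ℝ) • a m) ∂P)
          + ∫ s, condRad a k (ψ s - (2 : ℝ) • a m) ∂P) / 2 := by linarith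
      _ = ∫ s, (condRad a k (ψ s + (2 : ℝ) • a m) + condRad a k (ψ s - (2 : ℝ) • a m)) / 2 ∂P := by
          rw [integral_div, integral_add i1 i2]
      _ ≤ _ := integral_mono ((i1.add i2).div_const 2) (integrable_condRad ha P (k + 1) hψ hC)
          fun s => le_ciSup (bddAbove_condRad ha k (hC s)) m

/-- Suprema and averages of convex functions are convex; only midpoints are needed for
symmetrization. -/
theorem condRad_midpoint_le (ha : ∀ m i, |a m i| ≤ 2) (k : ℕ) {φ ψ : I → ℝ} {C : ℝ}
    (hφ : ∀ i, |φ i| ≤ C) (hψ : ∀ i, |ψ i| ≤ C) :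
    condRad a k (fun i => (φ i + ψ i) / 2) ≤ (condRad a k φ + condRad a k ψ) / 2 := by
  induction k generalizing φ ψ C with
  | zero =>
    refine ciSup_le fun i => ?_
    have h1 := le_ciSup (bddAbove_of_abs_le hφ) i
    have h2 := le_ciSup (bddAbove_of_abs_le hψ) i
    simp only [condRad]
    linarith
  | succ k ih =>
    refine ciSup_le fun m => ?_
    have h1 := le_ciSup (bddAbove_condRad ha k hφ) m
    have h2 := le_ciSup (bddAbove_condRad ha k hψ) m
    have h3 := ih (abs_add_two_smul_le hφ (ha m)) (abs_add_two_smul_le hψ (ha m))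
    have h4 := ih (abs_sub_two_smul_le hφ (ha m)) (abs_sub_two_smul_le hψ (ha m))
    have e3 : (fun i => ((φ + (2 : ℝ) • a m) i + (ψ + (2 : ℝ) • a m) i) / 2)
        = (fun i => (φ i + ψ i) / 2) + (2 : ℝ) • a m := by
      funext i; simp only [Pi.add_apply]; ring
    have e4 : (fun i => ((φ - (2 : ℝ) • a m) i + (ψ - (2 : ℝ) • a m) i) / 2)
        = (fun i => (φ i + ψ i) / 2) - (2 : ℝ) • a m := by
      funext i; simp only [Pi.sub_apply]; ring
    rw [e3] at h3
    rw [e4] at h4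
    simp only [condRad] at h1 h2 ⊢
    linarith

/-- `condRad` is lower semicontinuous for pointwise convergence of bounded functions. -/
theorem eventually_lt_condRad (ha : ∀ m i, |a m i| ≤ 2) (k : ℕ) {φ : I → ℝ} {C c : ℝ}
    (hc : c < condRad a k φ) :
    ∀ᶠ ψ in 𝓝 φ, (∀ i, |ψ i| ≤ C) → c < condRad a k ψ := by
  induction k generalizing φ C c with
  | zero =>
    obtain ⟨i, hi⟩ := exists_lt_of_lt_ciSup hc
    filter_upwards [(continuous_apply i).continuousAt.eventually (lt_mem_nhds hi)] with ψ h1 h2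
    exact h1.trans_le (le_ciSup (bddAbove_of_abs_le h2) i)
  | succ k ih =>
    obtain ⟨m, hm⟩ := exists_lt_of_lt_ciSup hc
    set A := condRad a k (φ + (2 : ℝ) • a m)
    set B := condRad a k (φ - (2 : ℝ) • a m)
    -- Both halves are allowed to drop by the same slack `(A + B) / 2 - c`, so that their mean stays
    -- above `c`.
    have h1 := ih (φ := φ + (2 : ℝ) • a m) (C := C + 4) (c := A - ((A + B) / 2 - c)) (by
      change _ < A; linarith)
    have h2 := ih (φ := φ - (2 : ℝ) • a m) (C := C + 4) (c := B - ((A + B) / 2 - c)) (by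
      change _ < B; linarith)
    have c1 : Tendsto (fun ψ : I → ℝ => ψ + (2 : ℝ) • a m) (𝓝 φ) (𝓝 (φ + (2 : ℝ) • a m)) :=
      (continuous_id.add continuous_const).tendsto φ
    have c2 : Tendsto (fun ψ : I → ℝ => ψ - (2 : ℝ) • a m) (𝓝 φ) (𝓝 (φ - (2 : ℝ) • a m)) :=
      (continuous_id.sub continuous_const).tendsto φ
    filter_upwards [c1.eventually h1, c2.eventually h2] with ψ h3 h4 h5
    have h6 := le_ciSup (bddAbove_condRad ha k h5) m
    have h7 := h3 (abs_add_two_smul_le h5 (ha m))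
    have h8 := h4 (abs_sub_two_smul_le h5 (ha m))
    simp only [condRad] at h6 ⊢
    linarith

/-- By lower semicontinuity, a limit of moves cannot do better than the moves themselves, so a dense
sequence of moves stands for all outcomes. -/
theorem half_condRad_le (ha : ∀ m i, |a m i| ≤ 2) (k : ℕ) {φ u : I → ℝ} {C : ℝ}
    (hφ : ∀ i, |φ i| ≤ C) (hu : u ∈ closure (Set.range a)) :
    (condRad a k (φ + (2 : ℝ) • u) + condRad a k (φ - (2 : ℝ) • u)) / 2
      ≤ condRad a (k + 1) φ := by
  by_contra! h
  set A := condRad a k (φ + (2 : ℝ) • u)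
  set B := condRad a k (φ - (2 : ℝ) • u)
  set D := condRad a (k + 1) φ
  have h1 := eventually_lt_condRad (φ := φ + (2 : ℝ) • u) (C := C + 4)
    (c := A - ((A + B) / 2 - D)) ha k (by change _ < A; linarith)
  have h2 := eventually_lt_condRad (φ := φ - (2 : ℝ) • u) (C := C + 4)
    (c := B - ((A + B) / 2 - D)) ha k (by change _ < B; linarith)
  have c1 : Tendsto (fun v : I → ℝ => φ + (2 : ℝ) • v) (𝓝 u) (𝓝 (φ + (2 : ℝ) • u)) :=
    (continuous_const.add (continuous_const_smul _)).tendsto u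
  have c2 : Tendsto (fun v : I → ℝ => φ - (2 : ℝ) • v) (𝓝 u) (𝓝 (φ - (2 : ℝ) • u)) :=
    (continuous_const.sub (continuous_const_smul _)).tendsto u
  obtain ⟨_, ⟨h3, h4⟩, m, rfl⟩ := mem_closure_iff_nhds.1 hu _
    ((c1.eventually h1).and (c2.eventually h2))
  have h5 := h3 (abs_add_two_smul_le hφ (ha m))
  have h6 := h4 (abs_sub_two_smul_le hφ (ha m))
  have h7 : _ ≤ D := le_ciSup (bddAbove_condRad ha k hφ) m
  linarith

end condRad

/-- A sequence of points whose values under `e` are dense in the range of `e`. -/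
theorem exists_dense_seq {W I : Type*} [Nonempty W] [Countable I] (e : W → I → ℝ) :
    ∃ d : ℕ → W, ∀ w, e w ∈ closure (Set.range fun m => e (d m)) := by
  have : Nonempty (Set.range e) := (Set.range_nonempty e).to_subtype
  let s := TopologicalSpace.denseSeq (Set.range e)
  choose d hd using fun m => (s m).2
  refine ⟨d, fun w => ?_⟩
  have h := TopologicalSpace.denseRange_denseSeq (Set.range e) ⟨e w, w, rfl⟩
  rw [closure_subtype] at h
  convert h using 2
  rw [← Set.range_comp]
  congr 1; funext m
  exact hd m

/-- Symmetrization. -/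
theorem integral_condRad_le {W I : Type*} [MeasurableSpace W] [Nonempty I] [Countable I]
    {e : W → I → ℝ} (he : ∀ i, Measurable fun w => e w i) (hb : ∀ w i, |e w i| ≤ 2)
    {d : ℕ → W} (hd : ∀ w, e w ∈ closure (Set.range fun m => e (d m)))
    (P : Measure W) [IsProbabilityMeasure P] (k : ℕ) {φ : I → ℝ} {C : ℝ} (hφ : ∀ i, |φ i| ≤ C) :
    ∫ w, condRad (fun m => e (d m)) k (φ + ((fun i => ∫ w', e w' i ∂P) - e w)) ∂P
      ≤ condRad (fun m => e (d m)) (k + 1) φ := by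
  set a := fun m => e (d m) with ha'
  have ha : ∀ m i, |a m i| ≤ 2 := fun m i => hb _ _
  have hint : ∀ i, Integrable (fun w => e w i) P := fun i =>
    .of_bound (he i).aestronglyMeasurable 2 (.of_forall fun w => hb w i)
  have hmp : ∀ i, Measurable fun w => (φ + (2 : ℝ) • e w) i := fun i =>
    ((he i).const_mul 2).const_add _
  have hmm : ∀ i, Measurable fun w => (φ - (2 : ℝ) • e w) i := fun i =>
    ((he i).const_mul 2).const_sub _
  have ip := integrable_condRad ha P k hmp (fun w => abs_add_two_smul_le hφ (hb w))
  have im := integrable_condRad ha P k hmm (fun w => abs_sub_two_smul_le hφ (hb w))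
  -- The mean is written as an integral over an independent copy `w'` and pulled out by Jensen. Then
  -- `φ + e w' - e w` is the midpoint of `φ + 2 e w'` and `φ - 2 e w`, which is the origin of the
  -- factor 2 in `condRad`. After integration both halves can carry the same variable.
  have key : ∀ w, condRad a k (φ + ((fun i => ∫ w', e w' i ∂P) - e w))
      ≤ ((∫ w', condRad a k (φ + (2 : ℝ) • e w') ∂P) + condRad a k (φ - (2 : ℝ) • e w)) / 2 := by
    intro w
    have hm : ∀ i, Measurable fun w' => (φ + e w' - e w) i := fun i =>
      ((he i).const_add _).sub_const _
    have hbd : ∀ w' i, |(φ + e w' - e w) i| ≤ C + 4 := by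
      intro w' i
      have h1 := abs_le.1 (hφ i)
      have h2 := abs_le.1 (hb w i)
      have h3 := abs_le.1 (hb w' i)
      simp only [Pi.add_apply, Pi.sub_apply]
      rw [abs_le]; constructor <;> linarith
    have e1 : φ + ((fun i => ∫ w', e w' i ∂P) - e w) = fun i => ∫ w', (φ + e w' - e w) i ∂P := by
      funext i
      have hs : Integrable (fun w' => φ i + e w' i) P := (integrable_const _).add (hint i)
      simp only [Pi.add_apply, Pi.sub_apply]
      rw [integral_sub hs (integrable_const _),
        integral_add (integrable_const _) (hint i)]
      simp; ring
    rw [e1]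
    refine (condRad_integral_le ha P k hm hbd).trans ?_
    have e2 : ((∫ w', condRad a k (φ + (2 : ℝ) • e w') ∂P) + condRad a k (φ - (2 : ℝ) • e w)) / 2
        = ∫ w', (condRad a k (φ + (2 : ℝ) • e w') + condRad a k (φ - (2 : ℝ) • e w)) / 2 ∂P := by
      rw [integral_div, integral_add ip (integrable_const _)]; simp
    rw [e2]
    refine integral_mono (integrable_condRad ha P k hm hbd)
      ((ip.add (integrable_const _)).div_const 2) fun w' => ?_
    have := condRad_midpoint_le ha k (abs_add_two_smul_le hφ (hb w'))
      (abs_sub_two_smul_le hφ (hb w))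
    refine le_of_eq_of_le (congrArg _ ?_) this
    funext i
    simp only [Pi.add_apply, Pi.sub_apply, Pi.smul_apply, smul_eq_mul]; ring
  have hbd' : ∀ w i, |(φ + ((fun i => ∫ w', e w' i ∂P) - e w)) i| ≤ C + 4 := by
    intro w i
    have h1 := abs_le.1 (hφ i)
    have h2 := abs_le.1 (hb w i)
    have h3 := abs_le.1 (abs_integral_le_of_abs_le P (fun w => hb w i))
    simp only [Pi.add_apply, Pi.sub_apply]
    rw [abs_le]; constructor <;> linarith
  have hm' : ∀ i, Measurable fun w => (φ + ((fun i => ∫ w', e w' i ∂P) - e w)) i := fun i =>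
    ((he i).const_sub _).const_add _
  calc _ ≤ ∫ w, ((∫ w', condRad a k (φ + (2 : ℝ) • e w') ∂P)
            + condRad a k (φ - (2 : ℝ) • e w)) / 2 ∂P :=
        integral_mono (integrable_condRad ha P k hm' hbd')
          (((integrable_const _).add im).div_const 2) key
    _ = ∫ w, (condRad a k (φ + (2 : ℝ) • e w) + condRad a k (φ - (2 : ℝ) • e w)) / 2 ∂P := by
        rw [integral_div, integral_div, integral_add ip im, integral_add (integrable_const _) im]
        simp
    _ ≤ ∫ _, condRad a (k + 1) φ ∂P := integral_mono ((ip.add im).div_const 2)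
        (integrable_const _) fun w => half_condRad_le ha k hφ (hd w)
    _ = _ := by simp

/-- Symmetrization, with the opposite sign. -/
theorem integral_condRad_le' {W I : Type*} [MeasurableSpace W] [Nonempty I] [Countable I]
    {e : W → I → ℝ} (he : ∀ i, Measurable fun w => e w i) (hb : ∀ w i, |e w i| ≤ 2)
    {d : ℕ → W} (hd : ∀ w, e w ∈ closure (Set.range fun m => e (d m)))
    (P : Measure W) [IsProbabilityMeasure P] (k : ℕ) {φ : I → ℝ} {C : ℝ} (hφ : ∀ i, |φ i| ≤ C) :
    ∫ w, condRad (fun m => e (d m)) k (φ + (e w - fun i => ∫ w', e w' i ∂P)) ∂P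
      ≤ condRad (fun m => e (d m)) (k + 1) φ := by
  have hd' : ∀ w, (-e w) ∈ closure (Set.range fun m => -e (d m)) := by
    intro w
    have := map_mem_closure (f := fun x : I → ℝ => -x) continuous_neg (hd w)
      (t := Set.range fun m => -e (d m)) (by rintro _ ⟨m, rfl⟩; exact ⟨m, rfl⟩)
    exact this
  have h := integral_condRad_le (e := fun w => -e w) (fun i => (he i).neg)
    (fun w i => by simpa using hb w i) hd' P k hφ
  rw [condRad_neg] at h
  refine le_of_eq_of_le ?_ h
  congr 1; funext w
  rw [condRad_neg]
  congr 2
  funext i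
  simp [integral_neg]
  ring

/-! ### The sequential fat-shattering dimension bounds the sequential Rademacher complexity -/

/-- A recursive form of sequential fat-shattering: the subclass `V` shatters a tree of depth `d`
at scale `γ`. -/
def FatShatters {I X : Type*} (f : I → X → ℝ) (γ : ℝ) : ℕ → Set I → Prop
  | 0, V => V.Nonempty
  | d + 1, V => ∃ x s, FatShatters f γ d {i ∈ V | s + γ ≤ f i x} ∧
      FatShatters f γ d {i ∈ V | f i x ≤ s - γ}

section FatShatters

variable {I X : Type*} {f : I → X → ℝ} {γ : ℝ}

theorem FatShatters.mono {d : ℕ} {U V : Set I} (h : FatShatters f γ d U) (hUV : U ⊆ V) :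
    FatShatters f γ d V := by
  induction d generalizing U V with
  | zero => exact Set.Nonempty.mono hUV h
  | succ d ih =>
    obtain ⟨x, s, h1, h2⟩ := h
    exact ⟨x, s, ih h1 fun i hi => ⟨hUV hi.1, hi.2⟩, ih h2 fun i hi => ⟨hUV hi.1, hi.2⟩⟩

theorem FatShatters.nonempty {d : ℕ} {V : Set I} (h : FatShatters f γ d V) : V.Nonempty := by
  induction d generalizing V with
  | zero => exact h
  | succ d ih =>
    obtain ⟨x, s, h1, -⟩ := h
    exact (ih h1).mono fun i hi => hi.1

/-- The tree with a given root label and given left and right subtrees. -/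
def consTree {α : Type*} {n : ℕ} (r : α) (T : Bool → BinTree α n) : BinTree α (n + 1) :=
  fun t => Fin.cases (motive := fun t => (Fin t → Bool) → α) (fun _ => r)
    (fun s h => T (h ⟨0, Nat.succ_pos _⟩) s fun i => h ⟨i + 1, Nat.succ_lt_succ i.2⟩) t

/-- The trees obtained for the upper and the lower subclass are glued under a root, below the signs
`true` and `false`. -/
theorem FatShatters.exists_tree {d : ℕ} {V : Set I} (h : FatShatters f γ d V) :
    ∃ (x : BinTree X d) (s : BinTree ℝ d), ∀ ε : Fin d → Bool, ∃ i ∈ V, ∀ t : Fin d,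
      γ ≤ sgn (ε t) * (f i (x t (past t ε)) - s t (past t ε)) := by
  induction d generalizing V with
  | zero =>
    obtain ⟨i, hi⟩ := h
    exact ⟨fun t => t.elim0, fun t => t.elim0, fun ε => ⟨i, hi, fun t => t.elim0⟩⟩
  | succ d ih =>
    obtain ⟨x, s, h1, h2⟩ := h
    obtain ⟨x1, s1, H1⟩ := ih h1
    obtain ⟨x2, s2, H2⟩ := ih h2
    refine ⟨consTree x fun b => if b then x1 else x2, consTree s fun b => if b then s1 else s2,
      fun ε => ?_⟩
    cases hb : ε 0 with
    | true =>
      obtain ⟨i, hi, hit⟩ := H1 fun t => ε t.succ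
      refine ⟨i, hi.1, fun t => ?_⟩
      refine Fin.cases ?_ (fun t => ?_) t
      · have := hi.2
        change γ ≤ sgn (ε 0) * (f i x - s)
        rw [hb, sgn, if_pos rfl]; linarith
      · have := hit t
        change γ ≤ sgn (ε t.succ) * (f i ((if ε 0 then x1 else x2) t (past t fun t => ε t.succ))
          - (if ε 0 then s1 else s2) t (past t fun t => ε t.succ))
        rwa [hb, if_pos rfl, if_pos rfl]
    | false =>
      obtain ⟨i, hi, hit⟩ := H2 fun t => ε t.succ
      refine ⟨i, hi.1, fun t => ?_⟩
      refine Fin.cases ?_ (fun t => ?_) t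
      · have := hi.2
        change γ ≤ sgn (ε 0) * (f i x - s)
        rw [hb, sgn, if_neg (by simp)]; linarith
      · have := hit t
        change γ ≤ sgn (ε t.succ) * (f i ((if ε 0 then x1 else x2) t (past t fun t => ε t.succ))
          - (if ε 0 then s1 else s2) t (past t fun t => ε t.succ))
        rwa [hb, if_neg (by simp), if_neg (by simp)]

end FatShatters

/-! ### Exponential moments and a Sauer–Shelah recursion -/

open scoped ENNReal

/-- The exponential analogue of `condRad`, over a subclass `V`. -/
def expRad {I : Type*} (l : ℝ) (a : ℕ → I → ℝ) : ℕ → Set I → (I → ℝ) → ℝ≥0∞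
  | 0, V, φ => ⨆ i ∈ V, ENNReal.ofReal (Real.exp (l * φ i))
  | k + 1, V, φ => ⨆ m, 2⁻¹ * (expRad l a k V (φ + (2 : ℝ) • a m)
      + expRad l a k V (φ - (2 : ℝ) • a m))

section expRad

variable {I : Type*} {l : ℝ} {a : ℕ → I → ℝ}

/-- A supremum of nonnegative terms over a union is at most the sum over the pieces, and averages
and suprema over moves preserve this. Covering a class therefore costs a sum of exponential moments.
-/
theorem expRad_le_sum {J : Type*} (s : Finset J) (U : J → Set I) (k : ℕ) {V : Set I}
    (hV : ∀ i ∈ V, ∃ j ∈ s, i ∈ U j) (φ : I → ℝ) :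
    expRad l a k V φ ≤ ∑ j ∈ s, expRad l a k (U j) φ := by
  induction k generalizing φ with
  | zero =>
    refine iSup₂_le fun i hi => ?_
    obtain ⟨j, hj, hij⟩ := hV i hi
    refine le_trans ?_ (Finset.single_le_sum (f := fun j => expRad l a 0 (U j) φ)
      (fun _ _ => zero_le) hj)
    exact le_iSup₂ (f := fun i (_ : i ∈ U j) => ENNReal.ofReal (Real.exp (l * φ i))) i hij
  | succ k ih =>
    refine iSup_le fun m => ?_
    calc _ ≤ 2⁻¹ * (∑ j ∈ s, expRad l a k (U j) (φ + (2 : ℝ) • a m)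
            + ∑ j ∈ s, expRad l a k (U j) (φ - (2 : ℝ) • a m)) := by gcongr <;> exact ih _
      _ = ∑ j ∈ s, 2⁻¹ * (expRad l a k (U j) (φ + (2 : ℝ) • a m)
            + expRad l a k (U j) (φ - (2 : ℝ) • a m)) := by
          rw [← Finset.sum_add_distrib, Finset.mul_sum]
      _ ≤ _ := Finset.sum_le_sum fun j _ => le_iSup (fun m =>
          2⁻¹ * (expRad l a k (U j) (φ + (2 : ℝ) • a m)
            + expRad l a k (U j) (φ - (2 : ℝ) • a m))) m

theorem expRad_empty (k : ℕ) (φ : I → ℝ) : expRad l a k ∅ φ = 0 := by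
  simpa using expRad_le_sum (l := l) (a := a) (∅ : Finset ℕ) (fun _ => ∅) k (V := ∅) (by simp) φ

theorem expRad_zero_mono {U V : Set I} (h : U ⊆ V) (φ : I → ℝ) :
    expRad l a 0 U φ ≤ expRad l a 0 V φ :=
  biSup_mono h

theorem expRad_zero_add_le {U : Set I} {u : I → ℝ} {c : ℝ} (hu : ∀ i ∈ U, l * u i ≤ c)
    (φ : I → ℝ) :
    expRad l a 0 U (φ + u) ≤ ENNReal.ofReal (Real.exp c) * expRad l a 0 U φ := by
  refine iSup₂_le fun i hi => ?_
  refine le_trans ?_ (mul_le_mul_right (le_iSup₂ (f := fun i (_ : i ∈ U) =>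
    ENNReal.ofReal (Real.exp (l * φ i))) i hi) _)
  rw [← ENNReal.ofReal_mul (Real.exp_pos _).le, ← Real.exp_add]
  refine ENNReal.ofReal_le_ofReal (Real.exp_le_exp.2 ?_)
  have := hu i hi
  simp only [Pi.add_apply]; linarith

/-- A Hoeffding estimate: on a piece of oscillation `ρ` the move is nearly a constant, so the random
sign contributes a hyperbolic cosine and the oscillation contributes `exp (2 l ρ)`. -/
theorem half_expRad_zero_le (hl : 0 ≤ l) {ρ : ℝ} {U : Set I} {u : I → ℝ}
    (hu : ∀ i ∈ U, |u i| ≤ 2) (hρ : ∀ i ∈ U, ∀ j ∈ U, |u i - u j| ≤ ρ) (φ : I → ℝ) :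
    2⁻¹ * (expRad l a 0 U (φ + (2 : ℝ) • u) + expRad l a 0 U (φ - (2 : ℝ) • u))
      ≤ ENNReal.ofReal (Real.exp (2 * l * ρ + 8 * l ^ 2)) * expRad l a 0 U φ := by
  rcases U.eq_empty_or_nonempty with rfl | ⟨i₀, hi₀⟩
  · simp [expRad_empty]
  have h1 := expRad_zero_add_le (a := a) (l := l) (U := U) (u := (2 : ℝ) • u)
    (c := 2 * l * u i₀ + 2 * l * ρ) (fun i hi => by
      have := (abs_le.1 (hρ i hi i₀ hi₀)).2
      simp only [Pi.smul_apply, smul_eq_mul]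
      nlinarith) φ
  have h2 := expRad_zero_add_le (a := a) (l := l) (U := U) (u := -((2 : ℝ) • u))
    (c := -(2 * l * u i₀) + 2 * l * ρ) (fun i hi => by
      have := (abs_le.1 (hρ i hi i₀ hi₀)).1
      simp only [Pi.neg_apply, Pi.smul_apply, smul_eq_mul]
      nlinarith) φ
  rw [← sub_eq_add_neg] at h2
  have h3 : (2 : ℝ≥0∞)⁻¹ * (ENNReal.ofReal (Real.exp (2 * l * u i₀ + 2 * l * ρ))
      + ENNReal.ofReal (Real.exp (-(2 * l * u i₀) + 2 * l * ρ)))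
      ≤ ENNReal.ofReal (Real.exp (2 * l * ρ + 8 * l ^ 2)) := by
    have h2' : (2 : ℝ≥0∞)⁻¹ = ENNReal.ofReal (2⁻¹) := by
      rw [ENNReal.ofReal_inv_of_pos two_pos]; simp
    rw [h2', ← ENNReal.ofReal_add (Real.exp_pos _).le (Real.exp_pos _).le,
      ← ENNReal.ofReal_mul (by norm_num)]
    refine ENNReal.ofReal_le_ofReal ?_
    have h4 : 2⁻¹ * (Real.exp (2 * l * u i₀ + 2 * l * ρ) + Real.exp (-(2 * l * u i₀) + 2 * l * ρ))
        = Real.cosh (2 * l * u i₀) * Real.exp (2 * l * ρ) := by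
      rw [Real.cosh_eq, Real.exp_add, Real.exp_add]; ring
    rw [h4, add_comm (2 * l * ρ), Real.exp_add]
    -- Since `|u i₀| ≤ 2`, the exponent `(2 l u i₀)² / 2` is at most `8 l²`.
    refine mul_le_mul_of_nonneg_right ((Real.cosh_le_exp_half_sq _).trans
      (Real.exp_le_exp.2 ?_)) (Real.exp_pos _).le
    have : (u i₀) ^ 2 ≤ 2 ^ 2 := sq_le_sq' (abs_le.1 (hu i₀ hi₀)).1 (abs_le.1 (hu i₀ hi₀)).2
    nlinarith [sq_nonneg l]
  calc _ ≤ 2⁻¹ * (ENNReal.ofReal (Real.exp (2 * l * u i₀ + 2 * l * ρ)) * expRad l a 0 U φ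
          + ENNReal.ofReal (Real.exp (-(2 * l * u i₀) + 2 * l * ρ)) * expRad l a 0 U φ) := by
        gcongr
    _ = 2⁻¹ * (ENNReal.ofReal (Real.exp (2 * l * u i₀ + 2 * l * ρ))
      + ENNReal.ofReal (Real.exp (-(2 * l * u i₀) + 2 * l * ρ))) * expRad l a 0 U φ := by ring
    _ ≤ _ := by gcongr

/-- A class that shatters no tree of depth `D` has a polynomially bounded exponential complexity,
up to the discretization error. -/
theorem expRad_le {X : Type*} {f : I → X → ℝ} {γ : ℝ} (hγ : 0 < γ) (hl : 0 ≤ l) (x : ℕ → X)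
    (hf : ∀ i x, |f i x| ≤ 1) (ha : ∀ m i, |a m i| ≤ 2) {M : ℕ} (hM : ⌊2 / γ⌋₊ < M)
    (k D : ℕ) {V : Set I} (hV : ∀ m, ∀ i ∈ V, ∀ j ∈ V, |a m i - a m j| ≤ |f i (x m) - f j (x m)|)
    (hD : ¬ FatShatters f γ D V) (φ : I → ℝ) :
    expRad l a k V φ ≤ ((1 + M * k) ^ D : ℕ) *
      ENNReal.ofReal (Real.exp (2 * l * (3 * γ) + 8 * l ^ 2)) ^ k * expRad l a 0 V φ := by
  induction k generalizing D V φ with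
  | zero => simp
  | succ k ih =>
    cases D with
    | zero =>
      rw [FatShatters, Set.not_nonempty_iff_eq_empty] at hD
      simp [hD, expRad_empty]
    | succ D =>
      set E := ENNReal.ofReal (Real.exp (2 * l * (3 * γ) + 8 * l ^ 2)) with hE
      refine iSup_le fun m => ?_
      -- Cell number of the value at the queried point, for a partition of `[-1, 1]` into fewer than
      -- `M + 1` cells of width `γ`.
      let c : I → ℕ := fun i => ⌊(f i (x m) + 1) / γ⌋₊
      have hc1 : ∀ i, γ * c i ≤ f i (x m) + 1 := fun i => by
        have h0 : 0 ≤ f i (x m) + 1 := by linarith [(abs_le.1 (hf i (x m))).1]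
        have := Nat.floor_le (div_nonneg h0 hγ.le)
        rw [le_div_iff₀ hγ] at this
        linarith
      have hc2 : ∀ i, f i (x m) + 1 < γ * (c i + 1) := fun i => by
        have := Nat.lt_floor_add_one ((f i (x m) + 1) / γ)
        rw [div_lt_iff₀ hγ] at this
        linarith
      have hcM : ∀ i, c i < M := fun i => by
        refine lt_of_le_of_lt (Nat.floor_le_floor ?_) hM
        gcongr
        linarith [(abs_le.1 (hf i (x m))).2]
      let P : ℕ → Set I := fun j => {i ∈ V | c i = j}
      -- The piece `none` collects all cells that still shatter to depth `D`; each other cell is a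
      -- piece of its own and has lost one level of depth.
      let U : Option ℕ → Set I := fun o => o.elim {i ∈ V | FatShatters f γ D (P (c i))}
        fun j => {i ∈ P j | ¬ FatShatters f γ D (P j)}
      have hUV : ∀ o, U o ⊆ V := by
        rintro (_ | j) i hi
        · exact hi.1
        · exact hi.1.1
      have hcov : ∀ i ∈ V, ∃ o ∈ (Finset.range M).insertNone, i ∈ U o := by
        intro i hi
        by_cases h : FatShatters f γ D (P (c i))
        · exact ⟨none, by simp, hi, h⟩
        · exact ⟨some (c i), by simpa using hcM i, ⟨hi, rfl⟩, h⟩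
      have hfar : ∀ i j, FatShatters f γ D (P (c i)) → FatShatters f γ D (P (c j)) →
          c j ≤ c i + 2 := by
        intro i j h1 h2
        by_contra! h
        -- If two such cells were three apart, this threshold would leave a margin `γ` on both
        -- sides: values in the lower cell are below `-1 + γ (c i + 1)`, those in the upper one at
        -- least `-1 + γ (c i + 3)`. Then `V` would shatter to depth `D + 1`.
        refine hD ⟨x m, -1 + γ * (c i + 2), h2.mono fun i' hi' => ⟨hi'.1, ?_⟩,
          h1.mono fun i' hi' => ⟨hi'.1, ?_⟩⟩
        · have h3 := hc1 i'
          rw [hi'.2] at h3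
          have h4 : (c i : ℝ) + 3 ≤ c j := by exact_mod_cast h
          nlinarith
        · have h3 := hc2 i'
          rw [hi'.2] at h3
          nlinarith
      have hosc : ∀ o, ∀ i ∈ U o, ∀ j ∈ U o, |a m i - a m j| ≤ 3 * γ := by
        intro o i hi j hj
        refine (hV m i (hUV o hi) j (hUV o hj)).trans ?_
        have hcc : (c j : ℝ) ≤ c i + 2 ∧ (c i : ℝ) ≤ c j + 2 := by
          rcases o with _ | o
          · exact ⟨by exact_mod_cast hfar i j hi.2 hj.2, by exact_mod_cast hfar j i hj.2 hi.2⟩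
          · have h1 : c i = c j := hi.1.2.trans hj.1.2.symm
            rw [h1]; constructor <;> linarith
        have := hc1 i; have := hc2 i; have := hc1 j; have := hc2 j
        rw [abs_le]; constructor <;> nlinarith
      have hbound : ∀ o, ∀ ψ, expRad l a k (U o) ψ ≤
          ((1 + M * k) ^ (if o = none then D + 1 else D) : ℕ) * E ^ k * expRad l a 0 (U o) ψ := by
        intro o ψ
        refine ih _ (fun m i hi j hj => hV m i (hUV o hi) j (hUV o hj)) ?_ ψ
        rcases o with _ | j
        · exact fun h => hD (h.mono (hUV none))
        · intro h
          obtain ⟨i, hi⟩ := h.nonempty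
          exact hi.2 (h.mono fun i hi => hi.1)
      calc 2⁻¹ * (expRad l a k V (φ + (2 : ℝ) • a m) + expRad l a k V (φ - (2 : ℝ) • a m))
          ≤ 2⁻¹ * (∑ o ∈ (Finset.range M).insertNone, expRad l a k (U o) (φ + (2 : ℝ) • a m)
            + ∑ o ∈ (Finset.range M).insertNone, expRad l a k (U o) (φ - (2 : ℝ) • a m)) := by
            gcongr <;> exact expRad_le_sum _ U k hcov _
        _ = ∑ o ∈ (Finset.range M).insertNone, 2⁻¹ * (expRad l a k (U o) (φ + (2 : ℝ) • a m)
            + expRad l a k (U o) (φ - (2 : ℝ) • a m)) := by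
            rw [← Finset.sum_add_distrib, Finset.mul_sum]
        _ ≤ ∑ o ∈ (Finset.range M).insertNone,
              ((1 + M * k) ^ (if o = none then D + 1 else D) : ℕ) * (E ^ (k + 1)
                * expRad l a 0 V φ) := by
            refine Finset.sum_le_sum fun o _ => ?_
            calc _ ≤ 2⁻¹ * (((1 + M * k) ^ (if o = none then D + 1 else D) : ℕ) * E ^ k
                      * expRad l a 0 (U o) (φ + (2 : ℝ) • a m)
                    + ((1 + M * k) ^ (if o = none then D + 1 else D) : ℕ) * E ^ k
                      * expRad l a 0 (U o) (φ - (2 : ℝ) • a m)) := by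
                  gcongr <;> exact hbound o _
              _ = ((1 + M * k) ^ (if o = none then D + 1 else D) : ℕ) * E ^ k
                  * (2⁻¹ * (expRad l a 0 (U o) (φ + (2 : ℝ) • a m)
                    + expRad l a 0 (U o) (φ - (2 : ℝ) • a m))) := by ring
              _ ≤ ((1 + M * k) ^ (if o = none then D + 1 else D) : ℕ) * E ^ k
                  * (E * expRad l a 0 (U o) φ) := by
                  exact mul_le_mul_right
                    (half_expRad_zero_le hl (fun i _ => ha m i) (hosc o) φ) _
              _ ≤ ((1 + M * k) ^ (if o = none then D + 1 else D) : ℕ) * E ^ k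
                  * (E * expRad l a 0 V φ) := by
                  gcongr
                  exact expRad_zero_mono (hUV o) φ
              _ = _ := by ring
        -- One piece of the old dimension and `M` pieces of smaller dimension.
        _ = (((1 + M * k) ^ (D + 1) + M * (1 + M * k) ^ D : ℕ) : ℝ≥0∞) * (E ^ (k + 1)
                * expRad l a 0 V φ) := by
            rw [← Finset.sum_mul, Finset.sum_insertNone]
            simp
        _ ≤ _ := by
            rw [mul_assoc]
            gcongr
            calc (1 + M * k) ^ (D + 1) + M * (1 + M * k) ^ D
                = (1 + M * k) ^ D * (1 + M * (k + 1)) := by ring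
              _ ≤ (1 + M * (k + 1)) ^ D * (1 + M * (k + 1)) := by gcongr; omega
              _ = _ := by ring

/-- The increasing continuous function `exp (l ·)` commutes with suprema, and by convexity it only
grows when averages are taken outside. -/
theorem ofReal_exp_condRad_le [Nonempty I] (hl : 0 ≤ l) (ha : ∀ m i, |a m i| ≤ 2) (k : ℕ)
    {φ : I → ℝ} {C : ℝ} (hφ : ∀ i, |φ i| ≤ C) :
    ENNReal.ofReal (Real.exp (l * condRad a k φ)) ≤ expRad l a k Set.univ φ := by
  have hmono : Monotone fun y : ℝ => ENNReal.ofReal (Real.exp (l * y)) := fun y z h =>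
    ENNReal.ofReal_le_ofReal (Real.exp_le_exp.2 (mul_le_mul_of_nonneg_left h hl))
  have hcont : Continuous fun y : ℝ => ENNReal.ofReal (Real.exp (l * y)) :=
    ENNReal.continuous_ofReal.comp (Real.continuous_exp.comp (continuous_const.mul continuous_id))
  induction k generalizing φ C with
  | zero =>
    have := hmono.map_ciSup_of_continuousAt hcont.continuousAt (bddAbove_of_abs_le hφ)
    simp only [condRad, expRad, Set.mem_univ, iSup_pos]
    exact this.le
  | succ k ih =>
    have := hmono.map_ciSup_of_continuousAt hcont.continuousAt (bddAbove_condRad ha k hφ)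
    simp only [condRad, expRad]
    refine this.le.trans (iSup_mono fun m => ?_)
    refine le_trans ?_ (mul_le_mul_right (add_le_add (ih (abs_add_two_smul_le hφ (ha m)))
      (ih (abs_sub_two_smul_le hφ (ha m)))) _)
    have h2' : (2 : ℝ≥0∞)⁻¹ = ENNReal.ofReal (2⁻¹) := by
      rw [ENNReal.ofReal_inv_of_pos two_pos]; simp
    rw [h2', ← ENNReal.ofReal_add (Real.exp_pos _).le (Real.exp_pos _).le,
      ← ENNReal.ofReal_mul (by norm_num)]
    refine ENNReal.ofReal_le_ofReal ?_
    set A := condRad a k (φ + (2 : ℝ) • a m)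
    set B := condRad a k (φ - (2 : ℝ) • a m)
    have e1 : Real.exp (l * ((A + B) / 2)) = Real.exp (l * A / 2) * Real.exp (l * B / 2) := by
      rw [← Real.exp_add]; ring_nf
    have e2 : Real.exp (l * A) = Real.exp (l * A / 2) ^ 2 := by rw [← Real.exp_nat_mul]; ring_nf
    have e3 : Real.exp (l * B) = Real.exp (l * B / 2) ^ 2 := by rw [← Real.exp_nat_mul]; ring_nf
    rw [e1, e2, e3]
    nlinarith [sq_nonneg (Real.exp (l * A / 2) - Real.exp (l * B / 2))]

/-- Logarithm of the exponential bound, summed over a finite cover `V`. Moves need only be dominated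
in oscillation by `f` inside each `V j`; this covers signed values and Lipschitz losses without a
separate contraction argument. -/
theorem mul_condRad_zero_le [Nonempty I] {X : Type*} {f : I → X → ℝ} {γ : ℝ} (hγ : 0 < γ)
    (hl : 0 ≤ l) (x : ℕ → X) (hf : ∀ i x, |f i x| ≤ 1) (ha : ∀ m i, |a m i| ≤ 2) {M : ℕ}
    (hM : ⌊2 / γ⌋₊ < M) {J : Type*} [Fintype J] (V : J → Set I) (hV : ∀ i, ∃ j, i ∈ V j)
    (haf : ∀ j, ∀ m, ∀ i ∈ V j, ∀ i' ∈ V j, |a m i - a m i'| ≤ |f i (x m) - f i' (x m)|)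
    {D : ℕ} (hD : ∀ j, ¬ FatShatters f γ D (V j)) (n : ℕ) :
    l * condRad a n 0 ≤ Real.log (Fintype.card J * (1 + M * n) ^ D)
      + n * (2 * l * (3 * γ) + 8 * l ^ 2) := by
  set c := 2 * l * (3 * γ) + 8 * l ^ 2
  have h0 : ∀ U : Set I, expRad l a 0 U 0 ≤ 1 := fun U => iSup₂_le fun i _ => by simp
  have h1 : ENNReal.ofReal (Real.exp (l * condRad a n 0)) ≤
      ENNReal.ofReal ((Fintype.card J * (1 + M * n) ^ D) * Real.exp (n * c)) := by
    calc _ ≤ expRad l a n Set.univ 0 := ofReal_exp_condRad_le hl ha n (C := 0) (by simp)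
      _ ≤ ∑ j, expRad l a n (V j) 0 := expRad_le_sum _ V n
          (fun i _ => by simpa using hV i) 0
      _ ≤ ∑ _j : J, (((1 + M * n) ^ D : ℕ) : ℝ≥0∞) * ENNReal.ofReal (Real.exp c) ^ n * 1 := by
          refine Finset.sum_le_sum fun j _ =>
            (expRad_le hγ hl x hf ha hM n D (haf j) (hD j) 0).trans ?_
          gcongr
          exact h0 _
      _ = _ := by
          rw [Finset.sum_const, nsmul_eq_mul, Finset.card_univ, mul_one,
            ENNReal.ofReal_mul (by positivity), ENNReal.ofReal_mul (by positivity),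
            Real.exp_nat_mul, ENNReal.ofReal_pow (Real.exp_pos _).le, ← mul_assoc,
            ENNReal.ofReal_natCast]
          congr 2
          rw [← ENNReal.ofReal_natCast]
          push_cast
          rfl
  have hJ : (0 : ℝ) < Fintype.card J := by
    obtain ⟨j, -⟩ := hV (Classical.arbitrary I)
    exact_mod_cast Fintype.card_pos_iff.2 ⟨j⟩
  have h2 : (0 : ℝ) < Fintype.card J * (1 + M * n) ^ D := by positivity
  rw [ENNReal.ofReal_le_ofReal_iff (by positivity)] at h1
  have h3 := Real.log_le_log (Real.exp_pos _) h1
  rwa [Real.log_exp, Real.log_mul h2.ne' (Real.exp_pos _).ne', Real.log_exp] at h3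

theorem eventually_condRad_le [Nonempty I] {X : Type*} {f : I → X → ℝ}
    (x : ℕ → X) (hf : ∀ i x, |f i x| ≤ 1) (ha : ∀ m i, |a m i| ≤ 2)
    {J : Type*} [Fintype J] (V : J → Set I) (hV : ∀ i, ∃ j, i ∈ V j)
    (haf : ∀ j, ∀ m, ∀ i ∈ V j, ∀ i' ∈ V j, |a m i - a m i'| ≤ |f i (x m) - f i' (x m)|)
    (hD : ∀ γ > 0, ∃ D, ∀ j, ¬ FatShatters f γ D (V j)) {η : ℝ} (hη : 0 < η) :
    ∀ᶠ n : ℕ in atTop, condRad a n 0 ≤ η * n := by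
  -- With `l = γ` the per-round exponent is `6 γ² + 8 γ² = 14 γ²`. Division by `l` leaves `14 γ = η
  -- / 2`, and the other `η / 2` absorbs the logarithm.
  set γ := η / 28 with hγ'
  have hγ : 0 < γ := by positivity
  obtain ⟨D, hD⟩ := hD γ hγ
  set M := ⌊2 / γ⌋₊ + 1
  have hJ : (0 : ℝ) < Fintype.card J := by
    obtain ⟨j, -⟩ := hV (Classical.arbitrary I)
    exact_mod_cast Fintype.card_pos_iff.2 ⟨j⟩
  have hlog : Tendsto (fun n : ℕ => Real.log (Fintype.card J * (1 + M * n) ^ D) / n) atTop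
      (𝓝 0) := by
    have h1 : Tendsto (fun n : ℕ => (1 + M * n : ℝ)) atTop atTop := by
      refine tendsto_atTop_add_const_left _ _ (Tendsto.const_mul_atTop ?_
        tendsto_natCast_atTop_atTop)
      positivity
    have h2 := (Real.isLittleO_log_id_atTop.tendsto_div_nhds_zero).comp h1
    have h3 : Tendsto (fun n : ℕ => (1 + M * n : ℝ) / n) atTop (𝓝 (0 + M)) := by
      have : Tendsto (fun n : ℕ => (1 : ℝ) / n + M) atTop (𝓝 (0 + M)) :=
        tendsto_one_div_atTop_nhds_zero_nat.add_const _
      refine this.congr' ?_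
      filter_upwards [eventually_gt_atTop 0] with n hn
      have : (n : ℝ) ≠ 0 := by positivity
      field_simp
    have h4 := (tendsto_const_div_atTop_nhds_zero_nat (Real.log (Fintype.card J))).add
      ((h2.mul h3).const_mul (D : ℝ))
    simp only [zero_mul, mul_zero, add_zero] at h4
    refine h4.congr' ?_
    filter_upwards [eventually_gt_atTop 0] with n hn
    have hn' : (n : ℝ) ≠ 0 := by positivity
    have h5 : (1 + M * n : ℝ) ≠ 0 := by positivity
    rw [Real.log_mul hJ.ne' (pow_ne_zero _ h5), Real.log_pow]
    simp only [Function.comp_apply, id]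
    field_simp
  filter_upwards [hlog.eventually (gt_mem_nhds (show 0 < γ * (η / 2) by positivity)),
    eventually_gt_atTop 0] with n hn hn0
  have h1 : _ ≤ Real.log (Fintype.card J * (1 + M * n) ^ D) + _ :=
    mul_condRad_zero_le hγ hγ.le x hf ha (Nat.lt_succ_self _) V hV haf hD n
  have hn' : (0 : ℝ) < n := by positivity
  rw [div_lt_iff₀ hn'] at hn
  have h2 : γ * condRad a n 0 ≤ γ * (η * n) := by
    refine h1.trans ?_
    have : η = 28 * γ := by rw [hγ']; ring
    rw [this] at hn ⊢
    nlinarith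
  exact le_of_mul_le_mul_left h2 hγ

end expRad

/-! ### A minimax theorem -/

/-- A one-sided finite minimax theorem. -/
theorem exists_forall_sub_le {J : Type*} [Fintype J] {S : Set (J → ℝ)} (hS : Convex ℝ S)
    (hne : S.Nonempty) {c δ : ℝ} (hδ : 0 < δ)
    (h : ∀ w ∈ stdSimplex ℝ J, ∃ y ∈ S, c ≤ ∑ j, w j * y j) : ∃ y ∈ S, ∀ j, c - δ ≤ y j := by
  classical
  by_contra! hcon
  let O : Set (J → ℝ) := Set.univ.pi fun _ => Set.Ioi (c - δ)
  have hO : IsOpen O := isOpen_set_pi Set.finite_univ fun _ _ => isOpen_Ioi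
  have hOc : Convex ℝ O := convex_pi fun _ _ => convex_Ioi _
  have hdisj : Disjoint O S := Set.disjoint_left.2 fun y hy hyS => by
    obtain ⟨j, hj⟩ := hcon y hyS
    exact (lt_asymm hj (hy j trivial)).elim
  obtain ⟨f, u, hfO, hfS⟩ := geometric_hahn_banach_open hOc hO hS hdisj
  let α : J → ℝ := fun j => f (Pi.single j 1)
  have hf : ∀ y, f y = ∑ j, y j * α j := by
    intro y
    conv_lhs => rw [← Finset.univ_sum_single y]
    rw [map_sum]
    refine Finset.sum_congr rfl fun j _ => ?_
    have : Pi.single j (y j) = y j • (Pi.single j 1 : J → ℝ) := by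
      rw [← Pi.single_smul]; simp
    rw [this, map_smul, smul_eq_mul]
  have hcO : ∀ t : ℝ, 0 ≤ t → ∀ j, (fun _ => c) + t • (Pi.single j 1 : J → ℝ) ∈ O := by
    intro t ht j i _
    have : 0 ≤ (Pi.single j 1 : J → ℝ) i := by
      by_cases hij : i = j
      · subst hij; simp
      · simp [hij]
    simp only [Pi.add_apply, Pi.smul_apply, smul_eq_mul, Set.mem_Ioi]
    have := mul_nonneg ht this
    linarith
  -- The open set contains a whole ray in each positive coordinate direction, on which the
  -- separating functional stays below `u`.
  have hα : ∀ j, α j ≤ 0 := by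
    intro j
    by_contra! hj
    have h1 := hfO _ (hcO (|u - f fun _ => c| / α j) (by positivity) j)
    rw [map_add, map_smul, smul_eq_mul, div_mul_cancel₀ _ hj.ne'] at h1
    have := le_abs_self (u - f fun _ => c)
    linarith
  have hc : f (fun _ => c) < u := hfO _ fun i _ => by simp only [Set.mem_Ioi]; linarith
  obtain ⟨y₀, hy₀⟩ := hne
  have hsum : ∑ j, α j < 0 := by
    refine lt_of_le_of_ne (Finset.sum_nonpos fun j _ => hα j) fun h0 => ?_
    have h1 := (Finset.sum_eq_zero_iff_of_nonpos fun j _ => hα j).1 h0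
    have h2 : ∀ y, f y = 0 := fun y => by
      rw [hf]; exact Finset.sum_eq_zero fun j hj => by rw [h1 j hj, mul_zero]
    have := hfS y₀ hy₀
    rw [h2] at this hc
    linarith
  -- The normalized coefficients of the functional are the weights that contradict the hypothesis.
  obtain ⟨y, hy, hcy⟩ := h (fun j => α j / ∑ j, α j) ⟨fun j => div_nonneg_of_nonpos (hα j) hsum.le,
    by rw [← Finset.sum_div, div_self hsum.ne]⟩
  have h1 : ∑ j, α j / (∑ j, α j) * y j = f y / ∑ j, α j := by
    rw [hf, Finset.sum_div]
    exact Finset.sum_congr rfl fun j _ => by ring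
  rw [h1, le_div_iff_of_neg hsum] at hcy
  have h2 : f (fun _ => c) = c * ∑ j, α j := by rw [hf, Finset.mul_sum]
  have := hfS y hy
  linarith

/-- Finitely supported probability vectors. -/
def finSimplex (I : Type*) : Set (I →₀ ℝ) := {w | (∀ i, 0 ≤ w i) ∧ w.sum (fun _ r => r) = 1}

/-- The mean of `φ` under the weights `w`. -/
def mix {I : Type*} (w : I →₀ ℝ) (φ : I → ℝ) : ℝ := w.sum fun i r => r * φ i

section mix

variable {I : Type*}

theorem mix_eq (w : I →₀ ℝ) (φ : I → ℝ) : mix w φ = Finsupp.linearCombination ℝ φ w := by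
  simp [mix, Finsupp.linearCombination_apply]

theorem mix_add (w : I →₀ ℝ) (φ ψ : I → ℝ) : mix w (φ + ψ) = mix w φ + mix w ψ := by
  simp [mix, mul_add, Finsupp.sum, Finset.sum_add_distrib]

theorem mix_sub (w : I →₀ ℝ) (φ ψ : I → ℝ) : mix w (φ - ψ) = mix w φ - mix w ψ := by
  simp [mix, mul_sub, Finsupp.sum, Finset.sum_sub_distrib]

theorem mix_smul (w : I →₀ ℝ) (c : ℝ) (φ : I → ℝ) : mix w (c • φ) = c * mix w φ := by
  simp only [mix, Finsupp.sum, Finset.mul_sum, Pi.smul_apply, smul_eq_mul]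
  exact Finset.sum_congr rfl fun i _ => by ring

theorem mix_le {w : I →₀ ℝ} (hw : w ∈ finSimplex I) {φ : I → ℝ} {C : ℝ} (h : ∀ i, φ i ≤ C) :
    mix w φ ≤ C := by
  calc mix w φ ≤ ∑ i ∈ w.support, w i * C :=
        Finset.sum_le_sum fun i _ => mul_le_mul_of_nonneg_left (h i) (hw.1 i)
    _ = C := by
        rw [← Finset.sum_mul]
        have := hw.2
        rw [Finsupp.sum] at this
        rw [this, one_mul]

theorem abs_mix_le {w : I →₀ ℝ} (hw : w ∈ finSimplex I) {φ : I → ℝ} {C : ℝ}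
    (h : ∀ i, |φ i| ≤ C) : |mix w φ| ≤ C := by
  refine abs_le.2 ⟨?_, mix_le hw fun i => (abs_le.1 (h i)).2⟩
  have h1 := mix_le hw (φ := (-1 : ℝ) • φ) (C := C) fun i => by
    have := (abs_le.1 (h i)).1
    simp only [Pi.smul_apply, smul_eq_mul]; linarith
  rw [mix_smul] at h1
  linarith

theorem single_mem_finSimplex (i : I) : Finsupp.single i (1 : ℝ) ∈ finSimplex I := by
  classical
  refine ⟨fun j => ?_, by simp⟩
  rw [Finsupp.single_apply]; split_ifs <;> norm_num

theorem mix_single (i : I) (φ : I → ℝ) : mix (Finsupp.single i 1) φ = φ i := by simp [mix]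

theorem convex_finSimplex : Convex ℝ (finSimplex I) := by
  intro w hw w' hw' a b ha hb hab
  refine ⟨fun i => ?_, ?_⟩
  · have h1 := mul_nonneg ha (hw.1 i)
    have h2 := mul_nonneg hb (hw'.1 i)
    simp only [Finsupp.add_apply, Finsupp.smul_apply, smul_eq_mul]
    linarith
  · have key : ∀ w : I →₀ ℝ, (w.sum fun _ r => r) = Finsupp.linearCombination ℝ (fun _ => 1) w :=
      fun w => by simp [Finsupp.linearCombination_apply]
    have h1 := hw.2
    have h2 := hw'.2
    rw [key] at h1 h2 ⊢
    rw [map_add, map_smul, map_smul, h1, h2]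
    simpa using hab

variable {W : Type*} [MeasurableSpace W] {e : W → I → ℝ}

theorem measurable_mix (he : ∀ i, Measurable fun z => e z i) (w : I →₀ ℝ) :
    Measurable fun z => mix w (e z) :=
  Finset.measurable_sum _ fun i _ => (he i).const_mul _

theorem integral_mix (he : ∀ i, Measurable fun z => e z i) (hb : ∀ z i, |e z i| ≤ 2)
    (w : I →₀ ℝ) (P : Measure W) [IsProbabilityMeasure P] :
    ∫ z, mix w (e z) ∂P = mix w fun i => ∫ z, e z i ∂P := by
  simp only [mix, Finsupp.sum]
  rw [integral_finsetSum]
  · simp only [integral_const_mul]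
  · intro i _
    exact (Integrable.of_bound (he i).aestronglyMeasurable 2
      (.of_forall fun z => hb z i)).const_mul _

end mix

/-! ### Threshold arrays and minimax without compactness -/

section threshold

variable {W I : Type*} [MeasurableSpace W] [Nonempty I] [Countable I] {e : W → I → ℝ} {d : ℕ → W}

/-- By Jensen, a mean of moves is no stronger than the moves, so distributions may be used as moves
as well. -/
theorem half_condRad_integral_le (he : ∀ i, Measurable fun w => e w i)
    (hb : ∀ w i, |e w i| ≤ 2) (hd : ∀ w, e w ∈ closure (Set.range fun m => e (d m)))
    (P : Measure W) [IsProbabilityMeasure P] (k : ℕ) {φ : I → ℝ} {C : ℝ} (hφ : ∀ i, |φ i| ≤ C) :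
    (condRad (fun m => e (d m)) k (φ + (2 : ℝ) • fun i => ∫ w, e w i ∂P)
      + condRad (fun m => e (d m)) k (φ - (2 : ℝ) • fun i => ∫ w, e w i ∂P)) / 2
      ≤ condRad (fun m => e (d m)) (k + 1) φ := by
  set a := fun m => e (d m)
  have ha : ∀ m i, |a m i| ≤ 2 := fun m i => hb _ _
  have hint : ∀ i, Integrable (fun w => 2 * e w i) P := fun i =>
    (Integrable.of_bound (he i).aestronglyMeasurable 2 (.of_forall fun w => hb w i)).const_mul 2
  have hmp : ∀ i, Measurable fun w => (φ + (2 : ℝ) • e w) i := fun i =>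
    ((he i).const_mul 2).const_add _
  have hmm : ∀ i, Measurable fun w => (φ - (2 : ℝ) • e w) i := fun i =>
    ((he i).const_mul 2).const_sub _
  have hp : ∀ w i, |(φ + (2 : ℝ) • e w) i| ≤ C + 4 := fun w => abs_add_two_smul_le hφ (hb w)
  have hm : ∀ w i, |(φ - (2 : ℝ) • e w) i| ≤ C + 4 := fun w => abs_sub_two_smul_le hφ (hb w)
  have ip := integrable_condRad ha P k hmp hp
  have im := integrable_condRad ha P k hmm hm
  have e1 : (φ + (2 : ℝ) • fun i => ∫ w, e w i ∂P) = fun i => ∫ w, (φ + (2 : ℝ) • e w) i ∂P := by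
    funext i
    simp only [Pi.add_apply, Pi.smul_apply, smul_eq_mul]
    rw [integral_add (integrable_const _) (hint i), integral_const_mul]; simp
  have e2 : (φ - (2 : ℝ) • fun i => ∫ w, e w i ∂P) = fun i => ∫ w, (φ - (2 : ℝ) • e w) i ∂P := by
    funext i
    simp only [Pi.sub_apply, Pi.smul_apply, smul_eq_mul]
    rw [integral_sub (integrable_const _) (hint i), integral_const_mul]; simp
  have h1 := condRad_integral_le ha P k hmp hp
  have h2 := condRad_integral_le ha P k hmm hm
  rw [e1, e2]
  calc _ ≤ ((∫ w, condRad a k (φ + (2 : ℝ) • e w) ∂P)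
          + ∫ w, condRad a k (φ - (2 : ℝ) • e w) ∂P) / 2 := by linarith
    _ = ∫ w, (condRad a k (φ + (2 : ℝ) • e w) + condRad a k (φ - (2 : ℝ) • e w)) / 2 ∂P := by
        rw [integral_div, integral_add ip im]
    _ ≤ ∫ _, condRad a (k + 1) φ ∂P := integral_mono ((ip.add im).div_const 2)
        (integrable_const _) fun w => half_condRad_le ha k hφ (hd w)
    _ = _ := by simp

/-- Long threshold sequences force a large sequential Rademacher complexity. -/
theorem add_mul_le_condRad (he : ∀ i, Measurable fun w => e w i)
    (hb : ∀ w i, |e w i| ≤ 2) (hd : ∀ w, e w ∈ closure (Set.range fun m => e (d m)))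
    {P : ℕ → Measure W} (hP : ∀ i, IsProbabilityMeasure (P i)) {g : ℕ → I →₀ ℝ}
    (hg : ∀ j, g j ∈ finSimplex I) {b : ℕ → ℝ} {γ : ℝ}
    (hlow : ∀ j i, j < i → b i + γ ≤ mix (g j) fun k => ∫ w, e w k ∂(P i))
    (hhigh : ∀ i j, i ≤ j → mix (g j) (fun k => ∫ w, e w k ∂(P i)) ≤ b i)
    (n s : ℕ) {φ : I → ℝ} {C m : ℝ} (hφ : ∀ i, |φ i| ≤ C)
    (hm : ∀ j, s ≤ j → j < s + 2 ^ n → m ≤ mix (g j) φ) :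
    m + γ * n ≤ condRad (fun m => e (d m)) n φ := by
  induction n generalizing s φ C m with
  | zero =>
    refine (le_of_eq (by simp)).trans ((hm s le_rfl (by simp)).trans (mix_le (hg s) fun i => ?_))
    exact le_ciSup (bddAbove_of_abs_le hφ) i
  | succ n ih =>
    -- Bisection of the `2 ^ (n + 1)` surviving indices by the distribution at the midpoint. On a
    -- plus sign the left half survives and gains at least `2 (b t + γ)`; on a minus sign the right
    -- half gains at least `-2 b t`. The average gain is `γ`.
    set t := s + 2 ^ n with ht
    set E : I → ℝ := fun k => ∫ w, e w k ∂(P t) with hE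
    have hEb : ∀ i, |E i| ≤ 2 := fun i => abs_integral_le_of_abs_le _ fun w => hb w i
    have h1 := ih s (m := m + 2 * (b t + γ)) (abs_add_two_smul_le hφ hEb) (fun j h1 h2 => by
      rw [mix_add, mix_smul]
      have := hm j h1 (by rw [pow_succ]; omega)
      have := hlow j t h2
      linarith)
    have h2 := ih t (m := m - 2 * b t) (abs_sub_two_smul_le hφ hEb) (fun j h1 h2 => by
      rw [mix_sub, mix_smul]
      have := hm j (by omega) (by rw [pow_succ]; omega)
      have := hhigh t j h1
      linarith)
    have h3 := half_condRad_integral_le he hb hd (P t) n hφ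
    push_cast
    linarith

/-- The learner has a near-optimal mixed action when the complexity is sublinear. -/
theorem exists_mix_le [Nonempty W] (he : ∀ i, Measurable fun w => e w i)
    (hb : ∀ w i, |e w i| ≤ 2) (hd : ∀ w, e w ∈ closure (Set.range fun m => e (d m)))
    (hrad : ∀ η > 0, ∀ᶠ n : ℕ in atTop, condRad (fun m => e (d m)) n 0 ≤ η * n)
    {Φ : W → ℝ} (hΦ : Measurable Φ) {B : ℝ} (hΦb : ∀ z, |Φ z| ≤ B) {v : ℝ}
    (h : ∀ P : Measure W, IsProbabilityMeasure P → ∀ δ > 0,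
      ∃ i, ∫ z, e z i ∂P + ∫ z, Φ z ∂P ≤ v + δ) {ε : ℝ} (hε : 0 < ε) :
    ∃ w ∈ finSimplex I, ∀ z, mix w (e z) + Φ z ≤ v + ε := by
  classical
  by_contra! hcon
  let pay : Measure W → (I →₀ ℝ) → ℝ := fun P w => mix w (fun i => ∫ z, e z i ∂P) + ∫ z, Φ z ∂P
  have hΦi : ∀ P : Measure W, IsProbabilityMeasure P → Integrable Φ P := fun P _ =>
    .of_bound hΦ.aestronglyMeasurable B (.of_forall hΦb)
  have hei : ∀ P : Measure W, IsProbabilityMeasure P → ∀ i, Integrable (fun z => e z i) P :=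
    fun P _ i => .of_bound (he i).aestronglyMeasurable 2 (.of_forall fun z => hb z i)
  have hmixi : ∀ P : Measure W, IsProbabilityMeasure P → ∀ w ∈ finSimplex I,
      Integrable (fun z => mix w (e z)) P := fun P _ w hw =>
    .of_bound (measurable_mix he w).aestronglyMeasurable 2 (.of_forall fun z => abs_mix_le hw (hb z))
  have hpay : ∀ P : Measure W, IsProbabilityMeasure P → ∀ w ∈ finSimplex I,
      pay P w = ∫ z, (mix w (e z) + Φ z) ∂P := fun P hP w hw => by
    rw [integral_add (hmixi P hP w hw) (hΦi P hP), integral_mix he hb]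
  -- Each new distribution makes all earlier mixed actions pay at least `v + 2 ε / 3`, and each new
  -- mixed action pays at most `v + ε / 3` against all distributions up to its own. Each choice is a
  -- finite minimax problem.
  obtain ⟨f, hf, hfr⟩ := exists_seq_of_forall_finset_exists
    (fun q : Measure W × (I →₀ ℝ) => IsProbabilityMeasure q.1 ∧ q.2 ∈ finSimplex I ∧
      pay q.1 q.2 ≤ v + ε / 3)
    (fun q q' => v + 2 * ε / 3 ≤ pay q'.1 q.2 ∧ pay q.1 q'.2 ≤ v + ε / 3) (by
    intro J hJ
    -- the distribution that beats all previous mixed actions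
    obtain ⟨y, ⟨P, hP, rfl⟩, hy⟩ := exists_forall_sub_le
      (S := {y : J → ℝ | ∃ P : Measure W, IsProbabilityMeasure P ∧ y = fun j => pay P j.1.2})
      (c := v + ε) (δ := ε / 3) (by
        rintro _ ⟨P, hP, rfl⟩ _ ⟨P', hP', rfl⟩ a b ha hb' hab
        refine ⟨ENNReal.ofReal a • P + ENNReal.ofReal b • P', ⟨?_⟩, ?_⟩
        · simp [← ENNReal.ofReal_add ha hb', hab]
        · have hmm : ∀ g : W → ℝ, Integrable g P → Integrable g P' →
              ∫ z, g z ∂(ENNReal.ofReal a • P + ENNReal.ofReal b • P')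
                = a * ∫ z, g z ∂P + b * ∫ z, g z ∂P' := by
            intro g h1 h2
            rw [integral_add_measure (h1.smul_measure ENNReal.ofReal_ne_top)
              (h2.smul_measure ENNReal.ofReal_ne_top), integral_smul_measure,
              integral_smul_measure, ENNReal.toReal_ofReal ha, ENNReal.toReal_ofReal hb']
            rfl
          funext j
          simp only [Pi.add_apply, Pi.smul_apply, smul_eq_mul, pay]
          have e1 : (fun i => ∫ z, e z i ∂(ENNReal.ofReal a • P + ENNReal.ofReal b • P'))
              = (a • fun i => ∫ z, e z i ∂P) + (b • fun i => ∫ z, e z i ∂P') := by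
            funext i
            exact hmm _ (hei P hP i) (hei P' hP' i)
          rw [e1, mix_add, mix_smul, mix_smul, hmm _ (hΦi P hP) (hΦi P' hP')]
          ring)
      ⟨_, Measure.dirac (Classical.arbitrary W), inferInstance, rfl⟩ (by positivity) (by
        intro u hu
        have hw : ∑ j : J, u j • j.1.2 ∈ finSimplex I := convex_finSimplex.sum_mem
          (fun j _ => hu.1 j) hu.2 fun j _ => (hJ j.1 j.2).2.1
        obtain ⟨z, hz⟩ := hcon _ hw
        refine ⟨_, ⟨Measure.dirac z, inferInstance, rfl⟩, ?_⟩
        have h1 : pay (Measure.dirac z) (∑ j : J, u j • j.1.2)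
            = ∑ j : J, u j * pay (Measure.dirac z) j.1.2 := by
          simp only [pay, mix_eq, map_sum, map_smul, mul_add, Finset.sum_add_distrib,
            ← Finset.sum_mul, hu.2, one_mul, smul_eq_mul]
        have h2 : StronglyMeasurable fun z => mix (∑ j : J, u j • j.1.2) (e z) + Φ z :=
          ((measurable_mix he _).add hΦ).stronglyMeasurable
        rw [← h1, hpay _ inferInstance _ hw, integral_dirac' _ _ h2]
        exact hz.le)
    -- the mixed action that is good against all distributions so far
    obtain ⟨y, ⟨w, hw, rfl⟩, hy'⟩ := exists_forall_sub_le
      (S := {y : Option J → ℝ | ∃ w ∈ finSimplex I, y = fun o => -pay (o.elim P fun j => j.1.1) w})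
      (c := -(v + ε / 6)) (δ := ε / 6) (by
        rintro _ ⟨w, hw, rfl⟩ _ ⟨w', hw', rfl⟩ a b ha hb' hab
        refine ⟨_, convex_finSimplex hw hw' ha hb' hab, ?_⟩
        funext o
        simp only [Pi.add_apply, Pi.smul_apply, smul_eq_mul, pay, mix_eq, map_add, map_smul]
        have : a = 1 - b := by linarith
        rw [this]; ring)
      ⟨_, _, single_mem_finSimplex (Classical.arbitrary I), rfl⟩ (by positivity) (by
        intro u hu
        let Q : Option J → Measure W := fun o => o.elim P fun j => j.1.1
        have hQ : ∀ o, IsProbabilityMeasure (Q o) := by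
          rintro (_ | j)
          · exact hP
          · exact (hJ j.1 j.2).1
        have hprob : IsProbabilityMeasure (∑ o, ENNReal.ofReal (u o) • Q o) := ⟨by
          simp only [Measure.coe_finsetSum, Finset.sum_apply, Measure.smul_apply, measure_univ,
            smul_eq_mul, mul_one]
          rw [← ENNReal.ofReal_sum_of_nonneg fun o _ => hu.1 o, hu.2, ENNReal.ofReal_one]⟩
        have hmm : ∀ g : W → ℝ, (∀ o, Integrable g (Q o)) →
            ∫ z, g z ∂(∑ o, ENNReal.ofReal (u o) • Q o) = ∑ o, u o * ∫ z, g z ∂(Q o) := by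
          intro g hg
          rw [integral_finsetSum_measure fun o _ => (hg o).smul_measure ENNReal.ofReal_ne_top]
          refine Finset.sum_congr rfl fun o _ => ?_
          rw [integral_smul_measure, ENNReal.toReal_ofReal (hu.1 o)]; rfl
        obtain ⟨i, hi⟩ := h _ hprob (ε / 6) (by positivity)
        refine ⟨_, ⟨_, single_mem_finSimplex i, rfl⟩, ?_⟩
        rw [hmm _ fun o => hei _ (hQ o) i, hmm _ fun o => hΦi _ (hQ o),
          ← Finset.sum_add_distrib] at hi
        simp only [pay, mix_single, mul_neg, Finset.sum_neg_distrib, neg_le_neg_iff]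
        refine le_of_eq_of_le (Finset.sum_congr rfl fun o _ => ?_) hi
        rw [mul_add])
    refine ⟨(P, w), ⟨hP, hw, ?_⟩, fun q hq => ⟨?_, ?_⟩⟩
    · have := hy' none
      simp only [Option.elim] at this ⊢
      linarith
    · have := hy ⟨q, hq⟩
      dsimp only at this ⊢
      linarith
    · have := hy' (some ⟨q, hq⟩)
      simp only [Option.elim] at this ⊢
      linarith)
  have hlow : ∀ j i, j < i → (v + ε / 3 - ∫ z, Φ z ∂(f i).1) + ε / 3
      ≤ mix (f j).2 fun k => ∫ w, e w k ∂(f i).1 := by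
    intro j i hji
    have := (hfr j i hji).1
    simp only [pay] at this
    linarith
  have hhigh : ∀ i j, i ≤ j → mix (f j).2 (fun k => ∫ w, e w k ∂(f i).1)
      ≤ v + ε / 3 - ∫ z, Φ z ∂(f i).1 := by
    intro i j hij
    have h1 : pay (f i).1 (f j).2 ≤ v + ε / 3 := by
      rcases hij.eq_or_lt with rfl | hij
      · exact (hf i).2.2
      · exact (hfr i j hij).2
    simp only [pay] at h1
    linarith
  -- The array has gap `ε / 3`, which forces growth at rate `ε / 3` against the assumed rate `ε /
  -- 6`.
  obtain ⟨n, hn, hn0⟩ := ((hrad (ε / 6) (by positivity)).and (eventually_gt_atTop 0)).exists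
  have h1 := add_mul_le_condRad he hb hd (fun i => (hf i).1) (fun j => (hf j).2.1) hlow hhigh n 0
    (φ := 0) (C := 0) (m := 0) (by simp) (fun j _ _ => by simp [mix])
  have hn' : (0 : ℝ) < n := by positivity
  nlinarith

end threshold

/-! ### A measurable strategy for the online game -/

theorem iSup_neg_eq {ι : Sort*} (f : ι → ℝ) : ⨆ i, -f i = -⨅ i, f i := by
  simpa using (Real.mul_iInf_of_nonpos (r := -1) (by norm_num) f).symm

/-- Countably many laws on `ℕ` approximate all finitely supported ones. -/
theorem exists_dense_laws : ∃ q : ℕ → Measure ℕ, (∀ c, IsProbabilityMeasure (q c)) ∧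
    ∀ w ∈ finSimplex ℕ, ∀ ε > 0, ∃ c, ∀ φ : ℕ → ℝ, (∀ i, |φ i| ≤ 2) →
      ∫ i, φ i ∂(q c) ≤ mix w φ + ε := by
  have hne : ∀ m : ℕ, Nonempty (stdSimplex ℝ (Fin (m + 1))) := fun m =>
    ⟨⟨Pi.single 0 1, single_mem_stdSimplex ℝ 0⟩⟩
  let y : (m : ℕ) → ℕ → stdSimplex ℝ (Fin (m + 1)) := fun m =>
    TopologicalSpace.denseSeq (stdSimplex ℝ (Fin (m + 1)))
  let q : ℕ × ℕ → Measure ℕ := fun c =>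
    ∑ j : Fin (c.1 + 1), ENNReal.ofReal ((y c.1 c.2).1 j) • Measure.dirac (j : ℕ)
  refine ⟨fun c => q c.unpair, fun c => ⟨?_⟩, fun w hw ε hε => ?_⟩
  · simp only [q, Measure.coe_finsetSum, Finset.sum_apply, Measure.smul_apply, measure_univ,
      smul_eq_mul, mul_one]
    rw [← ENNReal.ofReal_sum_of_nonneg fun o _ => (y _ _).2.1 o, (y _ _).2.2, ENNReal.ofReal_one]
  · obtain ⟨m, hm⟩ : ∃ m, ∀ i ∈ w.support, i < m + 1 :=
      ⟨w.support.sup id, fun i hi => Nat.lt_succ_of_le (Finset.le_sup (f := id) hi)⟩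
    have hsum : ∀ φ : ℕ → ℝ, mix w φ = ∑ j : Fin (m + 1), w j * φ j := by
      intro φ
      rw [Fin.sum_univ_eq_sum_range fun j => w j * φ j]
      exact Finset.sum_subset (fun i hi => Finset.mem_range.2 (hm i hi)) fun i _ hi => by
        simp [Finsupp.notMem_support_iff.1 hi]
    have hw' : (fun j : Fin (m + 1) => w j) ∈ stdSimplex ℝ (Fin (m + 1)) := by
      refine ⟨fun j => hw.1 j, ?_⟩
      have h1 := hsum fun _ => 1
      have h2 : mix w (fun _ => 1) = 1 := by simpa [mix] using hw.2
      rw [h2] at h1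
      simpa using h1.symm
    -- Each of the `m + 1` weights is off by less than `ε / (2 (m + 1))` and `|φ| ≤ 2`, so the total
    -- error is at most `ε`, uniformly in `φ`.
    obtain ⟨k, hk⟩ := (TopologicalSpace.denseRange_denseSeq
      (stdSimplex ℝ (Fin (m + 1)))).exists_dist_lt ⟨_, hw'⟩
      (show 0 < ε / (2 * (m + 1)) by positivity)
    refine ⟨Nat.pair m k, fun φ hφ => ?_⟩
    simp only [Nat.unpair_pair, q]
    rw [integral_finsetSum_measure fun j _ =>
      (integrable_dirac (by simp)).smul_measure ENNReal.ofReal_ne_top]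
    simp only [integral_smul_measure, integral_dirac, smul_eq_mul]
    rw [hsum, ← sub_le_iff_le_add', ← Finset.sum_sub_distrib]
    calc _ ≤ ∑ _j : Fin (m + 1), ε / (2 * (m + 1)) * 2 := by
          refine Finset.sum_le_sum fun j _ => ?_
          rw [ENNReal.toReal_ofReal ((y m k).2.1 j), ← sub_mul]
          refine (le_abs_self _).trans ?_
          rw [abs_mul]
          refine mul_le_mul ?_ (hφ j) (abs_nonneg _) (by positivity)
          have h1 : dist ((fun j : Fin (m + 1) => w j) j) ((y m k).1 j) ≤ _ :=
            (dist_le_pi_dist _ _ j).trans hk.le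
          rwa [dist_comm, Real.dist_eq] at h1
      _ = ε := by
          simp only [Finset.sum_const, Finset.card_univ, Fintype.card_fin, nsmul_eq_mul]
          push_cast
          field_simp

/-! ### The relaxation strategy and its measurable selection -/

section strategy

variable {W : Type*} {e : W → ℕ → ℝ} {d : ℕ → W}

/-- Along a sequence of dense outcomes approaching `w`, the expected loss converges by dominated
convergence and `condRad` is lower semicontinuous. A strategy therefore has to be tested on
countably many outcomes only. -/
theorem add_condRad_le_of_dense (hb : ∀ w i, |e w i| ≤ 2)
    (hd : ∀ w, e w ∈ closure (Set.range fun m => e (d m))) (Q : Measure ℕ)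
    [IsProbabilityMeasure Q] (k : ℕ) {φ : ℕ → ℝ} {C v : ℝ} (hφ : ∀ i, |φ i| ≤ C)
    (h : ∀ m, ∫ i, e (d m) i ∂Q + condRad (fun m => e (d m)) k (φ - e (d m)) ≤ v) (w : W) :
    ∫ i, e w i ∂Q + condRad (fun m => e (d m)) k (φ - e w) ≤ v := by
  have hbd : ∀ w i, |(φ - e w) i| ≤ C + 2 := fun w i => by
    have h1 := abs_le.1 (hφ i)
    have h2 := abs_le.1 (hb w i)
    simp only [Pi.sub_apply]
    rw [abs_le]; constructor <;> linarith
  obtain ⟨s, hs, hlim⟩ := mem_closure_iff_seq_limit.1 (hd w)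
  choose m hm using hs
  have h1 : Tendsto (fun j => ∫ i, e (d (m j)) i ∂Q) atTop (𝓝 (∫ i, e w i ∂Q)) := by
    refine tendsto_integral_of_dominated_convergence (fun _ => 2)
      (fun _ => measurable_from_top.aestronglyMeasurable) (integrable_const _)
      (fun j => .of_forall fun i => hb _ i) (.of_forall fun i => ?_)
    have : ∀ j, e (d (m j)) i = s j i := fun j => congrFun (hm j) i
    simp only [this]
    exact (tendsto_pi_nhds.1 hlim) i
  have h2 : Tendsto (fun j => φ - s j) atTop (𝓝 (φ - e w)) := tendsto_const_nhds.sub hlim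
  refine le_of_forall_pos_lt_add fun ε hε => ?_
  have h3 := h2.eventually (eventually_lt_condRad (C := C + 2)
    (c := condRad (fun m => e (d m)) k (φ - e w) - ε / 2) (fun m i => hb (d m) i) k (by linarith))
  have h4 := h1.eventually (lt_mem_nhds (show ∫ i, e w i ∂Q - ε / 2 < ∫ i, e w i ∂Q by linarith))
  obtain ⟨j, h5, h6⟩ := (h3.and h4).exists
  have h7 := hm j
  dsimp only at h7
  rw [← h7] at h5
  have := h5 (hbd _)
  have := h (m j)
  linarith

variable [MeasurableSpace W]

/-- Admissibility of the relaxation. After the minimax exchange the distribution `P` of the outcome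
is known, and an almost best response to `P` is enough. -/
theorem exists_law_add_condRad_le [Nonempty W] (he : ∀ i, Measurable fun w => e w i)
    (hb : ∀ w i, |e w i| ≤ 2) (hd : ∀ w, e w ∈ closure (Set.range fun m => e (d m)))
    (hrad : ∀ η > 0, ∀ᶠ n : ℕ in atTop, condRad (fun m => e (d m)) n 0 ≤ η * n)
    {q : ℕ → Measure ℕ} (hqd : ∀ w ∈ finSimplex ℕ, ∀ ε > 0, ∃ c, ∀ φ : ℕ → ℝ,
      (∀ i, |φ i| ≤ 2) → ∫ i, φ i ∂(q c) ≤ mix w φ + ε)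
    (k : ℕ) {φ : ℕ → ℝ} {C : ℝ} (hφ : ∀ i, |φ i| ≤ C) {η : ℝ} (hη : 0 < η) :
    ∃ c, ∀ w, ∫ i, e w i ∂(q c) + condRad (fun m => e (d m)) k (φ - e w)
      ≤ condRad (fun m => e (d m)) (k + 1) φ + η := by
  set a := fun m => e (d m)
  have ha : ∀ m i, |a m i| ≤ 2 := fun m i => hb _ _
  have hbd : ∀ w i, |(φ - e w) i| ≤ C + 2 := fun w i => by
    have h1 := abs_le.1 (hφ i)
    have h2 := abs_le.1 (hb w i)
    simp only [Pi.sub_apply]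
    rw [abs_le]; constructor <;> linarith
  have hms : ∀ i, Measurable fun w => (φ - e w) i := fun i => (he i).const_sub _
  obtain ⟨w, hw, hwle⟩ := exists_mix_le he hb hd hrad (Φ := fun z => condRad a k (φ - e z))
    (measurable_condRad k hms) (fun z => abs_condRad_le ha k (hbd z))
    (v := condRad a (k + 1) φ) (by
      intro P hP δ hδ
      have hEb : ∀ i, |∫ z, e z i ∂P| ≤ 2 := fun i => abs_integral_le_of_abs_le P fun z => hb z i
      obtain ⟨i, hi⟩ := exists_lt_of_ciInf_lt
        (show ⨅ i, ∫ z, e z i ∂P < (⨅ i, ∫ z, e z i ∂P) + δ by linarith)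
      refine ⟨i, ?_⟩
      set c := ⨅ i, ∫ z, e z i ∂P
      have hbd' : ∀ z i, |(φ + ((fun i => ∫ z, e z i ∂P) - e z)) i| ≤ C + 4 := fun z i => by
        have h1 := abs_le.1 (hφ i)
        have h2 := abs_le.1 (hb z i)
        have h3 := abs_le.1 (hEb i)
        simp only [Pi.add_apply, Pi.sub_apply]
        rw [abs_le]; constructor <;> linarith
      have hms' : ∀ i, Measurable fun z => (φ + ((fun i => ∫ z, e z i ∂P) - e z)) i := fun i =>
        ((he i).const_sub _).const_add _
      -- The constant `c`, the least mean loss, moves into the potential and is replaced by the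
      -- larger vector of mean losses; what remains is the symmetrization inequality.
      have h1 : ∫ z, condRad a k (φ - e z) ∂P + c ≤ condRad a (k + 1) φ := by
        calc _ = ∫ z, (condRad a k (φ - e z) + c) ∂P := by
              rw [integral_add (integrable_condRad ha P k hms hbd) (integrable_const _)]; simp
          _ ≤ ∫ z, condRad a k (φ + ((fun i => ∫ z, e z i ∂P) - e z)) ∂P := by
              refine integral_mono ((integrable_condRad ha P k hms hbd).add (integrable_const _))
                (integrable_condRad ha P k hms' hbd') fun z => ?_
              dsimp only
              rw [← condRad_add_const ha k (hbd z)]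
              refine condRad_mono ha k (hbd' z) fun i => ?_
              have : c ≤ ∫ z, e z i ∂P := ciInf_le (bddBelow_of_abs_le hEb) i
              simp only [Pi.add_apply, Pi.sub_apply]
              linarith
          _ ≤ _ := integral_condRad_le he hb hd P k hφ
      linarith) (half_pos hη)
  obtain ⟨c, hc⟩ := hqd w hw (η / 2) (half_pos hη)
  refine ⟨c, fun z => ?_⟩
  have := hc (e z) (hb z)
  have := hwle z
  linarith

/-- Losses so far plus the potential of the remaining rounds grow by at most `η` per round. At the
end the potential is minus the loss of the best index, so the sum telescopes to the regret. -/
theorem exists_strategy [Nonempty W] (he : ∀ i, Measurable fun w => e w i)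
    (hb : ∀ w i, |e w i| ≤ 2) (hd : ∀ w, e w ∈ closure (Set.range fun m => e (d m)))
    (hrad : ∀ η > 0, ∀ᶠ n : ℕ in atTop, condRad (fun m => e (d m)) n 0 ≤ η * n)
    {q : ℕ → Measure ℕ} (hq : ∀ c, IsProbabilityMeasure (q c))
    (hqd : ∀ w ∈ finSimplex ℕ, ∀ ε > 0, ∃ c, ∀ φ : ℕ → ℝ,
      (∀ i, |φ i| ≤ 2) → ∫ i, φ i ∂(q c) ≤ mix w φ + ε)
    (n : ℕ) {η : ℝ} (hη : 0 < η) :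
    ∃ c : (t : Fin n) → (Fin t → W) → ℕ, (∀ t, Measurable (c t)) ∧ ∀ z : Fin n → W,
      ∑ t, ∫ i, e (z t) i ∂(q (c t (past t z))) - ⨅ i, ∑ t, e (z t) i
        ≤ condRad (fun m => e (d m)) n 0 + n * η := by
  classical
  set a := fun m => e (d m) with ha'
  have ha : ∀ m i, |a m i| ≤ 2 := fun m i => hb _ _
  let φ : (t : ℕ) → (Fin t → W) → ℕ → ℝ := fun t h i => -∑ s, e (h s) i
  have hφ : ∀ t h i, |φ t h i| ≤ t * 2 := fun t h i => by
    simp only [φ, abs_neg]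
    refine (Finset.abs_sum_le_sum_abs _ _).trans ((Finset.sum_le_sum fun s _ => hb _ _).trans ?_)
    simp
  let good : (t : Fin n) → (Fin t → W) → ℕ → Prop := fun t h c =>
    ∀ m, ∫ i, e (d m) i ∂(q c) + condRad a (n - t - 1) (φ t h - e (d m))
      ≤ condRad a (n - t - 1 + 1) (φ t h) + η
  have hex : ∀ t h, ∃ c, good t h c := fun t h => by
    obtain ⟨c, hc⟩ := exists_law_add_condRad_le he hb hd hrad hqd (n - t - 1) (hφ t h) hη
    exact ⟨c, fun m => hc (d m)⟩
  have hφm : ∀ t i, Measurable fun h => φ t h i := fun t i =>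
    (Finset.measurable_sum _ fun s _ => (he i).comp (measurable_pi_apply s)).neg
  -- The least admissible number of a law depends measurably on the past, since admissibility is a
  -- countable intersection of measurable conditions.
  refine ⟨fun t h => Nat.find (hex t h), fun t => measurable_find _ fun c => ?_, fun z => ?_⟩
  · simp only [good, Set.ofPred_forall]
    refine MeasurableSet.iInter fun m => measurableSet_le ?_ ?_
    · exact (measurable_condRad _ fun i => (hφm t i).sub_const _).const_add _
    · exact (measurable_condRad _ fun i => hφm t i).add_const _
  · have hstep : ∀ t : Fin n, ∫ i, e (z t) i ∂(q (Nat.find (hex t (past t z))))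
        + condRad a (n - t - 1) (φ t (past t z) - e (z t))
        ≤ condRad a (n - t - 1 + 1) (φ t (past t z)) + η := fun t =>
      add_condRad_le_of_dense hb hd _ _ (hφ _ _) (Nat.find_spec (hex t (past t z))) (z t)
    -- Padding beyond time `n` allows an induction over natural numbers; the padded values are never
    -- used.
    let z' : ℕ → W := fun s => if h : s < n then z ⟨s, h⟩ else Classical.arbitrary W
    have hz' : ∀ t : Fin n, z' t = z t := fun t => by simp [z', t.2]
    let L : ℕ → ℝ := fun s => if h : s < n then
      ∫ i, e (z ⟨s, h⟩) i ∂(q (Nat.find (hex ⟨s, h⟩ (past ⟨s, h⟩ z)))) else 0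
    have hind : ∀ t ≤ n, ∑ s ∈ Finset.range t, L s
        + condRad a (n - t) (-∑ s ∈ Finset.range t, e (z' s)) ≤ condRad a n 0 + t * η := by
      intro t
      induction t with
      | zero => simp
      | succ t ih =>
        intro ht
        have h1 := ih (by omega)
        have h2 := hstep ⟨t, ht⟩
        have e1 : φ t (past ⟨t, ht⟩ z) = -∑ s ∈ Finset.range t, e (z' s) := by
          funext i
          simp only [φ, Pi.neg_apply, Finset.sum_apply]
          rw [Finset.sum_range fun s => e (z' s) i]
          congr 1
          refine Finset.sum_congr rfl fun s _ => ?_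
          rw [show z' s = past ⟨t, ht⟩ z s from hz' ⟨s, s.2.trans ht⟩]
        have e2 : n - t - 1 + 1 = n - t := by omega
        have e3 : n - (t + 1) = n - t - 1 := by omega
        have e4 : L t = ∫ i, e (z ⟨t, ht⟩) i ∂(q (Nat.find (hex ⟨t, ht⟩ (past ⟨t, ht⟩ z)))) :=
          dif_pos (Nat.lt_of_succ_le ht)
        have e5 : (-∑ s ∈ Finset.range t, e (z' s)) - e (z ⟨t, ht⟩)
            = -∑ s ∈ Finset.range (t + 1), e (z' s) := by
          rw [Finset.sum_range_succ, show z' t = z ⟨t, ht⟩ from hz' ⟨t, ht⟩]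
          abel
        dsimp only at h2
        rw [e1, e2, ← e4, e5] at h2
        rw [Finset.sum_range_succ, e3]
        push_cast
        linarith
    have h1 := hind n le_rfl
    have e1 : ∑ s ∈ Finset.range n, L s
        = ∑ t : Fin n, ∫ i, e (z t) i ∂(q (Nat.find (hex t (past t z)))) := by
      rw [Finset.sum_range]
      exact Finset.sum_congr rfl fun t _ => dif_pos t.2
    have e2 : condRad a (n - n) (-∑ s ∈ Finset.range n, e (z' s)) = -⨅ i, ∑ t, e (z t) i := by
      have : ∀ i, (-∑ s ∈ Finset.range n, e (z' s)) i = -∑ t, e (z t) i := fun i => by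
        simp only [Pi.neg_apply, Finset.sum_apply]
        rw [Finset.sum_range fun s => e (z' s) i]
        simp only [hz']
      rw [Nat.sub_self]
      simp only [condRad, this]
      exact iSup_neg_eq _
    rw [e1, e2] at h1
    linarith

end strategy

/-! ### The martingale bound -/

section martingale

variable {Ω 𝓗 W I : Type*} [MeasurableSpace Ω] [m𝓗 : MeasurableSpace 𝓗] [MeasurableSpace W]

/-- Disintegration of an expectation along a regular conditional distribution. -/
theorem integral_comp_pair_eq (μ : Measure Ω) [IsProbabilityMeasure μ] {H : Ω → 𝓗}
    (hH : Measurable H) {X : Ω → W} (hX : Measurable X) {κ : 𝓗 → Measure W} (hκ : Measurable κ)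
    (hκp : ∀ h, IsProbabilityMeasure (κ h))
    (hdis : ∀ S B, MeasurableSet S → MeasurableSet B →
      ∫⁻ ω in H ⁻¹' S, κ (H ω) B ∂μ = μ (H ⁻¹' S ∩ X ⁻¹' B))
    {G : 𝓗 × W → ℝ} (hG : Measurable G) {C : ℝ} (hC : ∀ p, |G p| ≤ C) :
    ∫ ω, G (H ω, X ω) ∂μ = ∫ ω, ∫ x, G (H ω, x) ∂(κ (H ω)) ∂μ := by
  let K : Kernel 𝓗 W := ⟨κ, hκ⟩
  have : IsMarkovKernel K := ⟨hκp⟩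
  have : IsProbabilityMeasure (μ.map H) := Measure.isProbabilityMeasure_map hH.aemeasurable
  have key : (μ.map H) ⊗ₘ K = μ.map fun ω => (H ω, X ω) := by
    refine Measure.ext_prod_iff.2 fun {S B} hS hB => ?_
    rw [Measure.compProd_apply_prod hS hB, Measure.map_apply (hH.prodMk hX) (hS.prod hB),
      setLIntegral_map hS (K.measurable_coe hB) hH]
    exact hdis S B hS hB
  have h1 : ∫ ω, G (H ω, X ω) ∂μ = ∫ p, G p ∂(μ.map fun ω => (H ω, X ω)) :=
    (integral_map (hH.prodMk hX).aemeasurable hG.aestronglyMeasurable).symm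
  rw [h1, ← key, Measure.integral_compProd
    (.of_bound hG.aestronglyMeasurable C (.of_forall hC)),
    integral_map hH.aemeasurable]
  · rfl
  · exact (hG.stronglyMeasurable.integral_kernel_prod_right' (κ := K)).aestronglyMeasurable

variable [Nonempty I] [Countable I] {e : W → I → ℝ} {d : ℕ → W}

theorem measurable_integral_apply {κ : 𝓗 → Measure W} (hκ : Measurable κ)
    (hκp : ∀ h, IsProbabilityMeasure (κ h)) {g : W → ℝ} (hg : Measurable g) :
    Measurable fun h => ∫ x, g x ∂(κ h) := by
  let K : Kernel 𝓗 W := ⟨κ, hκ⟩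
  have : IsMarkovKernel K := ⟨hκp⟩
  have h : Measurable fun p : 𝓗 × W => g p.2 := hg.comp measurable_snd
  exact (h.stronglyMeasurable.integral_kernel_prod_right' (κ := K)).measurable

/-- Given the history, the next step is a centred random step drawn from `κ`, so conditional
symmetrization trades it for one round of `condRad`. -/
theorem integral_condRad_step (he : ∀ i, Measurable fun w => e w i)
    (hb : ∀ w i, |e w i| ≤ 2) (hd : ∀ w, e w ∈ closure (Set.range fun m => e (d m)))
    (μ : Measure Ω) [IsProbabilityMeasure μ] {H : Ω → 𝓗}
    (hH : Measurable H) {X : Ω → W} (hX : Measurable X) {κ : 𝓗 → Measure W} (hκ : Measurable κ)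
    (hκp : ∀ h, IsProbabilityMeasure (κ h))
    (hdis : ∀ S B, MeasurableSet S → MeasurableSet B →
      ∫⁻ ω in H ⁻¹' S, κ (H ω) B ∂μ = μ (H ⁻¹' S ∩ X ⁻¹' B))
    {ψ : 𝓗 → I → ℝ} (hψ : ∀ i, Measurable fun h => ψ h i) {C : ℝ} (hC : ∀ h i, |ψ h i| ≤ C)
    (k : ℕ) :
    ∫ ω, condRad (fun m => e (d m)) k
        (ψ (H ω) + (e (X ω) - fun i => ∫ x, e x i ∂(κ (H ω)))) ∂μ
      ≤ ∫ ω, condRad (fun m => e (d m)) (k + 1) (ψ (H ω)) ∂μ := by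
  set a := fun m => e (d m)
  have ha : ∀ m i, |a m i| ≤ 2 := fun m i => hb _ _
  let θ : 𝓗 × W → I → ℝ := fun p => ψ p.1 + (e p.2 - fun i => ∫ x, e x i ∂(κ p.1))
  have hθ : ∀ i, Measurable fun p => θ p i := fun i =>
    ((hψ i).comp measurable_fst).add (((he i).comp measurable_snd).sub
      ((measurable_integral_apply hκ hκp (he i)).comp measurable_fst))
  have hθb : ∀ p i, |θ p i| ≤ C + 4 := fun p i => by
    have h1 := abs_le.1 (hC p.1 i)
    have h2 := abs_le.1 (hb p.2 i)
    have h3 := abs_le.1 (abs_integral_le_of_abs_le (κ p.1) fun x => hb x i)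
    simp only [θ, Pi.add_apply, Pi.sub_apply]
    rw [abs_le]; constructor <;> linarith
  have hm : Measurable fun p => condRad a k (θ p) := measurable_condRad k hθ
  let K : Kernel 𝓗 W := ⟨κ, hκ⟩
  have : IsMarkovKernel K := ⟨hκp⟩
  rw [integral_comp_pair_eq μ hH hX hκ hκp hdis hm fun p => abs_condRad_le ha k (hθb p)]
  refine integral_mono ?_ (integrable_condRad ha μ (k + 1) (fun i => (hψ i).comp hH)
    fun ω => hC (H ω)) fun ω => integral_condRad_le' he hb hd (κ (H ω)) k (hC (H ω))
  refine .of_bound (((hm.stronglyMeasurable.integral_kernel_prod_right'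
    (κ := K)).measurable.comp hH).aestronglyMeasurable) (C + 4 + 4 * k) (.of_forall fun ω => ?_)
  exact abs_integral_le_of_abs_le (κ (H ω)) fun x => abs_condRad_le ha k (hθb (H ω, x))

/-- The expected uniform deviation of a process from its conditional means is at most the
sequential Rademacher complexity. -/
theorem integral_iSup_sum_le (he : ∀ i, Measurable fun w => e w i)
    (hb : ∀ w i, |e w i| ≤ 2) (hd : ∀ w, e w ∈ closure (Set.range fun m => e (d m)))
    (μ : Measure Ω) [IsProbabilityMeasure μ] {n : ℕ} {m : Fin n → MeasurableSpace Ω}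
    (hm : ∀ t, m t ≤ ‹MeasurableSpace Ω›) {X : Fin n → Ω → W} (hX : ∀ t, Measurable (X t))
    {κ : Fin n → Ω → Measure W} (hκ : ∀ t, Measurable[m t] (κ t))
    (hκp : ∀ t ω, IsProbabilityMeasure (κ t ω))
    (hXm : ∀ s t, s < t → Measurable[m t] (X s)) (hκm : ∀ s t, s < t → m s ≤ m t)
    (hdis : ∀ t S B, MeasurableSet[m t] S → MeasurableSet B →
      ∫⁻ ω in S, κ t ω B ∂μ = μ (S ∩ X t ⁻¹' B)) :
    ∫ ω, ⨆ i, ∑ t, (e (X t ω) i - ∫ x, e x i ∂(κ t ω)) ∂μ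
      ≤ condRad (fun m => e (d m)) n 0 := by
  set a := fun m => e (d m)
  let D : ℕ → Ω → I → ℝ := fun s ω =>
    if h : s < n then (e (X ⟨s, h⟩ ω) - fun i => ∫ x, e x i ∂(κ ⟨s, h⟩ ω)) else 0
  have hD : ∀ t : Fin n, ∀ ω, D t ω = e (X t ω) - fun i => ∫ x, e x i ∂(κ t ω) := fun t ω => by
    simp [D, t.2]
  have hDb : ∀ s ω i, |D s ω i| ≤ 4 := fun s ω i => by
    by_cases h : s < n
    · have h2 := abs_le.1 (hb (X ⟨s, h⟩ ω) i)
      have h3 := abs_le.1 (abs_integral_le_of_abs_le (κ ⟨s, h⟩ ω) fun x => hb x i)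
      simp only [D, h, dif_pos, Pi.sub_apply]
      rw [abs_le]; constructor <;> linarith
    · simp [D, h]
  have hDm : ∀ t : Fin n, ∀ s < (t : ℕ), ∀ i, Measurable[m t] fun ω => D s ω i := by
    intro t s hs i
    have h : s < n := hs.trans t.2
    simp only [D, h, dif_pos, Pi.sub_apply]
    have h1 : Measurable[m t] fun ω => e (X ⟨s, h⟩ ω) i := (he i).comp (hXm ⟨s, h⟩ t hs)
    have h2 : Measurable[m t] fun ω => ∫ x, e x i ∂(κ ⟨s, h⟩ ω) :=
      @measurable_integral_apply Ω W (m t) _ _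
        ((hκ ⟨s, h⟩).mono (hκm ⟨s, h⟩ t hs) le_rfl) (hκp ⟨s, h⟩) _ (he i)
    exact h1.sub h2
  have hind : ∀ t ≤ n, ∫ ω, condRad a (n - t) (∑ s ∈ Finset.range t, D s ω) ∂μ
      ≤ condRad a n 0 := by
    intro t
    induction t with
    | zero => simp
    | succ t ih =>
      intro ht
      refine le_trans ?_ (ih (by omega))
      let T : Fin n := ⟨t, ht⟩
      have hψ : ∀ i, Measurable[m T] fun ω => (∑ s ∈ Finset.range t, D s ω) i := fun i => by
        simp only [Finset.sum_apply]
        exact Finset.measurable_sum (m := m T) _ fun s hs => hDm T s (Finset.mem_range.1 hs) i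
      have hψb : ∀ ω i, |(∑ s ∈ Finset.range t, D s ω) i| ≤ t * 4 := fun ω i => by
        rw [Finset.sum_apply]
        refine (Finset.abs_sum_le_sum_abs _ _).trans
          ((Finset.sum_le_sum fun s _ => hDb s ω i).trans ?_)
        simp
      -- The history space is `Ω` itself with the smaller σ-algebra `m T`, and the history map is
      -- the identity.
      have h := @integral_condRad_step Ω Ω W I _ (m T) _ _ _ e d he hb hd μ _ id (hm T)
        (X T) (hX T) (κ T) (hκ T) (hκp T) (hdis T) _ hψ _ hψb (n - t - 1)
      have e2 : n - t - 1 + 1 = n - t := by omega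
      have e3 : n - (t + 1) = n - t - 1 := by omega
      rw [e2] at h
      rw [e3]
      refine le_of_eq_of_le ?_ h
      congr 1; funext ω
      rw [Finset.sum_range_succ, hD T]
      rfl
  have h := hind n le_rfl
  rw [Nat.sub_self] at h
  refine le_of_eq_of_le ?_ h
  congr 1; funext ω
  simp only [condRad]
  congr 1; funext i
  rw [Finset.sum_apply, Finset.sum_range]
  exact Finset.sum_congr rfl fun t _ => by rw [hD t]; rfl

end martingale

/-! ### Elementary bounds -/

/-- The upper bound matters: a real `limsup` without an eventual upper bound is the infimum of the
empty set, which is `0` by default. -/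
theorem limsup_eq_zero_iff {w : ℕ → ℝ} {C : ℝ} (h0 : ∀ n, 0 ≤ w n) (hC : ∀ n, w n ≤ C) :
    limsup w atTop = 0 ↔ ∀ ε > 0, ∀ᶠ n in atTop, w n ≤ ε := by
  constructor
  · intro h ε hε
    have hb : IsBoundedUnder (· ≤ ·) atTop w := ⟨C, by simpa using ⟨0, fun n _ => hC n⟩⟩
    exact (eventually_lt_of_limsup_lt (by rw [h]; exact hε) hb).mono fun n hn => hn.le
  · intro h
    refine Tendsto.limsup_eq (tendsto_order.2 ⟨fun a ha => .of_forall fun n => ha.trans_le (h0 n),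
      fun a ha => ?_⟩)
    exact (h (a / 2) (by positivity)).mono fun n hn => by linarith

theorem absLoss_nonneg {𝒳 : Type u} (f : 𝒳 → Y) (z : Z 𝒳) : 0 ≤ absLoss f z := abs_nonneg _

theorem absLoss_le {𝒳 : Type u} (f : 𝒳 → Y) (z : Z 𝒳) : absLoss f z ≤ 2 := by
  have h1 := z.2.2
  have h2 := (f z.1).2
  rw [absLoss, abs_le]
  constructor <;> linarith [h1.1, h1.2, h2.1, h2.2]

theorem abs_absLoss_le {𝒳 : Type u} (f : 𝒳 → Y) (z : Z 𝒳) : |absLoss f z| ≤ 2 := by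
  rw [abs_of_nonneg (absLoss_nonneg f z)]; exact absLoss_le f z

theorem abs_coe_le (y : Y) : |(y : ℝ)| ≤ 1 := abs_le.2 y.2

theorem abs_sgn (b : Bool) : |sgn b| = 1 := by cases b <;> simp [sgn]

theorem sgn_mul_self (b : Bool) : sgn b * sgn b = 1 := by cases b <;> simp [sgn]

theorem sgn_not (b : Bool) : sgn (!b) = -sgn b := by cases b <;> simp [sgn]

section measurable

variable {𝒳 : Type u} [MeasurableSpace 𝒳]

theorem risk_nonneg (P : Measure (Z 𝒳)) (f : 𝒳 → Y) : 0 ≤ risk P f :=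
  integral_nonneg fun z => absLoss_nonneg f z

theorem abs_risk_le (P : Measure (Z 𝒳)) [IsProbabilityMeasure P] (f : 𝒳 → Y) :
    |risk P f| ≤ 2 :=
  abs_integral_le_of_abs_le P fun z => abs_absLoss_le f z

theorem risk_le (P : Measure (Z 𝒳)) [IsProbabilityMeasure P] (f : 𝒳 → Y) : risk P f ≤ 2 :=
  (le_abs_self _).trans (abs_risk_le P f)

theorem measurable_absLoss {f : 𝒳 → Y} (hf : Measurable f) : Measurable (absLoss f) := by
  have h1 : Measurable fun z : Z 𝒳 => (z.2 : ℝ) := measurable_subtype_coe.comp measurable_snd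
  have h2 : Measurable fun z : Z 𝒳 => (f z.1 : ℝ) :=
    measurable_subtype_coe.comp (hf.comp measurable_fst)
  exact (h1.sub h2).abs

theorem measurable_past {α : Type*} [MeasurableSpace α] {n : ℕ} (t : Fin n) :
    Measurable (past t : (Fin n → α) → Fin t → α) :=
  measurable_pi_lambda _ fun _ => measurable_pi_apply _

theorem sum_mem_Icc {n : ℕ} {g : Fin n → ℝ} (h : ∀ t, g t ∈ Set.Icc (0 : ℝ) 2) :
    ∑ t, g t ∈ Set.Icc (0 : ℝ) (2 * n) := by
  refine ⟨Finset.sum_nonneg fun t _ => (h t).1, (Finset.sum_le_sum fun t _ => (h t).2).trans ?_⟩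
  simp [mul_comm]

theorem iInf_mem_Icc {ι : Type*} [Nonempty ι] {g : ι → ℝ} {C : ℝ}
    (h : ∀ i, g i ∈ Set.Icc (0 : ℝ) C) : ⨅ i, g i ∈ Set.Icc (0 : ℝ) C := by
  obtain ⟨i⟩ := ‹Nonempty ι›
  have : Nonempty ι := ⟨i⟩
  exact ⟨le_ciInf fun i => (h i).1,
    (ciInf_le ⟨0, by rintro _ ⟨j, rfl⟩; exact (h j).1⟩ i).trans (h i).2⟩

/-- Covers `n = 0` as well, where `1 / n` is `0`; thus the values are bounded for every `n`. -/
theorem abs_one_div_mul_le {n : ℕ} {s C : ℝ} (hC : 0 ≤ C) (h : |s| ≤ C * n) :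
    |(1 / n : ℝ) * s| ≤ C := by
  rcases Nat.eq_zero_or_pos n with rfl | hn
  · simpa using hC
  · have hn' : (0 : ℝ) < n := by exact_mod_cast hn
    rw [abs_mul, abs_of_pos (by positivity), one_div, inv_mul_le_iff₀ hn', mul_comm]
    exact h

variable {F : Set (𝒳 → Y)} {n : ℕ}

theorem abs_onlineRegret_le (hne : F.Nonempty) (R : LearningRule F n) (z : Fin n → Z 𝒳) :
    |onlineRegret R z| ≤ 2 := by
  have : Nonempty F := hne.to_subtype
  refine abs_integral_le_of_abs_le _ fun r => abs_one_div_mul_le two_pos.le ?_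
  have h1 : ∑ t : Fin n, absLoss (R.rule t (past t z) r) (z t) ∈ Set.Icc (0 : ℝ) (2 * n) :=
    sum_mem_Icc fun t => ⟨absLoss_nonneg _ _, absLoss_le _ _⟩
  have h2 : ⨅ f : F, ∑ t : Fin n, absLoss (f : 𝒳 → Y) (z t) ∈ Set.Icc (0 : ℝ) (2 * n) :=
    iInf_mem_Icc fun f => sum_mem_Icc fun t => ⟨absLoss_nonneg _ _, absLoss_le _ _⟩
  rw [abs_le]; constructor <;> linarith [h1.1, h1.2, h2.1, h2.2]

theorem abs_preqRegret_le (hne : F.Nonempty) (R : LearningRule F n) (P : JointLaw 𝒳 n) :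
    |preqRegret R P| ≤ 4 := by
  have : Nonempty F := hne.to_subtype
  refine abs_integral_le_of_abs_le _ fun p => ?_
  have h1 : ∀ g : Fin n → 𝒳 → Y,
      |(1 / n : ℝ) * ∑ t : Fin n, risk (P.cond t (past t p.1)) (g t)| ≤ 2 := fun g => by
    refine abs_one_div_mul_le two_pos.le ?_
    have := sum_mem_Icc fun t => ⟨risk_nonneg (P.cond t (past t p.1)) (g t), risk_le _ _⟩
    rw [abs_le]; constructor <;> linarith [this.1, this.2]
  have h2 := abs_le.1 (h1 fun t => R.rule t (past t p.1) p.2)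
  have h3 := abs_le.1 (abs_ciInf_le fun f : F => h1 fun _ => f)
  rw [abs_le]; constructor <;> linarith

/-! ### Prequential learnability implies online learnability -/

/-- The law of a deterministic sequence. -/
def diracLaw (z : Fin n → Z 𝒳) : JointLaw 𝒳 n where
  law := Measure.dirac z
  cond t := Kernel.const _ (Measure.dirac (z t))
  cond_eq t := by
    rw [Measure.map_dirac' (measurable_past t), Measure.map_dirac'
      ((measurable_past t).prodMk (measurable_pi_apply t)), Measure.compProd_const,
      Measure.dirac_prod_dirac]

theorem measurable_absLoss_rule (R : LearningRule F n) (t : Fin n) (z : Z 𝒳) :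
    Measurable fun p : (Fin n → Z 𝒳) × R.Seed => absLoss (R.rule t (past t p.1) p.2) z := by
  have h : Measurable fun p : (Fin n → Z 𝒳) × R.Seed =>
      (R.rule t (past t p.1) p.2 : 𝒳 → Y) z.1 :=
    (R.measurable_rule t).comp (((measurable_past t).comp measurable_fst).prodMk
      (measurable_snd.prodMk measurable_const))
  exact ((measurable_subtype_coe.comp h).const_sub _).abs

theorem preqRegret_diracLaw (hF : PointwiseMeasurable F) (R : LearningRule F n)
    (z : Fin n → Z 𝒳) : preqRegret R (diracLaw z) = onlineRegret R z := by
  have hrisk : ∀ (t : Fin n) (h : Fin t → Z 𝒳) (f : F),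
      risk ((diracLaw z).cond t h) (f : 𝒳 → Y) = absLoss f (z t) := fun t h f =>
    integral_dirac' _ _ (measurable_absLoss (hF.measurable f f.2)).stronglyMeasurable
  have hm : Measurable fun p : (Fin n → Z 𝒳) × R.Seed =>
      ((1 / n : ℝ) * ∑ t : Fin n, absLoss (R.rule t (past t p.1) p.2) (z t))
      - ⨅ f : F, (1 / n : ℝ) * ∑ t : Fin n, absLoss (f : 𝒳 → Y) (z t) :=
    ((Finset.measurable_sum _ fun t _ => measurable_absLoss_rule R t (z t)).const_mul _).sub_const _
  simp only [preqRegret, hrisk]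
  change ∫ p, _ ∂((Measure.dirac z).prod R.seedLaw) = _
  rw [Measure.dirac_prod, integral_map (measurable_prodMk_left.aemeasurable)
    hm.aestronglyMeasurable]
  simp only [onlineRegret, mul_sub]
  rw [Real.mul_iInf_of_nonneg (by positivity)]

theorem onlineRegret_le_iSup_preqRegret (hne : F.Nonempty) (hF : PointwiseMeasurable F)
    (R : LearningRule F n) (z : Fin n → Z 𝒳) :
    onlineRegret R z ≤ ⨆ P : JointLaw 𝒳 n, preqRegret R P := by
  rw [← preqRegret_diracLaw hF]
  exact le_ciSup (bddAbove_of_abs_le (abs_preqRegret_le hne R)) (diracLaw z)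

/-- On a sequence labelled by a member of the class the comparator has loss zero. This makes the
game values nonnegative and their infima bounded below. -/
theorem exists_onlineRegret_nonneg [Nonempty 𝒳] (hne : F.Nonempty) (R : LearningRule F n) :
    ∃ z, 0 ≤ onlineRegret R z := by
  obtain ⟨g, hg⟩ := hne
  let x₀ : 𝒳 := Classical.arbitrary 𝒳
  refine ⟨fun _ => (x₀, g x₀), integral_nonneg fun r => mul_nonneg (by positivity) ?_⟩
  have h1 : ⨅ f : F, ∑ _t : Fin n, absLoss (f : 𝒳 → Y) (x₀, g x₀) ≤ 0 := by
    refine (ciInf_le ⟨0, ?_⟩ (⟨g, hg⟩ : F)).trans (by simp [absLoss])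
    rintro _ ⟨f, rfl⟩
    exact Finset.sum_nonneg fun t _ => absLoss_nonneg _ _
  have h2 : 0 ≤ ∑ t : Fin n, absLoss (R.rule t (past t fun _ => (x₀, g x₀)) r) (x₀, g x₀) :=
    Finset.sum_nonneg fun t _ => absLoss_nonneg _ _
  linarith

theorem iSup_onlineRegret_nonneg [Nonempty 𝒳] (hne : F.Nonempty) (R : LearningRule F n) :
    0 ≤ ⨆ z, onlineRegret R z := by
  obtain ⟨z, hz⟩ := exists_onlineRegret_nonneg hne R
  exact hz.trans (le_ciSup (bddAbove_of_abs_le (abs_onlineRegret_le hne R)) z)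

theorem iSup_preqRegret_nonneg [Nonempty 𝒳] (hne : F.Nonempty) (hF : PointwiseMeasurable F)
    (R : LearningRule F n) : 0 ≤ ⨆ P : JointLaw 𝒳 n, preqRegret R P := by
  obtain ⟨z, hz⟩ := exists_onlineRegret_nonneg hne R
  exact hz.trans (onlineRegret_le_iSup_preqRegret hne hF R z)

/-- The rule that always plays the same function. -/
def constRule (hF : PointwiseMeasurable F) (g : F) : LearningRule F n where
  Seed := Unit
  seedLaw := Measure.dirac ()
  rule _ _ _ := g
  measurable_rule _ := (hF.measurable g g.2).comp (measurable_snd.comp measurable_snd)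

theorem nonempty_learningRule (hne : F.Nonempty) (hF : PointwiseMeasurable F) :
    Nonempty (LearningRule F n) := ⟨constRule hF ⟨_, hne.some_mem⟩⟩

theorem nonempty_jointLaw [Nonempty 𝒳] : Nonempty (JointLaw 𝒳 n) :=
  ⟨diracLaw fun _ => (Classical.arbitrary 𝒳, ⟨0, by norm_num⟩)⟩

theorem onlineValue_nonneg [Nonempty 𝒳] (hne : F.Nonempty) (hF : PointwiseMeasurable F) (n : ℕ) :
    0 ≤ onlineValue F n :=
  have := nonempty_learningRule (n := n) hne hF
  le_ciInf fun R => iSup_onlineRegret_nonneg hne R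

theorem bddBelow_onlineValue [Nonempty 𝒳] (hne : F.Nonempty) :
    BddBelow (Set.range fun R : LearningRule F n => ⨆ z, onlineRegret R z) :=
  ⟨0, by rintro _ ⟨R, rfl⟩; exact iSup_onlineRegret_nonneg hne R⟩

theorem bddBelow_preqValue [Nonempty 𝒳] (hne : F.Nonempty) (hF : PointwiseMeasurable F) :
    BddBelow (Set.range fun R : LearningRule F n => ⨆ P : JointLaw 𝒳 n, preqRegret R P) :=
  ⟨0, by rintro _ ⟨R, rfl⟩; exact iSup_preqRegret_nonneg hne hF R⟩

theorem onlineValue_le_preqValue [Nonempty 𝒳] (hne : F.Nonempty) (hF : PointwiseMeasurable F)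
    (n : ℕ) : onlineValue F n ≤ preqValue F n := by
  have := nonempty_learningRule (n := n) hne hF
  have : Nonempty (Fin n → Z 𝒳) := ⟨fun _ => (Classical.arbitrary 𝒳, ⟨0, by norm_num⟩)⟩
  exact ciInf_mono (bddBelow_onlineValue hne) fun R =>
    ciSup_le fun z => onlineRegret_le_iSup_preqRegret hne hF R z

theorem preqValue_nonneg [Nonempty 𝒳] (hne : F.Nonempty) (hF : PointwiseMeasurable F) (n : ℕ) :
    0 ≤ preqValue F n :=
  (onlineValue_nonneg hne hF n).trans (onlineValue_le_preqValue hne hF n)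

theorem preqValue_le [Nonempty 𝒳] (hne : F.Nonempty) (hF : PointwiseMeasurable F) (n : ℕ) :
    preqValue F n ≤ 4 := by
  obtain ⟨R⟩ := nonempty_learningRule (n := n) hne hF
  have := nonempty_jointLaw (𝒳 := 𝒳) (n := n)
  exact (ciInf_le (bddBelow_preqValue hne hF) R).trans
    (ciSup_le fun P => (le_abs_self _).trans (abs_preqRegret_le hne R P))

end measurable

theorem onlineLearnable_of_prequentiallyLearnable {𝒳 : Type u} [MeasurableSpace 𝒳] [Nonempty 𝒳]
    {F : Set (𝒳 → Y)} (hne : F.Nonempty) (hF : PointwiseMeasurable F)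
    (h : PrequentiallyLearnable F) : OnlineLearnable F := by
  have h1 := (limsup_eq_zero_iff (preqValue_nonneg hne hF) (preqValue_le hne hF)).1 h
  refine (limsup_eq_zero_iff (onlineValue_nonneg hne hF) fun n =>
    (onlineValue_le_preqValue hne hF n).trans (preqValue_le hne hF n)).2 fun ε hε => ?_
  exact (h1 ε hε).mono fun n hn => (onlineValue_le_preqValue hne hF n).trans hn

/-! ### Sequential Rademacher complexity -/

section signs

variable {n : ℕ}

/-- Flipping the sign at time `t`. -/
def flipSign (t : Fin n) (ε : Fin n → Bool) : Fin n → Bool := Function.update ε t (!ε t)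

theorem flipSign_involutive (t : Fin n) : Function.Involutive (flipSign t) := fun ε => by
  simp [flipSign]

theorem flipSign_self (t : Fin n) (ε : Fin n → Bool) : flipSign t ε t = !ε t := by simp [flipSign]

theorem flipSign_of_ne {s t : Fin n} (h : s ≠ t) (ε : Fin n → Bool) :
    flipSign t ε s = ε s := by simp [flipSign, h]

theorem past_flipSign {s t : Fin n} (h : s ≤ t) (ε : Fin n → Bool) :
    past s (flipSign t ε) = past s ε := by
  funext i
  refine flipSign_of_ne (fun h' => ?_) ε
  have h1 := i.2
  have h2 := congrArg Fin.val h'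
  simp only at h2
  have h3 : (s : ℕ) ≤ t := h
  omega

/-- Flipping the sign at `t` is an involution that negates every term. It plays the role of the
martingale property for random signs. -/
theorem sum_sgn_mul_eq_zero (t : Fin n) {h : (Fin n → Bool) → ℝ}
    (hh : ∀ ε, h (flipSign t ε) = h ε) : ∑ ε, sgn (ε t) * h ε = 0 := by
  have h1 : ∑ ε, sgn (ε t) * h ε = ∑ ε, sgn (flipSign t ε t) * h (flipSign t ε) :=
    (Equiv.sum_comp (flipSign_involutive t).toPerm fun ε => sgn (ε t) * h ε).symm
  simp only [flipSign_self, sgn_not, hh, neg_mul, Finset.sum_neg_distrib] at h1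
  linarith

theorem sum_sgn_sq (n : ℕ) : ∑ ε : Fin n → Bool, (∑ t, sgn (ε t)) ^ 2 = n * 2 ^ n := by
  have h1 : ∀ t s : Fin n, ∑ ε : Fin n → Bool, sgn (ε t) * sgn (ε s)
      = if s = t then 2 ^ n else 0 := by
    intro t s
    split_ifs with h
    · subst h; simp [sgn_mul_self]
    · exact sum_sgn_mul_eq_zero t fun ε => by rw [flipSign_of_ne h]
  simp only [sq, Finset.sum_mul_sum]
  rw [Finset.sum_comm]
  simp_rw [Finset.sum_comm (s := (Finset.univ : Finset (Fin n → Bool))), h1]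
  simp

end signs

/-! ### Shattered trees have large complexity -/

section seqRad

variable {𝒳 : Type u} {F : Set (𝒳 → Y)} {n : ℕ}

theorem abs_seqRadSum_le (g : 𝒳 → Y) (x : BinTree 𝒳 n) (ε : Fin n → Bool) :
    |(1 / n : ℝ) * ∑ t : Fin n, sgn (ε t) * (g (x t (past t ε)) : ℝ)| ≤ 1 := by
  refine abs_one_div_mul_le one_pos.le ((Finset.abs_sum_le_sum_abs _ _).trans ?_)
  refine (Finset.sum_le_sum (g := fun _ => (1 : ℝ)) fun t _ => ?_).trans (by simp)
  rw [abs_mul, abs_sgn, one_mul]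
  exact abs_coe_le _

theorem avg_le {b : (Fin n → Bool) → ℝ} {C : ℝ} (h : ∀ ε, b ε ≤ C) :
    (1 / 2 ^ n : ℝ) * ∑ ε, b ε ≤ C := by
  calc _ ≤ (1 / 2 ^ n : ℝ) * ∑ _ε : Fin n → Bool, C := by gcongr; exact h _
    _ = C := by simp

theorem le_avg {b : (Fin n → Bool) → ℝ} {C : ℝ} (h : ∀ ε, C ≤ b ε) :
    C ≤ (1 / 2 ^ n : ℝ) * ∑ ε, b ε := by
  calc C = (1 / 2 ^ n : ℝ) * ∑ _ε : Fin n → Bool, C := by simp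
    _ ≤ _ := by gcongr; exact h _

theorem abs_seqRadOn_le (hne : F.Nonempty) (x : BinTree 𝒳 n) : |seqRadOn F x| ≤ 1 := by
  have : Nonempty F := hne.to_subtype
  have h := fun ε => abs_le.1 (abs_ciSup_le fun f : F => abs_seqRadSum_le (f : 𝒳 → Y) x ε)
  exact abs_le.2 ⟨le_avg fun ε => (h ε).1, avg_le fun ε => (h ε).2⟩

theorem seqRadOn_le_seqRad (hne : F.Nonempty) (x : BinTree 𝒳 n) : seqRadOn F x ≤ seqRad F n :=
  le_ciSup (bddAbove_of_abs_le (abs_seqRadOn_le hne)) x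

theorem seqRad_le [Nonempty 𝒳] (hne : F.Nonempty) (n : ℕ) : seqRad F n ≤ 1 :=
  have : Nonempty (BinTree 𝒳 n) := ⟨fun _ _ => Classical.arbitrary 𝒳⟩
  ciSup_le fun x => (abs_le.1 (abs_seqRadOn_le hne x)).2

theorem seqRad_nonneg [Nonempty 𝒳] (hne : F.Nonempty) (n : ℕ) : 0 ≤ seqRad F n := by
  obtain ⟨g, hg⟩ := hne
  refine le_trans ?_ (seqRadOn_le_seqRad ⟨g, hg⟩ fun _ _ => Classical.arbitrary 𝒳)
  have h1 : (1 / 2 ^ n : ℝ) * ∑ ε : Fin n → Bool, (1 / n : ℝ) * ∑ t : Fin n,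
      sgn (ε t) * (g (Classical.arbitrary 𝒳) : ℝ) = 0 := by
    rw [← Finset.mul_sum, Finset.sum_comm]
    rw [Finset.sum_eq_zero fun t _ => sum_sgn_mul_eq_zero t fun ε => rfl]
    simp
  rw [← h1]
  refine mul_le_mul_of_nonneg_left (Finset.sum_le_sum fun ε _ => ?_) (by positivity)
  exact le_ciSup (f := fun f : F => (1 / n : ℝ) * ∑ t : Fin n,
    sgn (ε t) * ((f : 𝒳 → Y) (Classical.arbitrary 𝒳) : ℝ))
    (bddAbove_of_abs_le fun f : F => abs_seqRadSum_le (f : 𝒳 → Y)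
      (fun _ _ => Classical.arbitrary 𝒳) ε) ⟨g, hg⟩

/-- The witness `s` at time `t` depends on earlier signs only, so its signed sum averages to zero,
while the shattering function gains `γ` over it at each node of the path. -/
theorem le_seqRadOn_of_shattered (hn : 0 < n) {γ : ℝ} {x : BinTree 𝒳 n} (hx : Shattered F γ x) :
    γ ≤ seqRadOn F x := by
  obtain ⟨s, hs⟩ := hx
  have hn' : (0 : ℝ) < n := by exact_mod_cast hn
  have h0 : (1 / 2 ^ n : ℝ) * ∑ ε : Fin n → Bool, (γ + (1 / n : ℝ) * ∑ t : Fin n,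
      sgn (ε t) * s t (past t ε)) = γ := by
    rw [Finset.sum_add_distrib, ← Finset.mul_sum, Finset.sum_comm]
    rw [Finset.sum_eq_zero fun t _ => sum_sgn_mul_eq_zero t fun ε => by
      rw [past_flipSign le_rfl]]
    simp
  rw [← h0]
  refine mul_le_mul_of_nonneg_left (Finset.sum_le_sum fun ε _ => ?_) (by positivity)
  obtain ⟨f, hf, hfs⟩ := hs ε
  refine le_trans ?_ (le_ciSup (bddAbove_of_abs_le fun f : F =>
    abs_seqRadSum_le (f : 𝒳 → Y) x ε) ⟨f, hf⟩)
  have h1 : ∑ _t : Fin n, γ ≤ ∑ t : Fin n, sgn (ε t) * ((f (x t (past t ε)) : ℝ)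
      - s t (past t ε)) := Finset.sum_le_sum fun t _ => hfs t
  simp only [Finset.sum_const, Finset.card_univ, Fintype.card_fin, nsmul_eq_mul, mul_sub,
    Finset.sum_sub_distrib] at h1
  have h2 : γ = (1 / n : ℝ) * (n * γ) := by field_simp
  calc _ = (1 / n : ℝ) * (n * γ + ∑ t : Fin n, sgn (ε t) * s t (past t ε)) := by
        rw [mul_add, ← h2]
    _ ≤ _ := by
        refine mul_le_mul_of_nonneg_left ?_ (by positivity)
        dsimp only
        linarith

theorem sfat_lt_top_of_seqRad [Nonempty 𝒳] (hne : F.Nonempty)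
    (h : limsup (seqRad F) atTop = 0) {γ : ℝ} (hγ : 0 < γ) : sfat F γ < ⊤ := by
  have h1 := (limsup_eq_zero_iff (seqRad_nonneg hne) (seqRad_le hne)).1 h (γ / 2) (by positivity)
  obtain ⟨N, hN⟩ := eventually_atTop.1 h1
  have h2 : sfat F γ ≤ (N : ℕ∞) := by
    refine iSup₂_le fun n hn => ?_
    obtain ⟨x, hx⟩ := hn
    by_contra! hlt
    have hlt' : N < n := by exact_mod_cast hlt
    have h3 := le_seqRadOn_of_shattered (by omega) hx
    have h4 := seqRadOn_le_seqRad hne x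
    have h5 := hN n hlt'.le
    linarith
  exact h2.trans_lt (ENat.natCast_lt_top N)

end seqRad

/-! ### Online learnability implies vanishing complexity -/

/-- A sign as an element of the output space. -/
def signY (b : Bool) : Y := ⟨sgn b, by cases b <;> norm_num [sgn]⟩

theorem absLoss_signY {𝒳 : Type u} (f : 𝒳 → Y) (x : 𝒳) (b : Bool) :
    absLoss f (x, signY b) = 1 - sgn b * (f x : ℝ) := by
  have h := (f x).2
  cases b
  · simp only [absLoss, signY, sgn]
    rw [abs_of_nonpos (by simp; linarith [h.1])]
    simp; ring
  · simp only [absLoss, signY, sgn]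
    rw [abs_of_nonneg (by simp; linarith [h.2])]
    simp

section online

variable {𝒳 : Type u} [MeasurableSpace 𝒳] {F : Set (𝒳 → Y)} {n : ℕ}

/-- For labels `±1` the absolute loss is affine in the prediction. The prediction does not depend on
the current sign, so random labels cancel its contribution on average, and what is left of the
regret is the Rademacher supremum. -/
theorem seqRadOn_le_iSup_onlineRegret (hne : F.Nonempty) (R : LearningRule F n)
    (x : BinTree 𝒳 n) (hn : 0 < n) : seqRadOn F x ≤ ⨆ z, onlineRegret R z := by
  have : Nonempty F := hne.to_subtype
  have hn' : (0 : ℝ) < n := by exact_mod_cast hn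
  let z : (Fin n → Bool) → Fin n → Z 𝒳 := fun ε t => (x t (past t ε), signY (ε t))
  let b : Fin n → (Fin n → Bool) → ℝ := fun t ε =>
    ∫ r, ((R.rule t (past t (z ε)) r : 𝒳 → Y) (x t (past t ε)) : ℝ) ∂(R.seedLaw)
  have hb : ∀ t ε, b t (flipSign t ε) = b t ε := by
    intro t ε
    have h1 : past t (z (flipSign t ε)) = past t (z ε) := by
      funext i
      have hi : (⟨i, i.2.trans t.2⟩ : Fin n) < t := i.2
      simp only [past, z]
      rw [flipSign_of_ne hi.ne]
      congr 1
      exact congrArg _ (past_flipSign hi.le ε)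
    simp only [b, h1, past_flipSign le_rfl]
  have hint : ∀ t ε, Integrable (fun r =>
      ((R.rule t (past t (z ε)) r : 𝒳 → Y) (x t (past t ε)) : ℝ)) R.seedLaw := by
    intro t ε
    refine .of_bound (Measurable.aestronglyMeasurable ?_) 1 (.of_forall fun r => abs_coe_le _)
    exact measurable_subtype_coe.comp ((R.measurable_rule t).comp
      (measurable_const.prodMk (measurable_id.prodMk measurable_const)))
  have hreg : ∀ ε, (⨆ f : F, (1 / n : ℝ) * ∑ t : Fin n,
      sgn (ε t) * ((f : 𝒳 → Y) (x t (past t ε)) : ℝ))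
      - (1 / n : ℝ) * ∑ t, sgn (ε t) * b t ε ≤ onlineRegret R (z ε) := by
    intro ε
    have e1 : onlineRegret R (z ε) = (1 / n : ℝ) * ((n - ∑ t, sgn (ε t) * b t ε)
        - ⨅ f : F, ∑ t : Fin n, absLoss (f : 𝒳 → Y) (z ε t)) := by
      have hi : ∀ t, Integrable (fun r => absLoss (R.rule t (past t (z ε)) r) (z ε t))
          R.seedLaw := fun t => by
        simp only [z, absLoss_signY]
        exact (integrable_const _).sub ((hint t ε).const_mul _)
      have e2 : ∀ t, ∫ r, absLoss (R.rule t (past t (z ε)) r) (z ε t) ∂(R.seedLaw)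
          = 1 - sgn (ε t) * b t ε := fun t => by
        simp only [z, absLoss_signY]
        rw [integral_sub (integrable_const _) ((hint t ε).const_mul _), integral_const_mul]
        simp [b, z]
      simp only [onlineRegret]
      rw [integral_const_mul, integral_sub (integrable_finsetSum _ fun t _ => hi t)
        (integrable_const _), integral_finsetSum _ fun t _ => hi t]
      simp [e2]
    rw [e1, ← Real.mul_iSup_of_nonneg (by positivity), ← mul_sub]
    refine mul_le_mul_of_nonneg_left ?_ (by positivity)
    have h2 : ⨆ f : F, ∑ t : Fin n, sgn (ε t) * ((f : 𝒳 → Y) (x t (past t ε)) : ℝ)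
        ≤ n - ⨅ f : F, ∑ t : Fin n, absLoss (f : 𝒳 → Y) (z ε t) := by
      refine ciSup_le fun f => ?_
      have h3 : ⨅ f : F, ∑ t : Fin n, absLoss (f : 𝒳 → Y) (z ε t)
          ≤ ∑ t : Fin n, absLoss (f : 𝒳 → Y) (z ε t) :=
        ciInf_le ⟨0, by
          rintro _ ⟨g, rfl⟩
          exact Finset.sum_nonneg fun t _ => absLoss_nonneg _ _⟩ f
      simp only [z, absLoss_signY, Finset.sum_sub_distrib, Finset.sum_const, Finset.card_univ,
        Fintype.card_fin, nsmul_eq_mul, mul_one] at h3 ⊢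
      linarith
    linarith
  have hzero : (1 / 2 ^ n : ℝ) * ∑ ε : Fin n → Bool, (1 / n : ℝ) * ∑ t, sgn (ε t) * b t ε = 0 := by
    rw [← Finset.mul_sum, Finset.sum_comm,
      Finset.sum_eq_zero fun t _ => sum_sgn_mul_eq_zero t (hb t)]
    simp
  calc seqRadOn F x = (1 / 2 ^ n : ℝ) * ∑ ε : Fin n → Bool, ((⨆ f : F, (1 / n : ℝ) *
        ∑ t : Fin n, sgn (ε t) * ((f : 𝒳 → Y) (x t (past t ε)) : ℝ))
        - (1 / n : ℝ) * ∑ t, sgn (ε t) * b t ε) := by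
        rw [Finset.sum_sub_distrib, mul_sub, hzero, sub_zero]; rfl
    _ ≤ _ := avg_le fun ε => (hreg ε).trans
        (le_ciSup (bddAbove_of_abs_le (abs_onlineRegret_le hne R)) (z ε))

theorem seqRad_tendsto_of_onlineLearnable [Nonempty 𝒳] (hne : F.Nonempty)
    (hF : PointwiseMeasurable F) (h : OnlineLearnable F) : limsup (seqRad F) atTop = 0 := by
  have h1 := (limsup_eq_zero_iff (onlineValue_nonneg hne hF) fun n =>
    (onlineValue_le_preqValue hne hF n).trans (preqValue_le hne hF n)).1 h
  refine (limsup_eq_zero_iff (seqRad_nonneg hne) (seqRad_le hne)).2 fun ε hε => ?_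
  filter_upwards [h1 ε hε, eventually_gt_atTop 0] with n hn hn0
  refine le_trans ?_ hn
  have := nonempty_learningRule (n := n) hne hF
  have : Nonempty (BinTree 𝒳 n) := ⟨fun _ _ => Classical.arbitrary 𝒳⟩
  exact ciSup_le fun x => le_ciInf fun R => seqRadOn_le_iSup_onlineRegret hne R x hn0

end online

/-! ### The uniform martingale law implies vanishing complexity -/

/-- Independent uniform signs. -/
abbrev SignSpace (n : ℕ) : Type v := ULift.{v} (Fin n → Bool)

/-- All sets of signs are measurable. -/
@[reducible] def signSigma (n : ℕ) : MeasurableSpace (SignSpace.{v} n) := ⊤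

attribute [local instance] signSigma

/-- The uniform distribution. -/
def signLaw (n : ℕ) : Measure (SignSpace.{v} n) :=
  ∑ ε : Fin n → Bool, ENNReal.ofReal (1 / 2 ^ n) • Measure.dirac ⟨ε⟩

section signs

variable {n : ℕ}

instance : IsProbabilityMeasure (signLaw.{v} n) := ⟨by
  simp only [signLaw, Measure.coe_finsetSum, Finset.sum_apply, Measure.smul_apply, measure_univ,
    smul_eq_mul, mul_one]
  rw [← ENNReal.ofReal_sum_of_nonneg fun _ _ => by positivity]
  simp⟩

theorem integral_signLaw (g : SignSpace.{v} n → ℝ) :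
    ∫ ω, g ω ∂(signLaw n) = (1 / 2 ^ n : ℝ) * ∑ ε : Fin n → Bool, g ⟨ε⟩ := by
  have hg : Measurable g := measurable_from_top
  rw [signLaw, integral_finsetSum_measure fun ε _ =>
    (Integrable.of_bound hg.aestronglyMeasurable (∑ ε, |g ⟨ε⟩|) (.of_forall fun ω =>
      Finset.single_le_sum (f := fun ε => |g ⟨ε⟩|) (fun _ _ => abs_nonneg _)
        (Finset.mem_univ ω.down))).smul_measure ENNReal.ofReal_ne_top, Finset.mul_sum]
  refine Finset.sum_congr rfl fun ε _ => ?_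
  rw [integral_smul_measure, integral_dirac' _ _ hg.stronglyMeasurable,
    ENNReal.toReal_ofReal (by positivity), smul_eq_mul]

theorem integrable_signLaw (g : SignSpace.{v} n → ℝ) : Integrable g (signLaw n) := by
  have hg : Measurable g := measurable_from_top
  exact .of_bound hg.aestronglyMeasurable (∑ ε, |g ⟨ε⟩|) (.of_forall fun ω =>
    Finset.single_le_sum (f := fun ε => |g ⟨ε⟩|) (fun _ _ => abs_nonneg _)
      (Finset.mem_univ ω.down))

/-- The signs before time `k`. -/
def truncSign (k : ℕ) (ω : SignSpace.{v} n) : Fin n → Bool :=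
  fun i => if (i : ℕ) < k then ω.down i else false

theorem past_truncSign {t : Fin n} {k : ℕ} (h : (t : ℕ) ≤ k) (ω : SignSpace.{v} n) :
    past t (truncSign k ω) = past t ω.down := by
  funext i
  exact if_pos (lt_of_lt_of_le i.2 h)

/-- The natural filtration of the signs. -/
def signFiltration (n : ℕ) : Filtration ℕ (signSigma.{v} n) where
  seq k := MeasurableSpace.comap (truncSign k) ⊤
  mono' k l hkl := by
    have h : (truncSign k : SignSpace.{v} n → _)
        = (fun (ε : Fin n → Bool) (i : Fin n) => if (i : ℕ) < k then ε i else false) ∘ truncSign l := by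
      funext ω i
      simp only [truncSign, Function.comp]
      split_ifs with h1 h2
      · rfl
      · omega
      · rfl
    change MeasurableSpace.comap (truncSign k) ⊤ ≤ MeasurableSpace.comap (truncSign l) ⊤
    rw [h, ← MeasurableSpace.comap_comp]
    exact MeasurableSpace.comap_mono le_top
  le' _ := le_top

theorem measurable_truncSign_comp {β : Type*} [MeasurableSpace β] (k : ℕ)
    (g : (Fin n → Bool) → β) :
    Measurable[signFiltration.{v} n k] fun ω : SignSpace.{v} n => g (truncSign k ω) := by
  intro s _
  exact ⟨g ⁻¹' s, trivial, rfl⟩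

variable {𝒳 : Type u} [MeasurableSpace 𝒳]

/-- The process that visits the node of the tree `x` when the next sign is `+1`, and rests at `x₀`
otherwise. -/
def treeProcess (x : BinTree 𝒳 n) (x₀ : 𝒳) : FilteredProcess.{u, v} 𝒳 n where
  Ω := SignSpace.{v} n
  space := signSigma n
  μ := signLaw n
  𝓐 := signFiltration n
  X t ω := if ω.down t then x t (past t ω.down) else x₀
  adapted t := by
    have h := measurable_truncSign_comp.{v} ((t : ℕ) + 1) fun ε : Fin n → Bool =>
      if ε t then x t (past t ε) else x₀
    convert h using 3 with ω
    · simp [truncSign]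
    · rw [past_truncSign (Nat.le_succ _)]
  cond t ω := (2⁻¹ : ENNReal) • Measure.dirac (x t (past t ω.down))
    + (2⁻¹ : ENNReal) • Measure.dirac x₀
  cond_prob t ω := ⟨by simp [ENNReal.inv_two_add_inv_two]⟩
  cond_measurable t := by
    have h := measurable_truncSign_comp.{v} (t : ℕ) fun ε : Fin n → Bool =>
      (2⁻¹ : ENNReal) • Measure.dirac (x t (past t ε)) + (2⁻¹ : ENNReal) • Measure.dirac x₀
    simpa only [past_truncSign le_rfl] using h
  cond_eq t B hB := by
    refine ae_eq_condExp_of_forall_setIntegral_eq ((signFiltration n).le t)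
      (integrable_signLaw _) (fun s _ _ => (integrable_signLaw _).integrableOn) ?_ ?_
    · intro s hs _
      obtain ⟨s', -, rfl⟩ := hs
      have hms : MeasurableSet (truncSign.{v} (n := n) t ⁻¹' s') := trivial
      rw [← integral_indicator hms, ← integral_indicator hms, integral_signLaw, integral_signLaw]
      congr 1
      rw [← sub_eq_zero, ← Finset.sum_sub_distrib]
      -- The conditional probability minus the indicator is `sgn (ε t)` times this function, which
      -- does not depend on the sign at `t`; hence the sum vanishes.
      let g : (Fin n → Bool) → ℝ := fun ε => (s'.indicator (fun _ => 1) (truncSign.{v} t ⟨ε⟩)) *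
        ((B.indicator (fun _ => 1) x₀ - B.indicator (fun _ => 1) (x t (past t ε))) / 2)
      have hg : ∀ ε, g (flipSign t ε) = g ε := by
        intro ε
        have : truncSign.{v} (n := n) t ⟨flipSign t ε⟩ = truncSign t ⟨ε⟩ := by
          funext i
          simp only [truncSign]
          split_ifs with h
          · exact flipSign_of_ne (by rintro rfl; exact lt_irrefl _ h) ε
          · rfl
        simp only [g]
        rw [this, past_flipSign le_rfl]
      rw [← sum_sgn_mul_eq_zero t hg]
      refine Finset.sum_congr rfl fun ε _ => ?_
      have hc : ∀ y : 𝒳, (((2⁻¹ : ENNReal) • Measure.dirac y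
          + (2⁻¹ : ENNReal) • Measure.dirac x₀).real B)
          = (B.indicator (fun _ => 1) y + B.indicator (fun _ => 1) x₀) / 2 := by
        intro y
        simp only [Measure.real, Measure.add_apply, Measure.smul_apply, Measure.dirac_apply' _ hB]
        by_cases h1 : y ∈ B <;> by_cases h2 : x₀ ∈ B <;>
          simp [h1, h2, ENNReal.inv_two_add_inv_two]
      by_cases h : truncSign.{v} (n := n) t ⟨ε⟩ ∈ s'
      · rw [Set.indicator_of_mem (show (⟨ε⟩ : SignSpace.{v} n) ∈ truncSign t ⁻¹' s' from h),
          Set.indicator_of_mem (show (⟨ε⟩ : SignSpace.{v} n) ∈ truncSign t ⁻¹' s' from h), hc]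
        simp only [g, Set.indicator_of_mem h, one_mul]
        change _ - B.indicator (fun _ => (1 : ℝ)) (if ε t then x t (past t ε) else x₀) = _
        cases ε t
        · simp only [sgn, Bool.false_eq_true, if_false]
          ring
        · simp only [sgn, if_true]
          ring
      · rw [Set.indicator_of_notMem (show (⟨ε⟩ : SignSpace.{v} n) ∉ truncSign t ⁻¹' s' from h),
          Set.indicator_of_notMem (show (⟨ε⟩ : SignSpace.{v} n) ∉ truncSign t ⁻¹' s' from h)]
        simp [g, h]
    · have h := measurable_truncSign_comp.{v} (t : ℕ) fun ε : Fin n → Bool =>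
        ((2⁻¹ : ENNReal) • Measure.dirac (x t (past t ε))
          + (2⁻¹ : ENNReal) • Measure.dirac x₀).real B
      simp only [past_truncSign le_rfl] at h
      exact h.aestronglyMeasurable

theorem abs_coe_sub_integral_le (g : 𝒳 → Y) (x : 𝒳) (P : Measure 𝒳) [IsProbabilityMeasure P] :
    |(g x : ℝ) - ∫ x, (g x : ℝ) ∂P| ≤ 2 := by
  have h1 := abs_le.1 (abs_coe_le (g x))
  have h2 := abs_le.1 (abs_integral_le_of_abs_le P fun x => abs_coe_le (g x))
  rw [abs_le]; constructor <;> linarith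

theorem abs_deviation_le (S : FilteredProcess.{u, v} 𝒳 n) (ω : S.Ω) (g : 𝒳 → Y) :
    |(1 / n : ℝ) * ∑ t : Fin n, ((g (S.X t ω) : ℝ) - ∫ x, (g x : ℝ) ∂(S.cond t ω))| ≤ 2 := by
  refine abs_one_div_mul_le two_pos.le ((Finset.abs_sum_le_sum_abs _ _).trans ?_)
  refine (Finset.sum_le_sum (g := fun _ => (2 : ℝ)) fun t _ => ?_).trans (by simp [mul_comm])
  have := S.cond_prob t ω
  exact abs_coe_sub_integral_le g _ _

variable {F : Set (𝒳 → Y)}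

theorem martingaleDeviation_mem (hne : F.Nonempty) (S : FilteredProcess.{u, v} 𝒳 n) :
    martingaleDeviation F S ∈ Set.Icc (0 : ℝ) 2 := by
  have : Nonempty F := hne.to_subtype
  refine ⟨integral_nonneg fun ω => Real.iSup_nonneg fun f => abs_nonneg _, ?_⟩
  refine (le_abs_self _).trans (abs_integral_le_of_abs_le _ fun ω => abs_ciSup_le fun f => ?_)
  rw [abs_abs]
  exact abs_deviation_le S ω f

theorem bddAbove_martingaleDeviation (hne : F.Nonempty) : BddAbove (Set.range
    fun S : FilteredProcess.{u, v} 𝒳 n => martingaleDeviation F S) :=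
  ⟨2, by rintro _ ⟨S, rfl⟩; exact (martingaleDeviation_mem hne S).2⟩

theorem nonempty_filteredProcess [Nonempty 𝒳] : Nonempty (FilteredProcess.{u, v} 𝒳 n) :=
  ⟨treeProcess (fun _ _ => Classical.arbitrary 𝒳) (Classical.arbitrary 𝒳)⟩

theorem iSup_martingaleDeviation_mem [Nonempty 𝒳] (hne : F.Nonempty) (n : ℕ) :
    ⨆ S : FilteredProcess.{u, v} 𝒳 n, martingaleDeviation F S ∈ Set.Icc (0 : ℝ) 2 := by
  have := nonempty_filteredProcess.{u, v} (𝒳 := 𝒳) (n := n)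
  exact ⟨Real.iSup_nonneg fun S => (martingaleDeviation_mem hne S).1,
    ciSup_le fun S => (martingaleDeviation_mem hne S).2⟩

/-- The centred step of the coin process is half the signed difference `f (x t) - f x₀`. This
recovers the Rademacher sum up to the term at `x₀`, which is at most the modulus of a mean of signs,
uniformly in `f`. -/
theorem seqRadOn_le_martingaleDeviation (hne : F.Nonempty) (hF : PointwiseMeasurable F)
    (hn : 0 < n) (x : BinTree 𝒳 n) (x₀ : 𝒳) {η : ℝ} (hη : 0 < η) :
    seqRadOn F x ≤ 2 * martingaleDeviation F (treeProcess.{u, v} x x₀)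
      + (η + 1 / (4 * η * n)) := by
  have : Nonempty F := hne.to_subtype
  have hn' : (0 : ℝ) < n := by exact_mod_cast hn
  let S := treeProcess.{u, v} x x₀
  let dev : SignSpace.{v} n → ℝ := fun ω => ⨆ f : F, |(1 / n : ℝ) * ∑ t : Fin n,
    (((f : 𝒳 → Y) (S.X t ω) : ℝ) - ∫ x, ((f : 𝒳 → Y) x : ℝ) ∂(S.cond t ω))|
  have hdev : martingaleDeviation F S = (1 / 2 ^ n : ℝ) * ∑ ε : Fin n → Bool, dev ⟨ε⟩ :=
    integral_signLaw dev
  have hterm : ∀ (f : F) (ε : Fin n → Bool) (t : Fin n),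
      ((f : 𝒳 → Y) (S.X t ⟨ε⟩) : ℝ) - ∫ x, ((f : 𝒳 → Y) x : ℝ) ∂(S.cond t ⟨ε⟩)
      = sgn (ε t) * (((f : 𝒳 → Y) (x t (past t ε)) : ℝ) - ((f : 𝒳 → Y) x₀ : ℝ)) / 2 := by
    intro f ε t
    have hf : StronglyMeasurable fun x : 𝒳 => ((f : 𝒳 → Y) x : ℝ) :=
      (measurable_subtype_coe.comp (hF.measurable f f.2)).stronglyMeasurable
    have hfi : ∀ P : Measure 𝒳, IsProbabilityMeasure P →
        Integrable (fun x : 𝒳 => ((f : 𝒳 → Y) x : ℝ)) P := fun P _ =>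
      .of_bound hf.aestronglyMeasurable 1 (.of_forall fun x => abs_coe_le _)
    have h1 : ∫ x, ((f : 𝒳 → Y) x : ℝ) ∂(S.cond t ⟨ε⟩)
        = (((f : 𝒳 → Y) (x t (past t ε)) : ℝ) + ((f : 𝒳 → Y) x₀ : ℝ)) / 2 := by
      change ∫ x, ((f : 𝒳 → Y) x : ℝ) ∂((2⁻¹ : ENNReal) • Measure.dirac (x t (past t ε))
        + (2⁻¹ : ENNReal) • Measure.dirac x₀) = _
      rw [integral_add_measure ((hfi _ inferInstance).smul_measure (by finiteness))
        ((hfi _ inferInstance).smul_measure (by finiteness)), integral_smul_measure,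
        integral_smul_measure, integral_dirac' _ _ hf, integral_dirac' _ _ hf]
      simp; ring
    rw [h1]
    change ((f : 𝒳 → Y) (if ε t then x t (past t ε) else x₀) : ℝ) - _ = _
    cases ε t <;> simp [sgn] <;> ring
  have hpt : ∀ ε : Fin n → Bool, (⨆ f : F, (1 / n : ℝ) * ∑ t : Fin n,
      sgn (ε t) * ((f : 𝒳 → Y) (x t (past t ε)) : ℝ))
      ≤ 2 * dev ⟨ε⟩ + (η + (∑ t, sgn (ε t)) ^ 2 / (4 * η * n ^ 2)) := by
    intro ε
    refine ciSup_le fun f => ?_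
    have h1 : |(1 / n : ℝ) * ∑ t : Fin n, (((f : 𝒳 → Y) (S.X t ⟨ε⟩) : ℝ)
        - ∫ x, ((f : 𝒳 → Y) x : ℝ) ∂(S.cond t ⟨ε⟩))| ≤ dev ⟨ε⟩ :=
      le_ciSup (f := fun f : F => |(1 / n : ℝ) * ∑ t : Fin n, (((f : 𝒳 → Y) (S.X t ⟨ε⟩) : ℝ)
        - ∫ x, ((f : 𝒳 → Y) x : ℝ) ∂(S.cond t ⟨ε⟩))|)
        (bddAbove_of_abs_le (C := 2) fun f : F => by
          rw [abs_abs]; exact abs_deviation_le S ⟨ε⟩ f) f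
    have h2 : (1 / n : ℝ) * ∑ t : Fin n, (((f : 𝒳 → Y) (S.X t ⟨ε⟩) : ℝ)
        - ∫ x, ((f : 𝒳 → Y) x : ℝ) ∂(S.cond t ⟨ε⟩))
        = ((1 / n : ℝ) * ∑ t : Fin n, sgn (ε t) * ((f : 𝒳 → Y) (x t (past t ε)) : ℝ)
          - (∑ t, sgn (ε t)) / n * ((f : 𝒳 → Y) x₀ : ℝ)) / 2 := by
      simp only [hterm, mul_sub, sub_div, Finset.sum_sub_distrib, ← Finset.sum_div,
        ← Finset.sum_mul]
      ring
    have h3 := (le_abs_self _).trans h1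
    rw [h2] at h3
    set y := (∑ t, sgn (ε t)) / n with hy
    have h4 : y * ((f : 𝒳 → Y) x₀ : ℝ) ≤ |y| := by
      refine (le_abs_self _).trans ?_
      rw [abs_mul]
      exact mul_le_of_le_one_right (abs_nonneg _) (abs_coe_le _)
    -- The arithmetic–geometric inequality replaces the modulus by a square, whose mean is exactly
    -- computable.
    have h5 : |y| ≤ η + (∑ t, sgn (ε t)) ^ 2 / (4 * η * n ^ 2) := by
      have h6 : (∑ t, sgn (ε t)) ^ 2 / (4 * η * n ^ 2) = |y| ^ 2 / (4 * η) := by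
        rw [sq_abs, hy]; field_simp
      have h7 : η + |y| ^ 2 / (4 * η) - |y| = (2 * η - |y|) ^ 2 / (4 * η) := by
        field_simp; ring
      have h8 : 0 ≤ (2 * η - |y|) ^ 2 / (4 * η) := by positivity
      rw [h6]; linarith
    linarith
  calc seqRadOn F x ≤ (1 / 2 ^ n : ℝ) * ∑ ε : Fin n → Bool,
        (2 * dev ⟨ε⟩ + (η + (∑ t, sgn (ε t)) ^ 2 / (4 * η * n ^ 2))) :=
      mul_le_mul_of_nonneg_left (Finset.sum_le_sum fun ε _ => hpt ε) (by positivity)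
    _ = 2 * ((1 / 2 ^ n : ℝ) * ∑ ε : Fin n → Bool, dev ⟨ε⟩) + (η + 1 / (4 * η * n)) := by
      rw [Finset.sum_add_distrib, Finset.sum_add_distrib, ← Finset.mul_sum, ← Finset.sum_div,
        sum_sgn_sq]
      simp only [Finset.sum_const, Finset.card_univ, Fintype.card_fun, Fintype.card_bool,
        Fintype.card_fin, nsmul_eq_mul]
      push_cast
      field_simp
    _ = _ := by rw [← hdev]

theorem seqRad_tendsto_of_UMLLN [Nonempty 𝒳] (hne : F.Nonempty)
    (hF : PointwiseMeasurable F) (h : UMLLN.{u, v} F) : limsup (seqRad F) atTop = 0 := by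
  have h1 := (limsup_eq_zero_iff (fun n => (iSup_martingaleDeviation_mem hne n).1)
    fun n => (iSup_martingaleDeviation_mem hne n).2).1 h
  refine (limsup_eq_zero_iff (seqRad_nonneg hne) (seqRad_le hne)).2 fun ε hε => ?_
  have h2 : ∀ᶠ n : ℕ in atTop, 1 / (4 * (ε / 4) * n) ≤ ε / 4 := by
    have h3 : Tendsto (fun n : ℕ => 1 / (4 * (ε / 4) * (n : ℝ))) atTop (𝓝 0) :=
      Tendsto.div_atTop tendsto_const_nhds
        (Tendsto.const_mul_atTop (by positivity) tendsto_natCast_atTop_atTop)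
    exact (h3.eventually (gt_mem_nhds (show 0 < ε / 4 by positivity))).mono fun n hn => hn.le
  filter_upwards [h1 (ε / 4) (by positivity), h2, eventually_gt_atTop 0] with n hn hn2 hn0
  have : Nonempty (BinTree 𝒳 n) := ⟨fun _ _ => Classical.arbitrary 𝒳⟩
  refine ciSup_le fun x => ?_
  have h4 := seqRadOn_le_martingaleDeviation.{u, v} hne hF hn0 x (Classical.arbitrary 𝒳)
    (show 0 < ε / 4 by positivity)
  have h5 := le_ciSup (bddAbove_martingaleDeviation.{u, v} (n := n) hne)
    (treeProcess x (Classical.arbitrary 𝒳))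
  linarith

end signs

/-! ### Reduction to a sequence of functions -/

section enumeration

variable {𝒳 : Type u} {F : Set (𝒳 → Y)}

/-- A class of finite sequential fat-shattering dimension does not shatter deep trees. -/
theorem exists_not_fatShatters {I : Type*} {f : I → 𝒳 → Y} (hf : ∀ i, f i ∈ F) {γ : ℝ}
    (h : sfat F γ < ⊤) :
    ∃ D, ∀ V : Set I, ¬ FatShatters (fun i x => (f i x : ℝ)) γ D V := by
  obtain ⟨N, hN⟩ := ENat.ne_top_iff_exists.1 h.ne
  refine ⟨N + 1, fun V hV => ?_⟩
  obtain ⟨x, s, hxs⟩ := hV.exists_tree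
  have h1 : ((N + 1 : ℕ) : ℕ∞) ≤ sfat F γ := by
    refine le_iSup₂_of_le (N + 1) ⟨x, s, fun ε => ?_⟩ le_rfl
    obtain ⟨i, -, hi⟩ := hxs ε
    exact ⟨f i, hf i, hi⟩
  rw [← hN] at h1
  have h2 : N + 1 ≤ N := by exact_mod_cast h1
  omega

theorem tendsto_absLoss {h : ℕ → 𝒳 → Y} {g : 𝒳 → Y}
    (hg : ∀ x, Tendsto (fun k => h k x) atTop (𝓝 (g x))) (z : Z 𝒳) :
    Tendsto (fun k => absLoss (h k) z) atTop (𝓝 (absLoss g z)) :=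
  (tendsto_const_nhds.sub ((continuous_subtype_val.tendsto _).comp (hg z.1))).abs

variable [MeasurableSpace 𝒳]

/-- The sequence `f` of members of `F` is dense in `F` for pointwise sequential convergence. -/
structure DenseSeqIn (F : Set (𝒳 → Y)) (f : ℕ → 𝒳 → Y) : Prop where
  mem : ∀ i, f i ∈ F
  measurable : ∀ i, Measurable (f i)
  exists_tendsto : ∀ g ∈ F, ∃ s : ℕ → ℕ, ∀ x, Tendsto (fun k => f (s k) x) atTop (𝓝 (g x))

theorem PointwiseMeasurable.exists_denseSeqIn (hne : F.Nonempty) (hF : PointwiseMeasurable F) :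
    ∃ f, DenseSeqIn F f := by
  obtain ⟨F₀, hF₀, hc, hlim⟩ := hF.separable
  obtain ⟨g₀, hg₀⟩ := hne
  obtain ⟨g, hg, -⟩ := hlim g₀ hg₀
  obtain ⟨f, rfl⟩ := hc.exists_eq_range ⟨g 0, hg 0⟩
  refine ⟨f, fun i => hF₀ ⟨i, rfl⟩, fun i => hF.measurable _ (hF₀ ⟨i, rfl⟩), fun g hg => ?_⟩
  obtain ⟨h, hh, hh'⟩ := hlim g hg
  choose s hs using hh
  exact ⟨s, fun x => by simpa only [hs] using hh' x⟩

variable {f : ℕ → 𝒳 → Y}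

/-- A functional continuous along pointwise limits does not see the difference between the class and
its dense sequence. Dominated convergence verifies this for the risks and means used below. -/
theorem DenseSeqIn.iSup_eq (hf : DenseSeqIn F f) {T : (𝒳 → Y) → ℝ} {C : ℝ}
    (hC : ∀ g, |T g| ≤ C) (hT : ∀ (h : ℕ → 𝒳 → Y) (g : 𝒳 → Y), (∀ k, Measurable (h k)) →
      (∀ x, Tendsto (fun k => h k x) atTop (𝓝 (g x))) →
      Tendsto (fun k => T (h k)) atTop (𝓝 (T g))) :
    ⨆ g : F, T g = ⨆ i, T (f i) := by
  have : Nonempty F := ⟨⟨_, hf.mem 0⟩⟩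
  refine le_antisymm (ciSup_le fun g => ?_) (ciSup_le fun i =>
    le_ciSup (f := fun g : F => T g) (bddAbove_of_abs_le fun g : F => hC g) ⟨f i, hf.mem i⟩)
  obtain ⟨s, hs⟩ := hf.exists_tendsto g g.2
  exact le_of_tendsto' (hT _ _ (fun k => hf.measurable (s k)) hs) fun k =>
    le_ciSup (bddAbove_of_abs_le fun i => hC (f i)) (s k)

theorem DenseSeqIn.iInf_eq (hf : DenseSeqIn F f) {T : (𝒳 → Y) → ℝ} {C : ℝ}
    (hC : ∀ g, |T g| ≤ C) (hT : ∀ (h : ℕ → 𝒳 → Y) (g : 𝒳 → Y), (∀ k, Measurable (h k)) →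
      (∀ x, Tendsto (fun k => h k x) atTop (𝓝 (g x))) →
      Tendsto (fun k => T (h k)) atTop (𝓝 (T g))) :
    ⨅ g : F, T g = ⨅ i, T (f i) := by
  have h := hf.iSup_eq (T := fun g => -T g) (fun g => by rw [abs_neg]; exact hC g)
    fun h g h1 h2 => (hT h g h1 h2).neg
  rw [iSup_neg_eq, iSup_neg_eq] at h
  linarith

theorem tendsto_risk {h : ℕ → 𝒳 → Y} {g : 𝒳 → Y} (hm : ∀ k, Measurable (h k))
    (hg : ∀ x, Tendsto (fun k => h k x) atTop (𝓝 (g x))) (P : Measure (Z 𝒳))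
    [IsProbabilityMeasure P] : Tendsto (fun k => risk P (h k)) atTop (𝓝 (risk P g)) :=
  tendsto_integral_of_dominated_convergence (fun _ => 2)
    (fun k => (measurable_absLoss (hm k)).aestronglyMeasurable) (integrable_const _)
    (fun k => .of_forall fun z => abs_absLoss_le (h k) z)
    (.of_forall fun z => tendsto_absLoss hg z)

theorem tendsto_integral_coe {h : ℕ → 𝒳 → Y} {g : 𝒳 → Y} (hm : ∀ k, Measurable (h k))
    (hg : ∀ x, Tendsto (fun k => h k x) atTop (𝓝 (g x))) (P : Measure 𝒳)
    [IsProbabilityMeasure P] :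
    Tendsto (fun k => ∫ x, (h k x : ℝ) ∂P) atTop (𝓝 (∫ x, (g x : ℝ) ∂P)) :=
  tendsto_integral_of_dominated_convergence (fun _ => 1)
    (fun k => (measurable_subtype_coe.comp (hm k)).aestronglyMeasurable) (integrable_const _)
    (fun k => .of_forall fun x => abs_coe_le (h k x))
    (.of_forall fun x => (continuous_subtype_val.tendsto _).comp (hg x))

end enumeration

/-! ### Finite dimension implies the uniform martingale law -/

section UMLLN

variable {𝒳 : Type u} {F : Set (𝒳 → Y)} {f : ℕ → 𝒳 → Y} {n : ℕ}

/-- The values of the functions `f i` and `-f i`. -/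
def signedEval (f : ℕ → 𝒳 → Y) (x : 𝒳) (p : ℕ × Bool) : ℝ := sgn p.2 * (f p.1 x : ℝ)

theorem abs_signedEval_le (f : ℕ → 𝒳 → Y) (x : 𝒳) (p : ℕ × Bool) : |signedEval f x p| ≤ 1 := by
  rw [signedEval, abs_mul, abs_sgn, one_mul]; exact abs_coe_le _

/-- Oscillations of signed values are controlled by those of `f` only between indices of equal sign,
hence the cover by the two sign classes. -/
theorem eventually_condRad_signedEval_le (hf : ∀ i, f i ∈ F)
    (h : ∀ γ : ℝ, 0 < γ → sfat F γ < ⊤) (d : ℕ → 𝒳) {η : ℝ} (hη : 0 < η) :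
    ∀ᶠ n : ℕ in atTop, condRad (fun m => signedEval f (d m)) n 0 ≤ η * n := by
  refine eventually_condRad_le (f := fun p : ℕ × Bool => fun x => (f p.1 x : ℝ)) d
    (fun p x => abs_coe_le _) (fun m p => (abs_signedEval_le f _ p).trans one_le_two)
    (fun b : Bool => {p : ℕ × Bool | p.2 = b}) (fun p => ⟨p.2, rfl⟩) ?_ ?_ hη
  · rintro b m ⟨i, _⟩ rfl ⟨j, _⟩ rfl
    simp only [signedEval]
    rw [← mul_sub, abs_mul, abs_sgn, one_mul]
  · intro γ hγ
    obtain ⟨D, hD⟩ := exists_not_fatShatters (f := fun p : ℕ × Bool => f p.1)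
      (fun p => hf p.1) (h γ hγ)
    exact ⟨D, fun b => hD _⟩

variable [MeasurableSpace 𝒳]

/-- Turns the almost sure identity of conditional probabilities, given set by set, into the
disintegration required by the martingale bound. -/
theorem FilteredProcess.setLIntegral_cond (S : FilteredProcess.{u, v} 𝒳 n) (t : Fin n)
    {A : Set S.Ω} (hA : MeasurableSet[S.𝓐 t] A) {B : Set 𝒳} (hB : MeasurableSet B) :
    ∫⁻ ω in A, S.cond t ω B ∂S.μ = S.μ (A ∩ S.X t ⁻¹' B) := by
  have hp := S.cond_prob t
  have hX : Measurable (S.X t) := (S.adapted t).mono (S.𝓐.le _) le_rfl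
  have hm : Measurable fun ω => (S.cond t ω).real B :=
    (((Measure.measurable_coe hB).comp (S.cond_measurable t)).mono (S.𝓐.le _) le_rfl).ennreal_toReal
  have h1 : ∫ ω in A, (S.cond t ω).real B ∂S.μ = S.μ.real (A ∩ S.X t ⁻¹' B) := by
    rw [setIntegral_congr_ae (S.𝓐.le t A hA) ((S.cond_eq t B hB).mono fun ω hω _ => hω),
      setIntegral_condExp (S.𝓐.le t) ((integrable_const _).indicator (hX hB)) hA,
      setIntegral_indicator (hX hB)]
    simp
  have h2 : ∫⁻ ω in A, S.cond t ω B ∂S.μ = ENNReal.ofReal (∫ ω in A, (S.cond t ω).real B ∂S.μ) := by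
    rw [ofReal_integral_eq_lintegral_ofReal]
    · refine lintegral_congr fun ω => ?_
      rw [Measure.real, ENNReal.ofReal_toReal (measure_ne_top _ _)]
    · exact .of_bound hm.aestronglyMeasurable 1 (.of_forall fun ω => by
        rw [Real.norm_of_nonneg measureReal_nonneg]; exact measureReal_le_one)
    · exact .of_forall fun ω => measureReal_nonneg
  rw [h2, h1, Measure.real, ENNReal.ofReal_toReal (measure_ne_top _ _)]

theorem martingaleDeviation_le (hf : DenseSeqIn F f) {d : ℕ → 𝒳}
    (hd : ∀ x, signedEval f x ∈ closure (Set.range fun m => signedEval f (d m)))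
    (S : FilteredProcess.{u, v} 𝒳 n) :
    martingaleDeviation F S ≤ (1 / n : ℝ) * condRad (fun m => signedEval f (d m)) n 0 := by
  have hp := S.cond_prob
  -- The absolute value becomes a supremum over both signs, absorbed into the index set `ℕ × Bool`.
  have key : ∀ ω, ⨆ g : F, |(1 / n : ℝ) * ∑ t : Fin n,
      (((g : 𝒳 → Y) (S.X t ω) : ℝ) - ∫ x, ((g : 𝒳 → Y) x : ℝ) ∂(S.cond t ω))|
      = (1 / n : ℝ) * ⨆ p, ∑ t : Fin n, (signedEval f (S.X t ω) p
        - ∫ x, signedEval f x p ∂(S.cond t ω)) := by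
    intro ω
    rw [hf.iSup_eq (T := fun g => |(1 / n : ℝ) * ∑ t : Fin n,
      ((g (S.X t ω) : ℝ) - ∫ x, (g x : ℝ) ∂(S.cond t ω))|)
      (fun g => by rw [abs_abs]; exact abs_deviation_le S ω g) (fun h g hm hg =>
        ((tendsto_finsetSum _ fun t _ => ((continuous_subtype_val.tendsto _).comp
          (hg (S.X t ω))).sub (tendsto_integral_coe hm hg (S.cond t ω))).const_mul _).abs)]
    have e1 : ∀ p : ℕ × Bool, (1 / n : ℝ) * ∑ t : Fin n, (signedEval f (S.X t ω) p
        - ∫ x, signedEval f x p ∂(S.cond t ω)) = sgn p.2 * ((1 / n : ℝ) * ∑ t : Fin n,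
        ((f p.1 (S.X t ω) : ℝ) - ∫ x, (f p.1 x : ℝ) ∂(S.cond t ω))) := by
      intro p
      simp only [signedEval, integral_const_mul, ← mul_sub, ← Finset.mul_sum]
      ring
    rw [Real.mul_iSup_of_nonneg (by positivity)]
    simp only [e1]
    have hb := fun i => abs_deviation_le S ω (f i)
    set A : ℕ → ℝ := fun i => (1 / n : ℝ) * ∑ t : Fin n,
      ((f i (S.X t ω) : ℝ) - ∫ x, (f i x : ℝ) ∂(S.cond t ω)) with hA
    change ⨆ i, |A i| = ⨆ p : ℕ × Bool, sgn p.2 * A p.1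
    have hb1 : BddAbove (Set.range fun i => |A i|) :=
      bddAbove_of_abs_le (C := 2) fun i => by rw [abs_abs]; exact hb i
    have hb2 : BddAbove (Set.range fun p : ℕ × Bool => sgn p.2 * A p.1) :=
      bddAbove_of_abs_le (C := 2) fun p => by
        rw [abs_mul, abs_sgn, one_mul]; exact hb p.1
    refine le_antisymm (ciSup_le fun i => ?_) (ciSup_le fun p => ?_)
    · refine abs_le'.2 ⟨?_, ?_⟩
      · simpa [sgn] using le_ciSup hb2 (i, true)
      · simpa [sgn] using le_ciSup hb2 (i, false)
    · refine le_trans ?_ (le_ciSup hb1 p.1)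
      refine (le_abs_self _).trans ?_
      rw [abs_mul, abs_sgn, one_mul]
  simp only [martingaleDeviation, key]
  rw [integral_const_mul]
  refine mul_le_mul_of_nonneg_left ?_ (by positivity)
  refine integral_iSup_sum_le (e := signedEval f) (m := fun t => S.𝓐 t) ?_
    (fun x p => (abs_signedEval_le f x p).trans one_le_two) hd S.μ (fun t => S.𝓐.le t)
    (fun t => (S.adapted t).mono (S.𝓐.le _) le_rfl) S.cond_measurable S.cond_prob ?_
    (fun s t hst => S.𝓐.mono (show (s : ℕ) ≤ t from hst.le))
    (fun t A B hA hB => S.setLIntegral_cond t hA hB)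
  · exact fun p => (measurable_subtype_coe.comp (hf.measurable p.1)).const_mul _
  · exact fun s t hst => (S.adapted s).mono (S.𝓐.mono (show (s : ℕ) + 1 ≤ t from hst)) le_rfl

theorem UMLLN_of_sfat [Nonempty 𝒳] (hne : F.Nonempty)
    (hF : PointwiseMeasurable F) (h : ∀ γ : ℝ, 0 < γ → sfat F γ < ⊤) : UMLLN.{u, v} F := by
  obtain ⟨f, hf⟩ := hF.exists_denseSeqIn hne
  obtain ⟨d, hd⟩ := exists_dense_seq (signedEval f)
  refine (limsup_eq_zero_iff (fun n => (iSup_martingaleDeviation_mem hne n).1)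
    fun n => (iSup_martingaleDeviation_mem hne n).2).2 fun ε hε => ?_
  filter_upwards [eventually_condRad_signedEval_le hf.mem h d hε, eventually_gt_atTop 0]
    with n hn hn0
  have hn' : (0 : ℝ) < n := by exact_mod_cast hn0
  have := nonempty_filteredProcess.{u, v} (𝒳 := 𝒳) (n := n)
  refine ciSup_le fun S => (martingaleDeviation_le hf hd S).trans ?_
  rw [one_div, inv_mul_le_iff₀ hn', mul_comm]
  exact hn

end UMLLN

/-! ### Finite dimension implies prequential learnability -/

section prequential

variable {𝒳 : Type u} {F : Set (𝒳 → Y)} {f : ℕ → 𝒳 → Y} {n : ℕ}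

/-- The losses of the functions `f i`. -/
def lossEval (f : ℕ → 𝒳 → Y) (z : Z 𝒳) (i : ℕ) : ℝ := absLoss (f i) z

/-- The loss is 1-Lipschitz in the prediction, so a single piece suffices, with the first components
of the outcomes as query points. -/
theorem eventually_condRad_lossEval_le (hf : ∀ i, f i ∈ F)
    (h : ∀ γ : ℝ, 0 < γ → sfat F γ < ⊤) (d : ℕ → Z 𝒳) {η : ℝ} (hη : 0 < η) :
    ∀ᶠ n : ℕ in atTop, condRad (fun m => lossEval f (d m)) n 0 ≤ η * n := by
  refine eventually_condRad_le (f := fun i x => (f i x : ℝ)) (fun m => (d m).1)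
    (fun i x => abs_coe_le _) (fun m i => abs_absLoss_le _ _)
    (fun _ : Unit => Set.univ) (fun i => ⟨(), trivial⟩) ?_ ?_ hη
  · intro _ m i _ j _
    simp only [absLoss]
    refine (abs_abs_sub_abs_le_abs_sub _ _).trans (le_of_eq ?_)
    rw [sub_sub_sub_cancel_left, abs_sub_comm]
  · intro γ hγ
    obtain ⟨D, hD⟩ := exists_not_fatShatters hf (h γ hγ)
    exact ⟨D, fun _ => hD _⟩

variable [MeasurableSpace 𝒳]

/-- The rule that plays, at time `t`, the function whose index is drawn from the law with
number `c t` of the past. -/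
def mixtureRule (hf : DenseSeqIn F f) (q : ℕ → Measure ℕ) (hq : ∀ c, IsProbabilityMeasure (q c))
    (c : (t : Fin n) → (Fin t → Z 𝒳) → ℕ) (hc : ∀ t, Measurable (c t)) : LearningRule F n where
  -- One seed is drawn for all times, and its coordinate `c` has law `q c`. Draws at different times
  -- may be dependent; the expected regret is a sum over rounds and does not notice.
  Seed := ℕ → ℕ
  seedLaw := Measure.infinitePi q
  rule t h r := ⟨f (r (c t h)), hf.mem _⟩
  measurable_rule t := by
    have h1 : Measurable fun p : ℕ × 𝒳 => f p.1 p.2 :=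
      measurable_from_prod_countable_right fun i => hf.measurable i
    have h2 : Measurable fun p : ℕ × (ℕ → ℕ) => p.2 p.1 :=
      measurable_from_prod_countable_right fun i => measurable_pi_apply i
    exact h1.comp ((h2.comp (((hc t).comp measurable_fst).prodMk
      (measurable_fst.comp measurable_snd))).prodMk (measurable_snd.comp measurable_snd))

theorem JointLaw.setLIntegral_cond (P : JointLaw 𝒳 n) (t : Fin n) {A : Set (Fin t → Z 𝒳)}
    (hA : MeasurableSet A) {B : Set (Z 𝒳)} (hB : MeasurableSet B) :
    ∫⁻ z in past t ⁻¹' A, P.cond t (past t z) B ∂P.law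
      = P.law (past t ⁻¹' A ∩ (fun z => z t) ⁻¹' B) := by
  have h := congrArg (fun μ => μ (A ×ˢ B)) (P.cond_eq t)
  have : IsProbabilityMeasure (P.law.map (past t)) :=
    Measure.isProbabilityMeasure_map (measurable_past t).aemeasurable
  rw [Measure.compProd_apply_prod hA hB, setLIntegral_map hA ((P.cond t).measurable_coe hB)
    (measurable_past t), Measure.map_apply ((measurable_past t).prodMk (measurable_pi_apply t))
    (hA.prod hB)] at h
  exact h

theorem integral_iSup_loss_le (hf : DenseSeqIn F f) {d : ℕ → Z 𝒳}
    (hd : ∀ x, lossEval f x ∈ closure (Set.range fun m => lossEval f (d m)))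
    (P : JointLaw 𝒳 n) :
    ∫ z, ⨆ i, ∑ t, (lossEval f (z t) i - ∫ x, lossEval f x i ∂(P.cond t (past t z))) ∂P.law
      ≤ condRad (fun m => lossEval f (d m)) n 0 := by
  refine integral_iSup_sum_le (e := lossEval f) (X := fun t z => z t)
    (m := fun t => MeasurableSpace.comap (past t) inferInstance)
    (fun i => measurable_absLoss (hf.measurable i)) (fun z i => abs_absLoss_le _ _) hd P.law
    (fun t => (measurable_past t).comap_le) (fun t => measurable_pi_apply t)
    (κ := fun t z => P.cond t (past t z))
    (fun t => (P.cond t).measurable.comp (comap_measurable _)) (fun t z => inferInstance)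
    ?_ ?_ ?_
  · intro s t hst
    have h : Measurable fun y : Fin t → Z 𝒳 => y ⟨s, hst⟩ := measurable_pi_apply _
    exact h.comp (comap_measurable (past t))
  · intro s t hst
    have h : Measurable fun (y : Fin t → Z 𝒳) (i : Fin s) => y ⟨i, i.2.trans hst⟩ :=
      measurable_pi_lambda _ fun i => measurable_pi_apply _
    exact (h.comp (comap_measurable (past t))).comap_le
  · rintro t _ B ⟨A, hA, rfl⟩ hB
    exact P.setLIntegral_cond t hA hB

/-- The rule's expected conditional risk equals its expected realized loss. Only the comparator
changes when realized losses replace risks, and the cost is a uniform martingale deviation of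
losses. -/
theorem preqRegret_mixtureRule_le (hf : DenseSeqIn F f) {d : ℕ → Z 𝒳}
    (hd : ∀ x, lossEval f x ∈ closure (Set.range fun m => lossEval f (d m)))
    {q : ℕ → Measure ℕ} (hq : ∀ c, IsProbabilityMeasure (q c))
    {c : (t : Fin n) → (Fin t → Z 𝒳) → ℕ} (hc : ∀ t, Measurable (c t)) {K : ℝ}
    (hK : ∀ z : Fin n → Z 𝒳, ∑ t, ∫ i, lossEval f (z t) i ∂(q (c t (past t z)))
      - ⨅ i, ∑ t, lossEval f (z t) i ≤ K) (P : JointLaw 𝒳 n) :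
    preqRegret (mixtureRule hf q hq c hc) P
      ≤ (1 / n : ℝ) * (K + condRad (fun m => lossEval f (d m)) n 0) := by
  set L := P.law
  let S : Measure (ℕ → ℕ) := Measure.infinitePi q
  have hmi : ∀ i, Measurable fun z => lossEval f z i := fun i => measurable_absLoss (hf.measurable i)
  have hbi : ∀ z i, |lossEval f z i| ≤ 2 := fun z i => abs_absLoss_le _ _
  let r : Fin n → (Fin n → Z 𝒳) → ℕ → ℝ := fun t z i => risk (P.cond t (past t z)) (f i)
  have hr : ∀ t i, Measurable fun z => r t z i := fun t i =>
    (measurable_integral_apply (P.cond t).measurable (fun h => inferInstance) (hmi i)).comp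
      (measurable_past t)
  have hrb : ∀ t z i, |r t z i| ≤ 2 := fun t z i => abs_risk_le _ _
  let J : (Fin n → Z 𝒳) → ℝ := fun z => ⨅ i, ∑ t, r t z i
  have hJ : ∀ z, ⨅ g : F, (1 / n : ℝ) * ∑ t : Fin n, risk (P.cond t (past t z)) (g : 𝒳 → Y)
      = (1 / n : ℝ) * J z := by
    intro z
    rw [hf.iInf_eq (T := fun g => (1 / n : ℝ) * ∑ t : Fin n, risk (P.cond t (past t z)) g)
      (C := 2), Real.mul_iInf_of_nonneg (by positivity)]
    · intro g
      refine abs_one_div_mul_le two_pos.le ?_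
      have := sum_mem_Icc fun t => ⟨risk_nonneg (P.cond t (past t z)) g, risk_le _ _⟩
      rw [abs_le]; constructor <;> linarith [this.1, this.2]
    · exact fun h g hm hg => (tendsto_finsetSum _ fun t _ =>
        tendsto_risk hm hg (P.cond t (past t z))).const_mul _
  have hJm : Measurable J := Measurable.iInf fun i => Finset.measurable_sum _ fun t _ => hr t i
  have hsum : ∀ u : Fin n → ℝ, (∀ t, |u t| ≤ 2) → |∑ t, u t| ≤ n * 2 := fun u hu =>
    (Finset.abs_sum_le_sum_abs _ _).trans ((Finset.sum_le_sum fun t _ => hu t).trans (by simp))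
  have hJb : ∀ z, |J z| ≤ n * 2 := fun z => abs_ciInf_le fun i => hsum _ fun t => hrb t z i
  -- the index played at time `t`
  let idx : Fin n → (Fin n → Z 𝒳) × (ℕ → ℕ) → ℕ := fun t p => p.2 (c t (past t p.1))
  have hidx : ∀ t, Measurable (idx t) := fun t => by
    have h2 : Measurable fun p : ℕ × (ℕ → ℕ) => p.2 p.1 :=
      measurable_from_prod_countable_right fun i => measurable_pi_apply i
    exact h2.comp ((((hc t).comp (measurable_past t)).comp measurable_fst).prodMk measurable_snd)
  have hAm : ∀ t, Measurable fun p : (Fin n → Z 𝒳) × (ℕ → ℕ) => r t p.1 (idx t p) := fun t => by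
    have h1 : Measurable fun p : ℕ × (Fin n → Z 𝒳) => r t p.2 p.1 :=
      measurable_from_prod_countable_right fun i => hr t i
    exact h1.comp ((hidx t).prodMk measurable_fst)
  have hBm : ∀ t, Measurable fun p : (Fin n → Z 𝒳) × (ℕ → ℕ) => lossEval f (p.1 t) (idx t p) :=
    fun t => by
    have h1 : Measurable fun p : ℕ × (Fin n → Z 𝒳) => lossEval f (p.2 t) p.1 :=
      measurable_from_prod_countable_right fun i => (hmi i).comp (measurable_pi_apply t)
    exact h1.comp ((hidx t).prodMk measurable_fst)
  have hAi : ∀ t, Integrable (fun p : (Fin n → Z 𝒳) × (ℕ → ℕ) => r t p.1 (idx t p)) (L.prod S) :=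
    fun t => .of_bound (hAm t).aestronglyMeasurable 2 (.of_forall fun p => hrb _ _ _)
  have hBi : ∀ t, Integrable (fun p : (Fin n → Z 𝒳) × (ℕ → ℕ) =>
      lossEval f (p.1 t) (idx t p)) (L.prod S) :=
    fun t => .of_bound (hBm t).aestronglyMeasurable 2 (.of_forall fun p => hbi _ _)
  have hAB : ∀ t, ∫ p, r t p.1 (idx t p) ∂(L.prod S)
      = ∫ p, lossEval f (p.1 t) (idx t p) ∂(L.prod S) := by
    intro t
    -- With the seed held fixed, the index played at `t` is a function of the past, so the
    -- disintegration along `P.cond t` applies.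
    rw [integral_prod_symm _ (hAi t), integral_prod_symm _ (hBi t)]
    congr 1; funext s
    have hG : Measurable fun p : (Fin t → Z 𝒳) × Z 𝒳 => lossEval f p.2 (s (c t p.1)) := by
      have h1 : Measurable fun p : ℕ × Z 𝒳 => lossEval f p.2 (s p.1) :=
        measurable_from_prod_countable_right fun i => hmi (s i)
      exact h1.comp (((hc t).comp measurable_fst).prodMk measurable_snd)
    exact (integral_comp_pair_eq L (measurable_past t) (measurable_pi_apply t)
      (P.cond t).measurable (fun h => inferInstance)
      (fun A B hA hB => P.setLIntegral_cond t hA hB) hG fun p => hbi _ _).symm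
  let b : Fin n → (Fin n → Z 𝒳) → ℝ := fun t z => ∫ i, lossEval f (z t) i ∂(q (c t (past t z)))
  have hb : ∀ t z, ∫ s, lossEval f (z t) (idx t (z, s)) ∂S = b t z := by
    intro t z
    have h1 := measurePreserving_eval_infinitePi q (c t (past t z))
    have hm : Measurable fun i => lossEval f (z t) i := measurable_from_top
    have h2 := integral_map (μ := S) h1.measurable.aemeasurable
      (hm.aestronglyMeasurable (μ := S.map (Function.eval (c t (past t z)))))
    rw [h1.map_eq] at h2
    exact h2.symm
  have hbint : ∀ t, Integrable (b t) L := fun t => by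
    have := (hBi t).integral_prod_left
    simpa only [hb] using this
  have hpreq : preqRegret (mixtureRule hf q hq c hc) P
      = ∫ z, (1 / n : ℝ) * (∑ t, b t z - J z) ∂L := by
    have e1 : preqRegret (mixtureRule hf q hq c hc) P
        = ∫ p : (Fin n → Z 𝒳) × (ℕ → ℕ), ((1 / n : ℝ) * ∑ t, r t p.1 (idx t p)
          - (1 / n : ℝ) * J p.1) ∂(L.prod S) := by
      simp only [preqRegret, hJ]
      rfl
    have hJi : Integrable J L := .of_bound hJm.aestronglyMeasurable _ (.of_forall hJb)
    have hJi' : Integrable (fun p : (Fin n → Z 𝒳) × (ℕ → ℕ) => J p.1) (L.prod S) :=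
      .of_bound (hJm.comp measurable_fst).aestronglyMeasurable _ (.of_forall fun p => hJb p.1)
    rw [e1, integral_sub ((integrable_finsetSum _ fun t _ => hAi t).const_mul _)
      (hJi'.const_mul _), integral_const_mul, integral_const_mul,
      integral_finsetSum _ fun t _ => hAi t, integral_const_mul,
      integral_sub (integrable_finsetSum _ fun t _ => hbint t) hJi,
      integral_finsetSum _ fun t _ => hbint t, mul_sub]
    have e2 : ∀ t, ∫ p, r t p.1 (idx t p) ∂(L.prod S) = ∫ z, b t z ∂L := fun t => by
      rw [hAB t, integral_prod _ (hBi t)]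
      simp only [hb]
    have e3 : ∫ p : (Fin n → Z 𝒳) × (ℕ → ℕ), J p.1 ∂(L.prod S) = ∫ z, J z ∂L := by
      rw [integral_prod _ hJi']
      simp
    simp only [e2, e3]
  have hDb : ∀ z i, |∑ t, (lossEval f (z t) i - r t z i)| ≤ n * 4 := fun z i => by
    rw [Finset.sum_sub_distrib]
    have h1 := abs_le.1 (hsum (fun t => lossEval f (z t) i) fun t => hbi _ _)
    have h2 := abs_le.1 (hsum (fun t => r t z i) fun t => hrb t z i)
    rw [abs_le]; constructor <;> linarith
  have hDi : Integrable (fun z => ⨆ i, ∑ t, (lossEval f (z t) i - r t z i)) L :=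
    .of_bound (Measurable.iSup fun i => Finset.measurable_sum _ fun t _ =>
      ((hmi i).comp (measurable_pi_apply t)).sub (hr t i)).aestronglyMeasurable (n * 4)
      (.of_forall fun z => abs_ciSup_le (hDb z))
  have hJi : Integrable J L := .of_bound hJm.aestronglyMeasurable _ (.of_forall hJb)
  rw [hpreq, integral_const_mul]
  refine mul_le_mul_of_nonneg_left ?_ (by positivity)
  calc ∫ z, (∑ t, b t z - J z) ∂L
      ≤ ∫ z, (K + ⨆ i, ∑ t, (lossEval f (z t) i - r t z i)) ∂L := by
        refine integral_mono ((integrable_finsetSum _ fun t _ => hbint t).sub hJi)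
          ((integrable_const _).add hDi) fun z => ?_
        have h1 : ∑ t, b t z - ⨅ i, ∑ t, lossEval f (z t) i ≤ K := hK z
        -- For each index, realized losses exceed risks by at most the uniform deviation; this
        -- compares the two infima pathwise.
        have h2 : (⨅ i, ∑ t, lossEval f (z t) i)
            - ⨆ i, ∑ t, (lossEval f (z t) i - r t z i) ≤ J z := by
          refine le_ciInf fun i => ?_
          have h3 := ciInf_le (bddBelow_of_abs_le fun i => hsum (fun t => lossEval f (z t) i)
            fun t => hbi _ _) i
          have h4 := le_ciSup (bddAbove_of_abs_le (hDb z)) i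
          rw [Finset.sum_sub_distrib] at h4
          linarith
        dsimp only
        linarith
    _ = K + ∫ z, ⨆ i, ∑ t, (lossEval f (z t) i - r t z i) ∂L := by
        rw [integral_add (integrable_const _) hDi]; simp
    _ ≤ _ := by
        gcongr
        exact integral_iSup_loss_le hf hd P

theorem prequentiallyLearnable_of_sfat [Nonempty 𝒳] (hne : F.Nonempty)
    (hF : PointwiseMeasurable F) (h : ∀ γ : ℝ, 0 < γ → sfat F γ < ⊤) :
    PrequentiallyLearnable F := by
  obtain ⟨f, hf⟩ := hF.exists_denseSeqIn hne
  have : Nonempty (Z 𝒳) := ⟨(Classical.arbitrary 𝒳, ⟨0, by norm_num⟩)⟩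
  obtain ⟨d, hd⟩ := exists_dense_seq (lossEval f)
  obtain ⟨q, hq, hqd⟩ := exists_dense_laws
  have hrad : ∀ η > 0, ∀ᶠ n : ℕ in atTop, condRad (fun m => lossEval f (d m)) n 0 ≤ η * n :=
    fun η hη => eventually_condRad_lossEval_le hf.mem h d hη
  refine (limsup_eq_zero_iff (preqValue_nonneg hne hF) (preqValue_le hne hF)).2 fun ε hε => ?_
  filter_upwards [hrad (ε / 3) (by positivity), eventually_gt_atTop 0] with n hn hn0
  have hn' : (0 : ℝ) < n := by exact_mod_cast hn0
  obtain ⟨c, hc, hK⟩ := exists_strategy (e := lossEval f) (fun i => measurable_absLoss (hf.measurable i))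
    (fun z i => abs_absLoss_le _ _) hd hrad hq hqd n (show 0 < ε / 3 by positivity)
  have := nonempty_jointLaw (𝒳 := 𝒳) (n := n)
  refine (ciInf_le (bddBelow_preqValue hne hF) (mixtureRule hf q hq c hc)).trans
    (ciSup_le fun P => (preqRegret_mixtureRule_le hf hd hq hc hK P).trans ?_)
  -- Three equal shares of `ε n / 3`: the initial potential, the slack of the strategy, and the
  -- martingale deviation.
  rw [one_div, inv_mul_le_iff₀ hn']
  linarith

end prequential

end PreqRegression

end

theorem mainTheorem4 {𝒳 : Type u} [MeasurableSpace 𝒳] [Nonempty 𝒳]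
    (F : Set (𝒳 → PreqRegression.Y)) (hne : F.Nonempty)
    (hF : PreqRegression.PointwiseMeasurable F) :
    List.TFAE [
      PreqRegression.PrequentiallyLearnable F,
      PreqRegression.OnlineLearnable F,
      PreqRegression.UMLLN.{u, v} F,
      ∀ γ : ℝ, 0 < γ → PreqRegression.sfat F γ < ⊤,
      limsup (PreqRegression.seqRad F) atTop = 0] := by
  tfae_have 1 → 2 := PreqRegression.onlineLearnable_of_prequentiallyLearnable hne hF
  tfae_have 2 → 5 := PreqRegression.seqRad_tendsto_of_onlineLearnable hne hF
  tfae_have 5 → 4 := fun h γ hγ => PreqRegression.sfat_lt_top_of_seqRad hne h hγ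
  tfae_have 4 → 1 := PreqRegression.prequentiallyLearnable_of_sfat hne hF
  tfae_have 4 → 3 := PreqRegression.UMLLN_of_sfat hne hF
  tfae_have 3 → 5 := PreqRegression.seqRad_tendsto_of_UMLLN hne hF
  tfae_finish
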